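/- **Setting.** Let $(X,T,S(0),S(1),Y(0),Y(1),R)$ have distribution $\mathbb P$, where $T,R\in\{0,1\}$, $Y(t)\in\mathbb R$, and $X$, $S(t)$ take values in standard Borel spaces (e.g. Euclidean spaces); put $S=S(T)$, $Y=Y(T)$. The distribution is specified by $\mathbb P(R=1)\in[0,1]$ and the conditional distributions given $R=1$ and given $R=0$; $\mathbb P(R=1)=0$ is allowed, the conditional distribution given $R=1$ being part of the data. Let $\delta^*=\mathbb E[Y(1)]-\mathbb E[Y(0)]$, $e^*(X)=\mathbb P(T=1\mid X)$, $e^*(1,X)=\mathbb P(T=1\mid R=1,X)$, $\tilde\mu^*(t,X,S)=\mathbb E[Y\mid T=t,R=1,X,S]$, and, as Radon–Nikodym derivatives, $$\lambda^*(X)=\frac{f^*(X)}{f^*(X\mid R=1)},\qquad \lambda^*_t(S,X)=\frac{f^*(S\mid X,T=t)}{f^*(S\mid X,T=t,R=1)}\quad(t=0,1).$$ **Assumptions.** Fix $\varepsilon\in(0,1/2)$ and $C>0$. For $t=0,1$: $\mathbb E|Y(t)|<\infty$; $(Y(t),S(t))\perp T\mid X$; $R\perp Y(t)\mid (X,T=t,S(t))$,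 meaning that the conditional distribution of $Y(t)$ given $(X,T=t,S(t))$ is unchanged by further conditioning on $R=1$; $\varepsilon\le e^*(X)\le 1-\varepsilon$ a.s.; $0<e^*(1,X)<1$ a.s.; and $\lambda^*(X)$, $\lambda_t^*(S,X)$ are well defined (the measures in the numerators are absolutely continuous with respect to those in the denominators) and a.s. at most $C$. Neither $R\perp S(t)\mid T,X$ nor $R\perp T\mid X$ is assumed. Put $$\tilde\psi'=\frac{T\lambda^*(X)\lambda_1^*(S,X)}{e^*(1,X)}\bigl(Y-\tilde\mu^*(1,X,S)\bigr)-\frac{(1-T)\lambda^*(X)\lambda_0^*(S,X)}{1-e^*(1,X)}\bigl(Y-\tilde\mu^*(0,X,S)\bigr),$$ and assume $\mathbb E[\tilde\psi'^2\mid R=1]<\infty$. **Model.** One observes i.i.d. draws from the distribution of $(X,T,S,Y)$ given $R=1$, and the unconditional distribution of $(X,T,S)$ is known: the model consists of all distributions that satisfy the assumptions (with the same $\varepsilon,C$, and without the condition on $\tilde\psi'$) and have this known law of $(X,T,S)$. A regular submodel is a path $\gamma\mapsto\mathbb P_\gamma$ of such distributions, $\gamma$ near $0$, with $\mathbb P_0=\mathbb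 P$, along which the following is bounded near $\gamma=0$: the second moment, given $R=1$ under $\mathbb P_\gamma$, of the function obtained from $\tilde\psi'$ by using the density ratios and the labelled propensity score of $\mathbb P_\gamma$ and keeping $\tilde\mu^*$. Its score $g$, if it exists, is the square-integrable derivative at $\gamma=0$ in quadratic mean of the law of $(X,T,S,Y)$ given $R=1$. **Theorem.** $\tilde\psi'$ is the efficient influence function for $\delta^*$: along every regular submodel with a score $g$, the average treatment effect $\delta(\mathbb P_\gamma)$ is differentiable at $\gamma=0$ with derivative $\mathbb E[\tilde\psi' g\mid R=1]$, and $\tilde\psi'$ lies in the closed linear span in $L^2$ of all such scores. The efficiency lower bound for $\delta^*$, i.e. the supremum of the Cramér–Rao bounds $(\tfrac{d}{d\gamma}\delta(\mathbb P_\gamma)|_{\gamma=0})^2/\mathbb E[g^2\mid R=1]$ over all regular submodels with a score, is $$\tilde V'^*=\mathbb E[\tilde\psi'^2\mid R=1].$$ -/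

import Mathlib

open MeasureTheory ProbabilityTheory Filter Topology
open scoped ENNReal NNReal

noncomputable section

/-! ### Semiparametric efficiency for a model indexed by `Θ`

`obs θ` is the law of one observation under `θ`, `χ θ` is the real target parameter, and a
one-dimensional submodel is a path `ℝ → Θ`.  `Γ` is the collection of regular parametric submodels
through the truth that are contained in the model; the truth is the value of the path at `0`. -/

namespace Efficiency

variable {Θ W : Type*} [MeasurableSpace W]

/-- The path of laws `Q` is differentiable in quadratic mean at `0` with score `g`:
`g ∈ L²(Q 0)` and `∫ ((√q_γ - √q_0) / γ - g √q_0 / 2)² → 0` as `γ → 0`.  The densities of `Q γ` and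
`Q 0` are taken with respect to `Q γ + Q 0`; the integral does not depend on the dominating
measure. -/
def HasScore (Q : ℝ → Measure W) (g : W → ℝ) : Prop :=
  MemLp g 2 (Q 0) ∧
  Tendsto (fun γ : ℝ =>
      ∫⁻ w, ENNReal.ofReal
        (((√(((Q γ).rnDeriv (Q γ + Q 0) w).toReal) - √(((Q 0).rnDeriv (Q γ + Q 0) w).toReal)) / γ
          - g w * √(((Q 0).rnDeriv (Q γ + Q 0) w).toReal) / 2) ^ 2) ∂(Q γ + Q 0))
    (𝓝[≠] 0) (𝓝 0)

/-- The tangent set: all scores of the submodels in `Γ`. -/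
def tangentSet (obs : Θ → Measure W) (Γ : Set (ℝ → Θ)) : Set (W → ℝ) :=
  {g | ∃ path ∈ Γ, HasScore (fun γ => obs (path γ)) g}

/-- `ψ` is an influence function (a gradient) of `χ` at `θ₀`: it is square integrable, and along
every submodel that has a score `g` the parameter is differentiable with derivative `E[ψ g]`. -/
def IsInfluenceFunction (obs : Θ → Measure W) (χ : Θ → ℝ) (θ₀ : Θ) (Γ : Set (ℝ → Θ))
    (ψ : W → ℝ) : Prop :=
  MemLp ψ 2 (obs θ₀) ∧
  ∀ path ∈ Γ, ∀ g : W → ℝ, HasScore (fun γ => obs (path γ)) g →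
    HasDerivAt (fun γ => χ (path γ)) (∫ w, ψ w * g w ∂(obs θ₀)) 0

/-- The efficient influence function: the influence function that lies in the tangent space, the
closed linear span in `L²` of the tangent set. -/
def IsEfficientInfluenceFunction (obs : Θ → Measure W) (χ : Θ → ℝ) (θ₀ : Θ) (Γ : Set (ℝ → Θ))
    (ψ : W → ℝ) : Prop :=
  IsInfluenceFunction obs χ θ₀ Γ ψ ∧
  ∀ η : ℝ≥0∞, 0 < η → ∃ h ∈ Submodule.span ℝ (tangentSet obs Γ),
    eLpNorm (fun w => ψ w - h w) 2 (obs θ₀) < η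

/-- The efficiency lower bound: the supremum, over the submodels in `Γ`, of the Cramér-Rao bound
`(dχ/dγ)² / E[g²]` (in `[0, ∞]`, with `0 / 0 = 0` and `a / 0 = ∞` for `a > 0`). -/
def efficiencyLowerBound (obs : Θ → Measure W) (χ : Θ → ℝ) (θ₀ : Θ) (Γ : Set (ℝ → Θ)) : ℝ≥0∞ :=
  ⨆ (path : ℝ → Θ) (_ : path ∈ Γ) (g : W → ℝ) (_ : HasScore (fun γ => obs (path γ)) g)
    (d : ℝ) (_ : HasDerivAt (fun γ => χ (path γ)) d 0),
    ENNReal.ofReal (d ^ 2) / ENNReal.ofReal (∫ w, g w ^ 2 ∂(obs θ₀))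

end Efficiency

/-! ### Populations with surrogates, potential outcomes and partially observed outcomes -/

namespace Surrogate

/-- The complete data `(X, T, (S(0), S(1)), (Y(0), Y(1)))` of a unit, without the labelling
indicator; `true` is the treatment `1` and `false` is the treatment `0`. -/
abbrev FullData (𝒳 𝒮 : Type*) := 𝒳 × Bool × (Bool → 𝒮) × (Bool → ℝ)

/-- The observation `(X, T, S, Y)` on a labelled unit. -/
abbrev Obs (𝒳 𝒮 : Type*) := 𝒳 × Bool × 𝒮 × ℝ

variable {𝒳 𝒮 : Type*}

/-- The covariates `X`. -/
def cov (v : FullData 𝒳 𝒮) : 𝒳 := v.1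

/-- The treatment `T`. -/
def trt (v : FullData 𝒳 𝒮) : Bool := v.2.1

/-- The potential surrogate `S(t)`. -/
def surr (t : Bool) (v : FullData 𝒳 𝒮) : 𝒮 := v.2.2.1 t

/-- The potential outcome `Y(t)`. -/
def out (t : Bool) (v : FullData 𝒳 𝒮) : ℝ := v.2.2.2 t

/-- The actual surrogate `S = S(T)`. -/
def surrObs (v : FullData 𝒳 𝒮) : 𝒮 := surr (trt v) v

/-- The actual outcome `Y = Y(T)`. -/
def outObs (v : FullData 𝒳 𝒮) : ℝ := out (trt v) v

/-- `(X, T, S)`. -/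
def covTrtSurr (v : FullData 𝒳 𝒮) : 𝒳 × Bool × 𝒮 := (cov v, trt v, surrObs v)

/-- `(X, T, S, Y)`. -/
def observe (v : FullData 𝒳 𝒮) : Obs 𝒳 𝒮 := (cov v, trt v, surrObs v, outObs v)

/-- The event `T = t`. -/
def arm (t : Bool) : Set (FullData 𝒳 𝒮) := {v | trt v = t}

variable [MeasurableSpace 𝒳] [MeasurableSpace 𝒮]

lemma measurable_cov : Measurable (cov : FullData 𝒳 𝒮 → 𝒳) := measurable_fst

/-- A distribution of `(X, T, S(0), S(1), Y(0), Y(1), R)`, given by `P(R = 1)` and by the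
conditional distributions of the other variables given `R = 1` and given `R = 0`.  The conditional
distribution given `R = 1` is part of the data, so that `P(R = 1) = 0` (unlabelled data of
a larger order than labelled data) is allowed. -/
structure Population (𝒳 𝒮 : Type*) [MeasurableSpace 𝒳] [MeasurableSpace 𝒮] where
  /-- `P(R = 1)` -/
  rate : ℝ≥0
  rate_le_one : rate ≤ 1
  /-- the distribution given `R = 1` -/
  labelled : Measure (FullData 𝒳 𝒮)
  /-- the distribution given `R = 0` -/
  unlabelled : Measure (FullData 𝒳 𝒮)
  isProb_labelled : IsProbabilityMeasure labelled
  isProb_unlabelled : IsProbabilityMeasure unlabelled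

namespace Population

instance (p : Population 𝒳 𝒮) : IsProbabilityMeasure p.labelled := p.isProb_labelled

instance (p : Population 𝒳 𝒮) : IsProbabilityMeasure p.unlabelled := p.isProb_unlabelled

/-- The unconditional distribution of `(X, T, S(0), S(1), Y(0), Y(1))`. -/
def law (p : Population 𝒳 𝒮) : Measure (FullData 𝒳 𝒮) :=
  p.rate • p.labelled + (1 - p.rate) • p.unlabelled

instance (p : Population 𝒳 𝒮) : IsProbabilityMeasure p.law := by
  refine ⟨?_⟩
  have h : (p.rate : ℝ≥0∞) + ((1 - p.rate : ℝ≥0) : ℝ≥0∞) = 1 := by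
    rw [← ENNReal.coe_add, add_tsub_cancel_of_le p.rate_le_one, ENNReal.coe_one]
  rw [law, Measure.add_apply, Measure.smul_apply, Measure.smul_apply, measure_univ, measure_univ,
    ENNReal.smul_def, ENNReal.smul_def, smul_eq_mul, smul_eq_mul, mul_one, mul_one, h]

/-- The law of one observation `(X, T, S, Y)` given `R = 1`. -/
def obsLaw (p : Population 𝒳 𝒮) : Measure (Obs 𝒳 𝒮) := p.labelled.map observe

/-- The unconditional law of `(X, T, S)`. -/
def covTrtSurrLaw (p : Population 𝒳 𝒮) : Measure (𝒳 × Bool × 𝒮) := p.law.map covTrtSurr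

/-- The average treatment effect `E[Y(1)] - E[Y(0)]`. -/
def ate (p : Population 𝒳 𝒮) : ℝ := (∫ v, out true v ∂p.law) - ∫ v, out false v ∂p.law

/-- The propensity score `e(x) = P(T = 1 | X = x)`. -/
def propensity (p : Population 𝒳 𝒮) (x : 𝒳) : ℝ := (condDistrib trt cov p.law x).real {true}

/-- The labelled propensity score `e(1, x) = P(T = 1 | R = 1, X = x)`. -/
def propensityLabelled (p : Population 𝒳 𝒮) (x : 𝒳) : ℝ :=
  (condDistrib trt cov p.labelled x).real {true}

/-- The density ratio `λ(x) = f(x) / f(x | R = 1)`. -/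
def ratioCov (p : Population 𝒳 𝒮) (x : 𝒳) : ℝ :=
  ((p.law.map cov).rnDeriv (p.labelled.map cov) x).toReal

variable [StandardBorelSpace 𝒮] [Nonempty 𝒮]

/-- The conditional distribution of `S` given `X = x, T = t`. -/
def surrKernel (p : Population 𝒳 𝒮) (t : Bool) : Kernel 𝒳 𝒮 :=
  condDistrib surrObs cov (ProbabilityTheory.cond p.law (arm t))

/-- The conditional distribution of `S` given `X = x, T = t, R = 1`. -/
def surrKernelLabelled (p : Population 𝒳 𝒮) (t : Bool) : Kernel 𝒳 𝒮 :=
  condDistrib surrObs cov (ProbabilityTheory.cond p.labelled (arm t))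

/-- The density ratio `λ_t(s, x) = f(s | x, T = t) / f(s | x, T = t, R = 1)`. -/
def ratioSurr (p : Population 𝒳 𝒮) (t : Bool) (s : 𝒮) (x : 𝒳) : ℝ :=
  (Kernel.rnDeriv (p.surrKernel t) (p.surrKernelLabelled t) x s).toReal

/-- The regression function `μ̃(t, x, s) = E[Y | T = t, R = 1, X = x, S = s]`. -/
def outcomeReg (p : Population 𝒳 𝒮) (t : Bool) (x : 𝒳) (s : 𝒮) : ℝ :=
  ∫ y, y ∂(condDistrib outObs covTrtSurr p.labelled (x, t, s))

/-- The weighted residual with propensity and density ratios from `p` and regression function from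
`p₀`. -/
def weightedResidual (p p₀ : Population 𝒳 𝒮) : Obs 𝒳 𝒮 → ℝ := fun ⟨x, t, s, y⟩ =>
  (if t then 1 else 0) * p.ratioCov x * p.ratioSurr true s x / p.propensityLabelled x
      * (y - p₀.outcomeReg true x s)
    - (1 - if t then 1 else 0) * p.ratioCov x * p.ratioSurr false s x
        / (1 - p.propensityLabelled x)
      * (y - p₀.outcomeReg false x s)

/-- The function `ψ̃'`. -/
def psi (p : Population 𝒳 𝒮) : Obs 𝒳 𝒮 → ℝ := p.weightedResidual p

/-- The assumptions on a population, with constants `ε` and `C`. -/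
structure Admissible [StandardBorelSpace 𝒳] (ε C : ℝ) (p : Population 𝒳 𝒮) : Prop where
  /-- `E[Y(t)]` exists -/
  integrable_out : ∀ t, Integrable (out t) p.law
  /-- `(Y(t), S(t)) ⊥ T | X` -/
  unconfounded_trt : ∀ t, CondIndepFun (MeasurableSpace.comap cov inferInstance)
    measurable_cov.comap_le (fun v => (out t v, surr t v)) trt p.law
  /-- `R ⊥ Y(t) | X, T = t, S(t)`: some version of the conditional distribution of `Y(t)` given
  `X, T = t, S(t)` is also one given `X, T = t, S(t), R = 1`. -/
  missing_at_random : ∀ t, ∃ κ : Kernel (𝒳 × 𝒮) ℝ, IsMarkovKernel κ ∧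
    HasCondDistrib (out t) (fun v => (cov v, surr t v)) κ
      (ProbabilityTheory.cond p.law (arm t)) ∧
    HasCondDistrib (out t) (fun v => (cov v, surr t v)) κ
      (ProbabilityTheory.cond p.labelled (arm t))
  /-- `ε ≤ e(X) ≤ 1 - ε` almost surely -/
  overlap : ∀ᵐ x ∂(p.law.map cov), ε ≤ p.propensity x ∧ p.propensity x ≤ 1 - ε
  /-- `λ(X)` is well defined and at most `C` almost surely -/
  ratioCov_ac : p.law.map cov ≪ p.labelled.map cov
  ratioCov_le : ∀ᵐ x ∂(p.law.map cov), p.ratioCov x ≤ C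
  /-- `0 < e(1, X) < 1` almost surely, so that conditioning on `X, T = t, R = 1` makes sense -/
  overlap_labelled : ∀ᵐ x ∂(p.law.map cov),
    0 < p.propensityLabelled x ∧ p.propensityLabelled x < 1
  /-- `λ_t(S, X)` is well defined and at most `C` almost surely -/
  ratioSurr_ac : ∀ t, ∀ᵐ x ∂(p.law.map cov), p.surrKernel t x ≪ p.surrKernelLabelled t x
  ratioSurr_le : ∀ t, ∀ᵐ x ∂(p.law.map cov), ∀ᵐ s ∂(p.surrKernel t x), p.ratioSurr t s x ≤ C

/-- The model: all admissible populations with the given, known law `ν` of `(X, T, S)`. -/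
def model [StandardBorelSpace 𝒳] (ε C : ℝ) (ν : Measure (𝒳 × Bool × 𝒮)) :
    Set (Population 𝒳 𝒮) :=
  {p | p.Admissible ε C ∧ p.covTrtSurrLaw = ν}

/-- The regular submodels through `p₀`: paths of populations that are at `p₀` for the parameter
value `0`, stay in the model near `0`, and have a second moment of the weighted residual
that is bounded near `0` (the usual local moment condition under which an expectation can be
differentiated along the path). -/
def regularSubmodels (M : Set (Population 𝒳 𝒮)) (p₀ : Population 𝒳 𝒮) :
    Set (ℝ → Population 𝒳 𝒮) :=
  {path | path 0 = p₀ ∧ (∀ᶠ γ in 𝓝 (0 : ℝ), path γ ∈ M) ∧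
    ∃ B : ℝ≥0, ∀ᶠ γ in 𝓝 (0 : ℝ),
      ∫⁻ w, ENNReal.ofReal ((path γ).weightedResidual p₀ w ^ 2) ∂(path γ).obsLaw ≤ B}

end Population

end Surrogate

end

/-!
Write `ψ` for the influence function; it is a weight, depending on `(X, T, S)`, times an outcome
residual that is centred given `(X, T, S)`. The weight turns the labelled law of `(X, T, S)` into
one that puts mass `1` on each arm and under which `X`, and `S` given `X` and the arm, are
distributed as in the whole population. The average treatment effect is therefore a weighted mean
of signed outcomes under the labelled law.

Along a submodel the law of `(X, T, S)` in the population is fixed, so all weights lead to the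
same law. Hence `δ(P_γ) - δ(P)` is the integral under `P_γ` of `ψ` divided by the marginal density
of `(X, T, S)` under `P_γ` relative to `P`. This density tends to `1`, because the laws of the
observation converge in Hellinger distance, and dividing by it keeps `ψ` centred. Together with
the bound on the second moments this gives the derivative `E[ψ g | R = 1]`.

Conversely every bounded function that is centred given `(X, T, S)` is a score: tilt the
conditional law of the outcome linearly by it and recombine the new outcome law with the old law
of `(X, T, S, R)`, which stays in the model. Such functions are dense in `L²` among the functions
centred given `(X, T, S)`, and `ψ` is one of those.
-/

noncomputable section

namespace Efficiency

section RootDensity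

variable {W : Type*} [MeasurableSpace W]

/-- The square root of the density, with respect to `P`, of the absolutely continuous part of
`Q`. -/
def rootDensity (P Q : Measure W) (w : W) : ℝ := √(Q.rnDeriv P w).toReal

lemma sq_rootDensity (P Q : Measure W) (w : W) :
    rootDensity P Q w ^ 2 = (Q.rnDeriv P w).toReal :=
  Real.sq_sqrt ENNReal.toReal_nonneg

lemma measurable_rootDensity (P Q : Measure W) : Measurable (rootDensity P Q) :=
  (Measure.measurable_rnDeriv Q P).ennreal_toReal.sqrt

variable (P Q : Measure W) [IsFiniteMeasure Q]

lemma integrable_sq_rootDensity : Integrable (fun w => rootDensity P Q w ^ 2) P := by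
  simpa only [sq_rootDensity] using Measure.integrable_toReal_rnDeriv

lemma memLp_rootDensity : MemLp (rootDensity P Q) 2 P :=
  (memLp_two_iff_integrable_sq (measurable_rootDensity P Q).aestronglyMeasurable).2
    (integrable_sq_rootDensity P Q)

variable [IsFiniteMeasure P]

lemma lintegral_add_eq_lintegral_rnDeriv_add (H : W → ℝ≥0∞) :
    ∫⁻ w, H w ∂(Q + P)
      = ∫⁻ w, (Q.rnDeriv P w + 1) * H w ∂P + ∫⁻ w, H w ∂(Q.singularPart P) := by
  have hdecomp : Q + P = P.withDensity (fun w => Q.rnDeriv P w + 1) + Q.singularPart P := by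
    have hadd : P.withDensity (fun w => Q.rnDeriv P w + 1) = P.withDensity (Q.rnDeriv P) + P :=
      (withDensity_add_left (Measure.measurable_rnDeriv Q P) fun _ => 1).trans (by simp)
    rw [hadd, add_right_comm, Measure.rnDeriv_add_singularPart]
  conv_lhs => rw [hdecomp]
  rw [lintegral_add_measure, lintegral_withDensity_eq_lintegral_mul_non_measurable]
  · rfl
  · exact (Measure.measurable_rnDeriv Q P).add_const 1
  · filter_upwards [Measure.rnDeriv_lt_top Q P] with w hw
      using ENNReal.add_lt_top.2 ⟨hw, ENNReal.one_lt_top⟩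

lemma rnDeriv_add_rnDeriv_eq_one :
    ∀ᵐ w ∂(Q + P), Q.rnDeriv (Q + P) w + P.rnDeriv (Q + P) w = 1 := by
  filter_upwards [Measure.rnDeriv_add' Q P (Q + P), Measure.rnDeriv_self (Q + P)] with w hadd hself
  rw [← hself, hadd, Pi.add_apply]

lemma toReal_rnDeriv_add :
    ∀ᵐ w ∂P, (Q.rnDeriv (Q + P) w).toReal
        = (Q.rnDeriv P w).toReal / ((Q.rnDeriv P w).toReal + 1) ∧
      (P.rnDeriv (Q + P) w).toReal = 1 / ((Q.rnDeriv P w).toReal + 1) := by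
  have hac : P ≪ Q + P := Measure.absolutelyContinuous_of_le (Measure.le_add_left le_rfl)
  filter_upwards [hac.ae_le (rnDeriv_add_rnDeriv_eq_one P Q),
    Measure.rnDeriv_mul_rnDeriv (κ := P) hac, Measure.rnDeriv_add' Q P P, Measure.rnDeriv_self P,
    Measure.rnDeriv_lt_top Q P] with w hsum hmul hadd hself hlt
  rw [Pi.mul_apply, hadd, Pi.add_apply, hself] at hmul
  have hle := hsum.le
  have hQ := ne_top_of_le_ne_top ENNReal.one_ne_top (le_self_add.trans hle)
  have hP := ne_top_of_le_ne_top ENNReal.one_ne_top (le_add_self.trans hle)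
  replace hsum := congrArg ENNReal.toReal hsum
  replace hmul := congrArg ENNReal.toReal hmul
  rw [ENNReal.toReal_add hQ hP, ENNReal.toReal_one] at hsum
  rw [ENNReal.toReal_mul, ENNReal.toReal_add hlt.ne ENNReal.one_ne_top, ENNReal.toReal_one] at hmul
  have hpos : (Q.rnDeriv P w).toReal + 1 ≠ 0 := by positivity
  rw [eq_div_iff hpos, eq_div_iff hpos]
  exact ⟨by linear_combination ((Q.rnDeriv P w).toReal + 1) * hsum - hmul, hmul⟩

lemma rnDeriv_add_of_singularPart :
    ∀ᵐ w ∂(Q.singularPart P), Q.rnDeriv (Q + P) w = 1 ∧ P.rnDeriv (Q + P) w = 0 := by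
  have hac : Q.singularPart P ≪ Q + P := Measure.absolutelyContinuous_of_le
    ((Measure.singularPart_le Q P).trans (Measure.le_add_right le_rfl))
  filter_upwards [hac.ae_le (rnDeriv_add_rnDeriv_eq_one P Q),
    Measure.rnDeriv_eq_zero_of_mutuallySingular
      (Measure.mutuallySingular_singularPart Q P).symm hac] with w hsum hzero
  rw [Pi.zero_apply] at hzero
  exact ⟨by simpa [hzero] using hsum, hzero⟩

lemma mul_sq_sqrt_div_sub (f γ g : ℝ) (hf : 0 ≤ f) :
    (f + 1) * ((√(f / (f + 1)) - √(1 / (f + 1))) / γ - g * √(1 / (f + 1)) / 2) ^ 2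
      = ((√f - 1) / γ - g / 2) ^ 2 := by
  have hpos : 0 < f + 1 := by positivity
  have hscale : √f / √(f + 1) / γ - 1 / √(f + 1) / γ - g * (1 / √(f + 1)) / 2
      = ((√f - 1) / γ - g / 2) / √(f + 1) := by ring
  rw [Real.sqrt_div hf, Real.sqrt_div zero_le_one, Real.sqrt_one, sub_div, hscale, div_pow,
    Real.sq_sqrt hpos.le, mul_div_cancel₀ _ hpos.ne']

lemma lintegral_sq_sqrt_rnDeriv_sub (g : W → ℝ) (γ : ℝ) :
    ∫⁻ w, ENNReal.ofReal
        (((√((Q.rnDeriv (Q + P) w).toReal) - √((P.rnDeriv (Q + P) w).toReal)) / γ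
          - g w * √((P.rnDeriv (Q + P) w).toReal) / 2) ^ 2) ∂(Q + P)
      = ∫⁻ w, ENNReal.ofReal (((rootDensity P Q w - 1) / γ - g w / 2) ^ 2) ∂P
        + ENNReal.ofReal ((Q.singularPart P).real Set.univ / γ ^ 2) := by
  rw [lintegral_add_eq_lintegral_rnDeriv_add]
  congr 1
  · refine lintegral_congr_ae ?_
    filter_upwards [toReal_rnDeriv_add P Q, Measure.rnDeriv_lt_top Q P] with w hw hlt
    rw [hw.1, hw.2, rootDensity, ← mul_sq_sqrt_div_sub _ γ (g w) ENNReal.toReal_nonneg,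
      ENNReal.ofReal_mul (by positivity),
      ENNReal.ofReal_add ENNReal.toReal_nonneg zero_le_one, ENNReal.ofReal_toReal hlt.ne,
      ENNReal.ofReal_one]
  · have hconst : ∀ᵐ w ∂(Q.singularPart P), ENNReal.ofReal
        (((√((Q.rnDeriv (Q + P) w).toReal) - √((P.rnDeriv (Q + P) w).toReal)) / γ
          - g w * √((P.rnDeriv (Q + P) w).toReal) / 2) ^ 2) = ENNReal.ofReal (1 / γ ^ 2) := by
      filter_upwards [rnDeriv_add_of_singularPart P Q] with w hw
      simp [hw.1, hw.2]
    rw [lintegral_congr_ae hconst, lintegral_const, ← ofReal_measureReal,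
      ← ENNReal.ofReal_mul (by positivity), one_div_mul_eq_div]

end RootDensity

section RootDifferentiable

variable {W : Type*} [MeasurableSpace W]

/-- `s` is a path in `L²(P)` which, at parameter value `0`, has the value `1` and the derivative
`g / 2`: what differentiability in quadratic mean with score `g` says of the square roots `s` of the
densities. -/
structure IsRootDifferentiable (P : Measure W) (s : ℝ → W → ℝ) (g : W → ℝ) : Prop where
  memLp_score : MemLp g 2 P
  memLp : ∀ γ, MemLp (s γ) 2 P
  tendsto : Tendsto (fun γ => ∫ w, ((s γ w - 1) / γ - g w / 2) ^ 2 ∂P) (𝓝[≠] 0) (𝓝 0)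

lemma memLp_rootRemainder {P : Measure W} [IsFiniteMeasure P] {s g : W → ℝ} (hs : MemLp s 2 P)
    (hg : MemLp g 2 P) (γ : ℝ) : MemLp (fun w => (s w - 1) / γ - g w / 2) 2 P := by
  simpa only [div_eq_mul_inv, Pi.sub_def] using
    ((hs.sub (memLp_const 1)).mul_const γ⁻¹).sub (hg.mul_const 2⁻¹)

lemma hasScore_iff {Q : ℝ → Measure W} [∀ γ, IsFiniteMeasure (Q γ)] {g : W → ℝ} :
    HasScore Q g ↔ IsRootDifferentiable (Q 0) (fun γ => rootDensity (Q 0) (Q γ)) g ∧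
      Tendsto (fun γ => ((Q γ).singularPart (Q 0)).real Set.univ / γ ^ 2) (𝓝[≠] 0) (𝓝 0) := by
  have hs : ∀ γ, MemLp (rootDensity (Q 0) (Q γ)) 2 (Q 0) := fun γ => memLp_rootDensity _ _
  have hint : MemLp g 2 (Q 0) → ∀ γ,
      ∫⁻ w, ENNReal.ofReal (((rootDensity (Q 0) (Q γ) w - 1) / γ - g w / 2) ^ 2) ∂(Q 0)
        = ENNReal.ofReal (∫ w, ((rootDensity (Q 0) (Q γ) w - 1) / γ - g w / 2) ^ 2 ∂(Q 0)) :=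
    fun hg γ => (ofReal_integral_eq_lintegral_ofReal
      (memLp_rootRemainder (hs γ) hg γ).integrable_sq (ae_of_all _ fun _ => sq_nonneg _)).symm
  rw [HasScore]
  simp only [lintegral_sq_sqrt_rnDeriv_sub]
  constructor
  · rintro ⟨hg, h⟩
    simp only [hint hg, ← ENNReal.ofReal_add (integral_nonneg fun _ => sq_nonneg _)
      (div_nonneg measureReal_nonneg (sq_nonneg _))] at h
    have hlim : ∀ {u : ℝ → ℝ}, (∀ γ, 0 ≤ u γ) →
        (∀ γ, u γ ≤ (∫ w, ((rootDensity (Q 0) (Q γ) w - 1) / γ - g w / 2) ^ 2 ∂(Q 0))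
          + ((Q γ).singularPart (Q 0)).real Set.univ / γ ^ 2) → Tendsto u (𝓝[≠] 0) (𝓝 0) := by
      refine fun hu hle => squeeze_zero hu hle ?_
      refine ((ENNReal.tendsto_toReal ENNReal.zero_ne_top).comp h).congr fun γ => ?_
      exact ENNReal.toReal_ofReal (add_nonneg (integral_nonneg fun _ => sq_nonneg _)
        (div_nonneg measureReal_nonneg (sq_nonneg _)))
    exact ⟨⟨hg, hs, hlim (fun γ => integral_nonneg fun _ => sq_nonneg _) fun γ =>
      le_add_of_nonneg_right (div_nonneg measureReal_nonneg (sq_nonneg _))⟩,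
      hlim (fun γ => div_nonneg measureReal_nonneg (sq_nonneg _)) fun γ =>
      le_add_of_nonneg_left (integral_nonneg fun _ => sq_nonneg _)⟩
  · rintro ⟨⟨hg, -, h⟩, hS⟩
    refine ⟨hg, ?_⟩
    simpa [hint hg] using (ENNReal.tendsto_ofReal h).add (ENNReal.tendsto_ofReal hS)

lemma integral_abs_mul_le_sqrt_mul_sqrt {μ : Measure W} {f g : W → ℝ} (hf : MemLp f 2 μ)
    (hg : MemLp g 2 μ) :
    ∫ w, |f w * g w| ∂μ ≤ √(∫ w, f w ^ 2 ∂μ) * √(∫ w, g w ^ 2 ∂μ) := by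
  rw [← ENNReal.ofReal_ofNat] at hf hg
  simpa [abs_mul, Real.sqrt_eq_rpow] using
    integral_mul_norm_le_Lp_mul_Lq Real.HolderConjugate.two_two hf hg

lemma integral_sq_le_of_abs_le {μ : Measure W} {f g : W → ℝ} (hg : MemLp g 2 μ)
    (hle : ∀ᵐ w ∂μ, |f w| ≤ |g w|) : ∫ w, f w ^ 2 ∂μ ≤ ∫ w, g w ^ 2 ∂μ :=
  integral_mono_of_nonneg (ae_of_all _ fun _ => sq_nonneg _) hg.integrable_sq
    (hle.mono fun _ => sq_le_sq.2)

lemma integral_sq_add_le {μ : Measure W} {f g : W → ℝ} (hf : MemLp f 2 μ) (hg : MemLp g 2 μ) :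
    ∫ w, (f w + g w) ^ 2 ∂μ ≤ 2 * ∫ w, f w ^ 2 ∂μ + 2 * ∫ w, g w ^ 2 ∂μ := by
  rw [← integral_const_mul, ← integral_const_mul,
    ← integral_add (hf.integrable_sq.const_mul 2) (hg.integrable_sq.const_mul 2)]
  refine integral_mono (hf.add hg).integrable_sq
    ((hf.integrable_sq.const_mul 2).add (hg.integrable_sq.const_mul 2)) fun w => ?_
  simpa only [mul_add] using add_sq_le (a := f w) (b := g w)

lemma tendsto_integral_abs_mul {ι : Type*} {l : Filter ι} {μ : ι → Measure W}
    {h k : ι → W → ℝ} {K : ℝ} (hh : ∀ᶠ i in l, MemLp (h i) 2 (μ i) ∧ ∫ w, h i w ^ 2 ∂μ i ≤ K)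
    (hk : ∀ᶠ i in l, MemLp (k i) 2 (μ i))
    (hk_zero : Tendsto (fun i => ∫ w, k i w ^ 2 ∂μ i) l (𝓝 0)) :
    Tendsto (fun i => ∫ w, |h i w * k i w| ∂μ i) l (𝓝 0) := by
  have hbound : Tendsto (fun i => √K * √(∫ w, k i w ^ 2 ∂μ i)) l (𝓝 0) := by
    simpa using hk_zero.sqrt.const_mul √K
  refine squeeze_zero' (Eventually.of_forall fun _ => integral_nonneg fun _ => abs_nonneg _) ?_
    hbound
  filter_upwards [hh, hk] with i ⟨hi, hiK⟩ hki
  exact (integral_abs_mul_le_sqrt_mul_sqrt hi hki).trans (by gcongr)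

lemma memLp_indicator_lt_abs {P : Measure W} {g : W → ℝ} (hg : MemLp g 2 P) (M : ℝ) :
    MemLp ({w | M < |g w|}.indicator g) 2 P :=
  hg.mono (hg.1.indicator₀ (nullMeasurableSet_lt aemeasurable_const
    (continuous_abs.comp_aestronglyMeasurable hg.1).aemeasurable))
    (ae_of_all _ fun _ => norm_indicator_le_norm_self _ _)

lemma tendsto_integral_sq_indicator_lt_abs {P : Measure W} {g : W → ℝ} (hg : MemLp g 2 P) :
    Tendsto (fun M : ℕ => ∫ w, {w | (M : ℝ) < |g w|}.indicator g w ^ 2 ∂P) atTop (𝓝 0) := by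
  rw [← integral_zero W ℝ (μ := P)]
  refine tendsto_integral_of_dominated_convergence (fun w => g w ^ 2)
    (fun M => (memLp_indicator_lt_abs hg M).1.pow 2)
    hg.integrable_sq (fun M => ae_of_all _ fun w => ?_) (ae_of_all _ fun w => ?_)
  · rw [Real.norm_eq_abs, abs_pow, ← sq_abs (g w)]
    exact pow_le_pow_left₀ (abs_nonneg _) (norm_indicator_le_norm_self g w) 2
  · obtain ⟨N, hN⟩ := exists_nat_ge |g w|
    refine tendsto_const_nhds.congr' ?_
    filter_upwards [eventually_ge_atTop N] with M hM
    have hle : |g w| ≤ M := hN.trans (mod_cast hM)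
    simp [Set.indicator_of_notMem, hle]

lemma integral_abs_mul_le_add_indicator {P : Measure W} [IsFiniteMeasure P] {h g : W → ℝ}
    (hh : MemLp h 2 P) (hg : MemLp g 2 P) {M : ℝ} (hM : 0 ≤ M) :
    ∫ w, |h w * g w| ∂P ≤ M * ∫ w, |h w| ∂P
      + √(∫ w, h w ^ 2 ∂P) * √(∫ w, {w | M < |g w|}.indicator g w ^ 2 ∂P) := by
  set tail := {w | M < |g w|}.indicator g with htail_def
  have htail : MemLp tail 2 P := memLp_indicator_lt_abs hg M
  have hsmall : Integrable (fun w => M * |h w|) P :=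
    (hh.integrable one_le_two).abs.const_mul M
  have hlarge : Integrable (fun w => |h w * tail w|) P := (hh.integrable_mul htail).abs
  have hpoint : ∀ w, |h w * g w| ≤ M * |h w| + |h w * tail w| := fun w => by
    rcases lt_or_ge M |g w| with hw | hw
    · rw [htail_def, Set.indicator_of_mem (by exact hw)]
      exact le_add_of_nonneg_left (by positivity)
    · rw [htail_def, Set.indicator_of_notMem (by exact hw.not_gt), mul_zero, abs_zero, add_zero,
        abs_mul, mul_comm]
      gcongr
  calc ∫ w, |h w * g w| ∂P ≤ ∫ w, (M * |h w| + |h w * tail w|) ∂P :=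
        integral_mono (hh.integrable_mul hg).abs (hsmall.add hlarge) hpoint
    _ = M * ∫ w, |h w| ∂P + ∫ w, |h w * tail w| ∂P := by
        rw [integral_add hsmall hlarge, integral_const_mul]
    _ ≤ _ := by
        gcongr
        exact integral_abs_mul_le_sqrt_mul_sqrt hh htail

lemma tendsto_integral_abs_mul_of_tendsto_integral_abs {ι : Type*} {l : Filter ι} {P : Measure W}
    [IsFiniteMeasure P] {h : ι → W → ℝ} {g : W → ℝ} {K : ℝ}
    (hh : ∀ᶠ i in l, MemLp (h i) 2 P ∧ ∫ w, h i w ^ 2 ∂P ≤ K)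
    (hh_zero : Tendsto (fun i => ∫ w, |h i w| ∂P) l (𝓝 0)) (hg : MemLp g 2 P) :
    Tendsto (fun i => ∫ w, |h i w * g w| ∂P) l (𝓝 0) := by
  refine tendsto_order.2 ⟨fun a ha => Eventually.of_forall fun i =>
    ha.trans_le (integral_nonneg fun _ => abs_nonneg _), fun a ha => ?_⟩
  have htail : Tendsto (fun M : ℕ => √K * √(∫ w, {w | (M : ℝ) < |g w|}.indicator g w ^ 2 ∂P))
      atTop (𝓝 0) := by
    simpa using (tendsto_integral_sq_indicator_lt_abs hg).sqrt.const_mul √K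
  obtain ⟨M, hM⟩ := ((tendsto_order.1 htail).2 (a / 2) (half_pos ha)).exists
  have hsmall : Tendsto (fun i => M * ∫ w, |h i w| ∂P) l (𝓝 0) := by
    simpa using hh_zero.const_mul (M : ℝ)
  filter_upwards [hh, (tendsto_order.1 hsmall).2 (a / 2) (half_pos ha)] with i ⟨hi, hiK⟩ hiM
  calc ∫ w, |h i w * g w| ∂P ≤ _ := integral_abs_mul_le_add_indicator hi hg M.cast_nonneg
    _ ≤ M * ∫ w, |h i w| ∂P
        + √K * √(∫ w, {w | (M : ℝ) < |g w|}.indicator g w ^ 2 ∂P) := by gcongr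
    _ < a := by linarith

lemma integral_mul_sq_div_sub {P : Measure W} [IsFiniteMeasure P] {Φ s g : W → ℝ} {γ : ℝ}
    (hΦ : MemLp Φ 2 P) (hΦs : MemLp (fun w => Φ w * s w) 2 P) (hs : MemLp s 2 P)
    (hg : MemLp g 2 P) (hcent : ∫ w, Φ w ∂P = 0) :
    (∫ w, Φ w * s w ^ 2 ∂P) / γ - ∫ w, Φ w * g w ∂P
      = ∫ w, Φ w * (s w + 1) * ((s w - 1) / γ - g w / 2) ∂P
        + (∫ w, Φ w * (s w - 1) * g w ∂P) / 2 := by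
  have hsq : Integrable (fun w => Φ w * s w ^ 2) P :=
    (hΦs.integrable_mul hs).congr (ae_of_all _ fun w => by simp only [Pi.mul_apply]; ring)
  have hdiff : Integrable (fun w => (Φ w * s w ^ 2 - Φ w) / γ) P :=
    (hsq.sub (hΦ.integrable one_le_two)).div_const γ
  have hΦg : Integrable (fun w => Φ w * g w) P := hΦ.integrable_mul hg
  have hrem : Integrable (fun w => Φ w * (s w + 1) * ((s w - 1) / γ - g w / 2)) P := by
    simp only [mul_add, mul_one]
    exact (hΦs.add hΦ).integrable_mul (memLp_rootRemainder hs hg γ)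
  have hdrift : Integrable (fun w => Φ w * (s w - 1) * g w / 2) P := by
    simp only [mul_sub, mul_one]
    exact ((hΦs.sub hΦ).integrable_mul hg).div_const 2
  rw [← sub_zero (∫ w, Φ w * s w ^ 2 ∂P), ← hcent, ← integral_sub hsq (hΦ.integrable one_le_two),
    ← integral_div, ← integral_div, ← integral_sub hdiff hΦg, ← integral_add hrem hdrift]
  congr with w
  ring

namespace IsRootDifferentiable

variable {P : Measure W} {s : ℝ → W → ℝ} {g : W → ℝ}

lemma memLp_remainder [IsFiniteMeasure P] (hs : IsRootDifferentiable P s g) (γ : ℝ) :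
    MemLp (fun w => (s γ w - 1) / γ - g w / 2) 2 P :=
  memLp_rootRemainder (hs.memLp γ) hs.memLp_score γ

lemma memLp_sub_one [IsFiniteMeasure P] (hs : IsRootDifferentiable P s g) (γ : ℝ) :
    MemLp (fun w => s γ w - 1) 2 P :=
  (hs.memLp γ).sub (memLp_const 1)

lemma setIntegral_sq_sub_one_div_le [IsFiniteMeasure P] (hs : IsRootDifferentiable P s g) (γ : ℝ)
    (A : Set W) :
    (∫ w in A, (s γ w - 1) ^ 2 ∂P) / γ ^ 2
      ≤ 2 * ∫ w, ((s γ w - 1) / γ - g w / 2) ^ 2 ∂P + (∫ w in A, g w ^ 2 ∂P) / 2 := by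
  have hrem := hs.memLp_remainder γ
  have hg : MemLp (fun w => g w / 2) 2 P := by
    simpa only [div_eq_mul_inv] using hs.memLp_score.mul_const 2⁻¹
  calc (∫ w in A, (s γ w - 1) ^ 2 ∂P) / γ ^ 2
      = ∫ w in A, ((s γ w - 1) / γ - g w / 2 + g w / 2) ^ 2 ∂P := by
        simp only [sub_add_cancel, div_pow, integral_div]
    _ ≤ 2 * ∫ w in A, ((s γ w - 1) / γ - g w / 2) ^ 2 ∂P + 2 * ∫ w in A, (g w / 2) ^ 2 ∂P :=
        integral_sq_add_le (hrem.restrict A) (hg.restrict A)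
    _ = 2 * ∫ w in A, ((s γ w - 1) / γ - g w / 2) ^ 2 ∂P + (∫ w in A, g w ^ 2 ∂P) / 2 := by
        simp only [div_pow, integral_div]
        ring
    _ ≤ _ := by
        gcongr ?_ + _
        gcongr
        exacts [ae_of_all _ fun _ => sq_nonneg _, hrem.integrable_sq, Measure.restrict_le_self]

lemma tendsto_integral_sq_sub_one [IsFiniteMeasure P] (hs : IsRootDifferentiable P s g) :
    Tendsto (fun γ => ∫ w, (s γ w - 1) ^ 2 ∂P) (𝓝[≠] 0) (𝓝 0) := by
  have hid : Tendsto (fun γ : ℝ => γ) (𝓝[≠] 0) (𝓝 0) := tendsto_id.mono_left nhdsWithin_le_nhds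
  refine squeeze_zero' (Eventually.of_forall fun _ => integral_nonneg fun _ => sq_nonneg _) ?_
    (g := fun γ => (2 * ∫ w, ((s γ w - 1) / γ - g w / 2) ^ 2 ∂P + (∫ w, g w ^ 2 ∂P) / 2) * γ ^ 2)
    (by simpa using ((hs.tendsto.const_mul 2).add_const _).mul (hid.pow 2))
  filter_upwards [self_mem_nhdsWithin] with γ hγ
  have hpos : 0 < γ ^ 2 := sq_pos_of_ne_zero hγ
  simpa using (div_le_iff₀ hpos).1 (hs.setIntegral_sq_sub_one_div_le γ Set.univ)

lemma tendsto_setIntegral_sq_sub_one_div [IsFiniteMeasure P] (hs : IsRootDifferentiable P s g)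
    {A : ℝ → Set W} (hA : Tendsto (fun γ => P.real (A γ)) (𝓝[≠] 0) (𝓝 0)) :
    Tendsto (fun γ => (∫ w in A γ, (s γ w - 1) ^ 2 ∂P) / γ ^ 2) (𝓝[≠] 0) (𝓝 0) := by
  have hgA : Tendsto (fun γ => ∫ w in A γ, g w ^ 2 ∂P) (𝓝[≠] 0) (𝓝 0) :=
    hs.memLp_score.integrable_sq.tendsto_setIntegral_nhds_zero
      (by simpa [Function.comp_def, ofReal_measureReal] using ENNReal.tendsto_ofReal hA)
  exact squeeze_zero (fun _ => div_nonneg (integral_nonneg fun _ => sq_nonneg _) (sq_nonneg _))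
    (fun γ => hs.setIntegral_sq_sub_one_div_le γ (A γ))
    (by simpa using (hs.tendsto.const_mul 2).add (hgA.div_const 2))

lemma tendsto_integral_abs_sq_sub_one [IsFiniteMeasure P] (hs : IsRootDifferentiable P s g) :
    Tendsto (fun γ => ∫ w, |s γ w ^ 2 - 1| ∂P) (𝓝[≠] 0) (𝓝 0) := by
  have hadd : ∀ᶠ γ in 𝓝[≠] 0, MemLp (fun w => s γ w + 1) 2 P ∧
      ∫ w, (s γ w + 1) ^ 2 ∂P ≤ 2 + 8 * P.real Set.univ := by
    filter_upwards [(tendsto_order.1 hs.tendsto_integral_sq_sub_one).2 1 one_pos] with γ hγ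
    refine ⟨(hs.memLp γ).add (memLp_const 1), ?_⟩
    calc ∫ w, (s γ w + 1) ^ 2 ∂P = ∫ w, (s γ w - 1 + 2) ^ 2 ∂P := by
          congr with w
          ring
      _ ≤ 2 * ∫ w, (s γ w - 1) ^ 2 ∂P + 2 * ∫ _, (2 : ℝ) ^ 2 ∂P :=
          integral_sq_add_le (hs.memLp_sub_one γ) (memLp_const 2)
      _ ≤ 2 + 8 * P.real Set.univ := by
          rw [integral_const, smul_eq_mul]
          linarith
  refine (tendsto_integral_abs_mul hadd (Eventually.of_forall hs.memLp_sub_one)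
    hs.tendsto_integral_sq_sub_one).congr fun γ => ?_
  simp only [← sq_sub_sq, one_pow]

lemma tendsto_integral_centred_div [IsFiniteMeasure P] (hs : IsRootDifferentiable P s g)
    {Φ : ℝ → W → ℝ} {K : ℝ}
    (hΦ : ∀ᶠ γ in 𝓝[≠] 0, MemLp (Φ γ) 2 P ∧ ∫ w, Φ γ w ^ 2 ∂P ≤ K)
    (hΦs : ∀ᶠ γ in 𝓝[≠] 0, MemLp (fun w => Φ γ w * s γ w) 2 P ∧
      ∫ w, (Φ γ w * s γ w) ^ 2 ∂P ≤ K)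
    (hcent : ∀ᶠ γ in 𝓝[≠] 0, ∫ w, Φ γ w ∂P = 0) :
    Tendsto (fun γ => (∫ w, Φ γ w * s γ w ^ 2 ∂P) / γ - ∫ w, Φ γ w * g w ∂P) (𝓝[≠] 0) (𝓝 0) := by
  have hplus : ∀ᶠ γ in 𝓝[≠] 0, MemLp (fun w => Φ γ w * (s γ w + 1)) 2 P ∧
      ∫ w, (Φ γ w * (s γ w + 1)) ^ 2 ∂P ≤ 4 * K := by
    filter_upwards [hΦ, hΦs] with γ ⟨hmem, hle⟩ ⟨hmem_s, hle_s⟩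
    simp only [mul_add, mul_one]
    exact ⟨hmem_s.add hmem, (integral_sq_add_le hmem_s hmem).trans (by linarith)⟩
  have hminus : ∀ᶠ γ in 𝓝[≠] 0, MemLp (fun w => Φ γ w * (s γ w - 1)) 2 P ∧
      ∫ w, (Φ γ w * (s γ w - 1)) ^ 2 ∂P ≤ 4 * K := by
    filter_upwards [hΦ, hΦs] with γ ⟨hmem, hle⟩ ⟨hmem_s, hle_s⟩
    have hle_neg := integral_sq_add_le hmem_s hmem.neg
    simp only [Pi.neg_apply, neg_sq, ← sub_eq_add_neg] at hle_neg
    simp only [mul_sub, mul_one]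
    exact ⟨hmem_s.sub hmem, hle_neg.trans (by linarith)⟩
  have hrem := tendsto_integral_abs_mul hplus (Eventually.of_forall hs.memLp_remainder) hs.tendsto
  have hdrift := tendsto_integral_abs_mul_of_tendsto_integral_abs hminus
    (tendsto_integral_abs_mul hΦ (Eventually.of_forall hs.memLp_sub_one)
      hs.tendsto_integral_sq_sub_one) hs.memLp_score
  refine squeeze_zero_norm' ?_
    (by simpa only [zero_div, add_zero] using hrem.add (hdrift.div_const 2))
  filter_upwards [hΦ, hΦs, hcent] with γ hmem hmem_s hzero
  rw [integral_mul_sq_div_sub hmem.1 hmem_s.1 (hs.memLp γ) hs.memLp_score hzero, Real.norm_eq_abs]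
  refine (abs_add_le _ _).trans ?_
  rw [abs_div, abs_two]
  exact add_le_add abs_integral_le_integral_abs
    (div_le_div_of_nonneg_right abs_integral_le_integral_abs zero_le_two)

end IsRootDifferentiable

end RootDifferentiable

section Marginal

variable {W V : Type*} [MeasurableSpace W] [MeasurableSpace V]

lemma le_withDensity_rnDeriv {μ ν ρ : Measure W} [ν.HaveLebesgueDecomposition ρ] (hle : μ ≤ ν)
    (hac : μ ≪ ρ) : μ ≤ ρ.withDensity (ν.rnDeriv ρ) := by
  obtain ⟨N, hN, hsing, hnull⟩ := Measure.mutuallySingular_singularPart ν ρ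
  refine Measure.le_intro fun A _ _ => ?_
  have hAN : μ (A ∩ Nᶜ) = 0 := hac (measure_mono_null Set.inter_subset_right hnull)
  calc μ A = μ (A ∩ N) := by rw [← measure_inter_add_sdiff A hN, Set.sdiff_eq, hAN, add_zero]
    _ ≤ ν (A ∩ N) := hle _
    _ = ν.singularPart ρ (A ∩ N) + ρ.withDensity (ν.rnDeriv ρ) (A ∩ N) := by
        rw [← Measure.add_apply, Measure.singularPart_add_rnDeriv]
    _ ≤ ρ.withDensity (ν.rnDeriv ρ) A := by
        rw [measure_mono_null Set.inter_subset_right hsing, zero_add]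
        exact measure_mono Set.inter_subset_left

/-- The density, with respect to the law of `π` under `P`, of the absolutely continuous part of the
law of `π` under `Q`. -/
def marginalDensity (π : W → V) (P Q : Measure W) (v : V) : ℝ :=
  ((Q.map π).rnDeriv (P.map π) v).toReal

lemma measurable_marginalDensity (π : W → V) (P Q : Measure W) :
    Measurable (marginalDensity π P Q) :=
  (Measure.measurable_rnDeriv _ _).ennreal_toReal

lemma integrable_marginalDensity (π : W → V) (P Q : Measure W) [IsFiniteMeasure Q] :
    Integrable (marginalDensity π P Q) (P.map π) :=
  Measure.integrable_toReal_rnDeriv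

variable (P Q : Measure W) [IsFiniteMeasure P] [IsFiniteMeasure Q] {π : W → V}

lemma setIntegral_sq_rootDensity_le (hπ : Measurable π) {A : Set V} (hA : MeasurableSet A) :
    ∫ w in π ⁻¹' A, rootDensity P Q w ^ 2 ∂P ≤ ∫ v in A, marginalDensity π P Q v ∂(P.map π) := by
  have hle : (P.withDensity (Q.rnDeriv P)).map π
      ≤ (P.map π).withDensity ((Q.map π).rnDeriv (P.map π)) :=
    le_withDensity_rnDeriv (Measure.map_mono (Measure.withDensity_rnDeriv_le Q P) hπ)
      ((withDensity_absolutelyContinuous P _).map hπ)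
  simp only [sq_rootDensity, marginalDensity]
  rw [Measure.setIntegral_toReal_rnDeriv_eq_withDensity,
    Measure.setIntegral_toReal_rnDeriv_eq_withDensity, ← map_measureReal_apply hπ hA]
  exact ENNReal.toReal_mono (measure_ne_top _ _) (hle A)

lemma setIntegral_one_sub_marginalDensity_le (hπ : Measurable π) {A : Set V}
    (hA : MeasurableSet A) :
    ∫ v in A, (1 - marginalDensity π P Q v) ∂(P.map π)
      ≤ ∫ w in π ⁻¹' A, (1 - rootDensity P Q w ^ 2) ∂P := by
  rw [integral_sub (integrable_const 1) (integrable_marginalDensity π P Q).integrableOn,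
    integral_sub (integrable_const 1) (integrable_sq_rootDensity P Q).integrableOn,
    setIntegral_const, setIntegral_const, map_measureReal_apply hπ hA]
  gcongr
  exact setIntegral_sq_rootDensity_le P Q hπ hA

lemma integral_abs_sub_one_le {μ : Measure V} [IsProbabilityMeasure μ] {θ : V → ℝ}
    (hθ_meas : Measurable θ) (hθ : Integrable θ μ) (hmass : ∫ v, θ v ∂μ ≤ 1) :
    ∫ v, |θ v - 1| ∂μ ≤ 2 * ∫ v in {v | θ v < 1}, (1 - θ v) ∂μ := by
  have hA : MeasurableSet {v | θ v < 1} := measurableSet_lt hθ_meas measurable_const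
  have hneg : Integrable (fun v => 2 * {v | θ v < 1}.indicator (fun v => 1 - θ v) v) μ :=
    (((integrable_const 1).sub hθ).indicator hA).const_mul 2
  have habs : ∀ v, |θ v - 1| = θ v - 1 + 2 * {v | θ v < 1}.indicator (fun v => 1 - θ v) v := by
    intro v
    by_cases hv : θ v < 1
    · rw [Set.indicator_of_mem (by exact hv), abs_of_neg (by linarith)]
      ring
    · rw [Set.indicator_of_notMem (by exact hv), abs_of_nonneg (by linarith)]
      ring
  have hsub : Integrable (fun v => θ v - 1) μ := hθ.sub (integrable_const 1)
  simp only [habs]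
  rw [integral_add hsub hneg, integral_sub hθ (integrable_const 1), integral_const_mul,
    integral_indicator hA, integral_const, probReal_univ, one_smul]
  linarith

lemma integral_abs_marginalDensity_sub_one_le (P Q : Measure W) [IsProbabilityMeasure P]
    [IsProbabilityMeasure Q] (hπ : Measurable π) :
    ∫ w, |marginalDensity π P Q (π w) - 1| ∂P ≤ 2 * ∫ w, |rootDensity P Q w ^ 2 - 1| ∂P := by
  have hθ := measurable_marginalDensity π P Q
  have hf : Integrable (fun w => 1 - rootDensity P Q w ^ 2) P :=
    (integrable_const 1).sub (integrable_sq_rootDensity P Q)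
  have := Measure.isProbabilityMeasure_map (μ := P) hπ.aemeasurable
  have := Measure.isProbabilityMeasure_map (μ := Q) hπ.aemeasurable
  have hmass : ∫ v, marginalDensity π P Q v ∂(P.map π) ≤ 1 := by
    simpa [marginalDensity] using Measure.setIntegral_toReal_rnDeriv_le (μ := Q.map π)
      (ν := P.map π) (s := Set.univ) (measure_ne_top _ _)
  calc ∫ w, |marginalDensity π P Q (π w) - 1| ∂P
      = ∫ v, |marginalDensity π P Q v - 1| ∂(P.map π) :=
        (integral_map hπ.aemeasurable (hθ.sub_const 1).abs.aestronglyMeasurable).symm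
    _ ≤ 2 * ∫ v in {v | marginalDensity π P Q v < 1}, (1 - marginalDensity π P Q v) ∂(P.map π) :=
        integral_abs_sub_one_le hθ (integrable_marginalDensity π P Q) hmass
    _ ≤ 2 * ∫ w in π ⁻¹' {v | marginalDensity π P Q v < 1}, (1 - rootDensity P Q w ^ 2) ∂P := by
        gcongr
        exact setIntegral_one_sub_marginalDensity_le P Q hπ (measurableSet_lt hθ measurable_const)
    _ ≤ 2 * ∫ w in π ⁻¹' {v | marginalDensity π P Q v < 1}, |1 - rootDensity P Q w ^ 2| ∂P := by
        gcongr ?_ * ?_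
        exact integral_mono hf.integrableOn hf.abs.integrableOn fun w => le_abs_self _
    _ ≤ 2 * ∫ w, |rootDensity P Q w ^ 2 - 1| ∂P := by
        simp only [abs_sub_comm _ (1 : ℝ)]
        gcongr ?_ * ?_
        exact setIntegral_le_integral hf.abs (ae_of_all _ fun _ => abs_nonneg _)

lemma measureReal_marginalDensity_lt_half_le (hπ : Measurable π) :
    P.real {w | marginalDensity π P Q (π w) < 1 / 2}
      ≤ 16 * ∫ w in {w | marginalDensity π P Q (π w) < 1 / 2}, (rootDensity P Q w - 1) ^ 2 ∂P := by
  set A : Set V := {v | marginalDensity π P Q v < 1 / 2}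
  have hA : MeasurableSet A :=
    measurableSet_lt (measurable_marginalDensity π P Q) measurable_const
  have hroot : Integrable (fun w => (rootDensity P Q w - 1) ^ 2) P :=
    ((memLp_rootDensity P Q).sub (memLp_const 1)).integrable_sq
  have hlower : 1 / 2 * P.real (π ⁻¹' A) ≤ ∫ v in A, (1 - marginalDensity π P Q v) ∂(P.map π) := by
    rw [← map_measureReal_apply hπ hA, mul_comm, ← smul_eq_mul, ← setIntegral_const]
    refine setIntegral_mono_on (integrable_const _).integrableOn
      ((integrable_const 1).sub (integrable_marginalDensity π P Q)).integrableOn hA fun v hv => ?_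
    have : marginalDensity π P Q v < 1 / 2 := hv
    linarith
  have hupper : ∫ w in π ⁻¹' A, (1 - rootDensity P Q w ^ 2) ∂P
      ≤ 1 / 4 * P.real (π ⁻¹' A) + 4 * ∫ w in π ⁻¹' A, (rootDensity P Q w - 1) ^ 2 ∂P := by
    rw [mul_comm (1 / 4), ← smul_eq_mul, ← setIntegral_const, ← integral_const_mul,
      ← integral_add (integrable_const _) (hroot.const_mul 4).integrableOn]
    refine integral_mono ((integrable_const 1).sub (integrable_sq_rootDensity P Q)).integrableOn
      ((integrable_const _).add (hroot.const_mul 4).integrableOn) fun w => ?_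
    nlinarith [sq_nonneg (4 * (1 - rootDensity P Q w) - 1)]
  have hcompare := setIntegral_one_sub_marginalDensity_le P Q hπ hA
  change P.real (π ⁻¹' A) ≤ 16 * ∫ w in π ⁻¹' A, (rootDensity P Q w - 1) ^ 2 ∂P
  linarith

end Marginal

/-- The reciprocal of `x`, replaced by `0` where it exceeds `2`: a bounded factor that agrees with
the reciprocal of a marginal density wherever that density is at least `1 / 2`. -/
def clippedInv (x : ℝ) : ℝ := if x < 1 / 2 then 0 else x⁻¹

@[fun_prop]
lemma measurable_clippedInv : Measurable clippedInv :=
  Measurable.ite measurableSet_Iio measurable_const measurable_inv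

lemma clippedInv_nonneg (x : ℝ) : 0 ≤ clippedInv x := by
  rw [clippedInv]
  split_ifs with hx
  · exact le_rfl
  · exact inv_nonneg.2 (by linarith)

lemma clippedInv_le_two (x : ℝ) : clippedInv x ≤ 2 := by
  rw [clippedInv]
  split_ifs with hx
  · exact zero_le_two
  · exact inv_le_of_inv_le₀ two_pos (by linarith)

lemma abs_clippedInv_sub_one_le_one (x : ℝ) : |clippedInv x - 1| ≤ 1 :=
  abs_le.2 ⟨by linarith [clippedInv_nonneg x], by linarith [clippedInv_le_two x]⟩

lemma abs_clippedInv_sub_one_le (x : ℝ) : |clippedInv x - 1| ≤ 2 * |x - 1| := by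
  rw [clippedInv]
  split_ifs with hx
  · rw [zero_sub, abs_neg, abs_one, abs_of_neg (by linarith)]
    linarith
  · have hpos : 0 < x := by linarith
    rw [show x⁻¹ - 1 = x⁻¹ * (1 - x) by field_simp, abs_mul, abs_of_pos (inv_pos.2 hpos),
      abs_sub_comm]
    gcongr
    exact inv_le_of_inv_le₀ two_pos (by linarith)

lemma clippedInv_mul_self {x : ℝ} (hx : 1 / 2 ≤ x) : clippedInv x * x = 1 := by
  rw [clippedInv, if_neg hx.not_gt, inv_mul_cancel₀ (by linarith)]

section Lebesgue

variable {W V : Type*} [MeasurableSpace W] [MeasurableSpace V] (P Q : Measure W)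
  [IsFiniteMeasure P] [IsFiniteMeasure Q]

lemma integral_eq_integral_sq_rootDensity_add {Φ : W → ℝ} (hΦ : Integrable Φ Q) :
    ∫ w, Φ w ∂Q = ∫ w, Φ w * rootDensity P Q w ^ 2 ∂P + ∫ w, Φ w ∂(Q.singularPart P) := by
  conv_lhs => rw [← Measure.rnDeriv_add_singularPart Q P]
  rw [integral_add_measure (hΦ.mono_measure (Measure.withDensity_rnDeriv_le Q P))
      (hΦ.mono_measure (Measure.singularPart_le Q P)),
    integral_withDensity_eq_integral_toReal_smul (Measure.measurable_rnDeriv Q P)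
      (Measure.rnDeriv_lt_top Q P)]
  simp only [sq_rootDensity, smul_eq_mul, mul_comm]

omit [IsFiniteMeasure P] in
lemma memLp_mul_rootDensity {Φ : W → ℝ} (hΦP : AEStronglyMeasurable Φ P) (hΦ : MemLp Φ 2 Q) :
    MemLp (fun w => Φ w * rootDensity P Q w) 2 P := by
  have hint : Integrable (fun w => Φ w ^ 2) (P.withDensity (Q.rnDeriv P)) :=
    hΦ.integrable_sq.mono_measure (Measure.withDensity_rnDeriv_le Q P)
  refine (memLp_two_iff_integrable_sq
    (hΦP.mul (measurable_rootDensity P Q).aestronglyMeasurable)).2 ?_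
  simpa only [Pi.mul_apply, mul_pow, sq_rootDensity, smul_eq_mul, mul_comm] using
    (integrable_withDensity_iff_integrable_smul' (Measure.measurable_rnDeriv Q P)
      (Measure.rnDeriv_lt_top Q P)).1 hint

lemma integral_sq_mul_rootDensity_le {Φ : W → ℝ} (hΦ : MemLp Φ 2 Q) :
    ∫ w, (Φ w * rootDensity P Q w) ^ 2 ∂P ≤ ∫ w, Φ w ^ 2 ∂Q := by
  simp only [mul_pow]
  rw [integral_eq_integral_sq_rootDensity_add P Q hΦ.integrable_sq]
  exact le_add_of_nonneg_right (integral_nonneg fun _ => sq_nonneg _)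

lemma ae_weight_mul_marginalDensity_eq {π : W → V} (hπ : Measurable π) {w w₀ : V → ℝ}
    (hw : Measurable w) (hw_nonneg : ∀ v, 0 ≤ w v) (hw₀ : Measurable w₀)
    (hw₀_nonneg : ∀ v, 0 ≤ w₀ v)
    (h : (Q.map π).withDensity (fun v => ENNReal.ofReal (w v))
      = (P.map π).withDensity fun v => ENNReal.ofReal (w₀ v)) :
    ∀ᵐ z ∂P, w (π z) * marginalDensity π P Q (π z) = w₀ (π z) := by
  refine ae_of_ae_map hπ.aemeasurable (p := fun v => w v * marginalDensity π P Q v = w₀ v) ?_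
  filter_upwards [Measure.rnDeriv_withDensity_left (μ := Q.map π) (ν := P.map π)
      hw.ennreal_ofReal.aemeasurable (ae_of_all _ fun _ => ENNReal.ofReal_ne_top),
    Measure.rnDeriv_withDensity (P.map π) hw₀.ennreal_ofReal] with v hleft hright
  rw [h, hright] at hleft
  simpa [hw_nonneg, hw₀_nonneg, marginalDensity] using (congrArg ENNReal.toReal hleft).symm

omit [IsFiniteMeasure P] [IsFiniteMeasure Q] in
lemma ae_eq_indicator_add_clippedInv_mul {π : W → V} {f f₀ : W → ℝ}
    (hf : ∀ᵐ z ∂P, f z * marginalDensity π P Q (π z) = f₀ z) :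
    ∀ᵐ z ∂P, f z = {z | marginalDensity π P Q (π z) < 1 / 2}.indicator f z
      + clippedInv (marginalDensity π P Q (π z)) * f₀ z := by
  filter_upwards [hf] with z hz
  rcases lt_or_ge (marginalDensity π P Q (π z)) (1 / 2) with hlt | hge
  · rw [Set.indicator_of_mem (by exact hlt), clippedInv, if_pos hlt, zero_mul, add_zero]
  · rw [Set.indicator_of_notMem (by exact hge.not_gt), zero_add, ← hz, mul_left_comm,
      clippedInv_mul_self hge, mul_one]

lemma integral_eq_integral_singularPart_add {π : W → V} (hπ : Measurable π) {f f₀ : W → ℝ}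
    (hf_int : Integrable f Q) (hf : ∀ᵐ z ∂P, f z * marginalDensity π P Q (π z) = f₀ z) :
    ∫ z, f z ∂Q = ∫ z, f z ∂(Q.singularPart P)
      + ∫ z in {z | marginalDensity π P Q (π z) < 1 / 2}, f z * rootDensity P Q z ^ 2 ∂P
      + ∫ z, clippedInv (marginalDensity π P Q (π z)) * f₀ z * rootDensity P Q z ^ 2 ∂P := by
  set A := {z | marginalDensity π P Q (π z) < 1 / 2}
  have hA : MeasurableSet A :=
    measurableSet_lt ((measurable_marginalDensity π P Q).comp hπ) measurable_const
  have hroot : Integrable (fun z => f z * rootDensity P Q z ^ 2) P := by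
    simpa only [sq_rootDensity, smul_eq_mul, mul_comm] using
      (integrable_withDensity_iff_integrable_smul' (Measure.measurable_rnDeriv Q P)
        (Measure.rnDeriv_lt_top Q P)).1 (hf_int.mono_measure (Measure.withDensity_rnDeriv_le Q P))
  have hsplit : (fun z => f z * rootDensity P Q z ^ 2) - A.indicator
        (fun z => f z * rootDensity P Q z ^ 2) =ᵐ[P]
      fun z => clippedInv (marginalDensity π P Q (π z)) * f₀ z * rootDensity P Q z ^ 2 := by
    filter_upwards [ae_eq_indicator_add_clippedInv_mul P Q hf] with z hz
    rw [Pi.sub_apply, Set.indicator_mul_left]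
    linear_combination rootDensity P Q z ^ 2 * hz
  rw [integral_eq_integral_sq_rootDensity_add P Q hf_int, ← integral_congr_ae hsplit,
    integral_sub' hroot (hroot.indicator hA), integral_indicator hA]
  ring

end Lebesgue

section Path

variable {W V : Type*} [MeasurableSpace W] [MeasurableSpace V] {Q : ℝ → Measure W} {π : W → V}
  {g : W → ℝ} {f : ℝ → W → ℝ} {f₀ : W → ℝ} {K : ℝ}

lemma tendsto_integral_singularPart_div [∀ γ, IsFiniteMeasure (Q γ)]
    (hS : Tendsto (fun γ => ((Q γ).singularPart (Q 0)).real Set.univ / γ ^ 2) (𝓝[≠] 0) (𝓝 0))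
    (hf : ∀ᶠ γ in 𝓝[≠] 0, MemLp (f γ) 2 (Q γ) ∧ ∫ z, f γ z ^ 2 ∂(Q γ) ≤ K) :
    Tendsto (fun γ => (∫ z, f γ z ∂((Q γ).singularPart (Q 0))) / γ) (𝓝[≠] 0) (𝓝 0) := by
  have hf_sing : ∀ᶠ γ in 𝓝[≠] 0, MemLp (f γ) 2 ((Q γ).singularPart (Q 0)) ∧
      ∫ z, f γ z ^ 2 ∂((Q γ).singularPart (Q 0)) ≤ K := by
    filter_upwards [hf] with γ ⟨hmem, hle⟩
    exact ⟨hmem.mono_measure (Measure.singularPart_le _ _), (integral_mono_measure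
      (Measure.singularPart_le _ _) (ae_of_all _ fun _ => sq_nonneg _) hmem.integrable_sq).trans
      hle⟩
  refine squeeze_zero_norm (fun γ => ?_) (tendsto_integral_abs_mul hf_sing
    (Eventually.of_forall fun γ => memLp_const γ⁻¹)
    (by simpa [integral_const, div_eq_mul_inv] using hS))
  rw [div_eq_mul_inv, ← integral_mul_const]
  exact norm_integral_le_integral_norm _

lemma tendsto_measureReal_marginalDensity_lt_half_div [∀ γ, IsFiniteMeasure (Q γ)]
    (hs : IsRootDifferentiable (Q 0) (fun γ => rootDensity (Q 0) (Q γ)) g) (hπ : Measurable π) :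
    Tendsto (fun γ => (Q 0).real {z | marginalDensity π (Q 0) (Q γ) (π z) < 1 / 2} / γ ^ 2)
      (𝓝[≠] 0) (𝓝 0) := by
  have hle := fun γ => measureReal_marginalDensity_lt_half_le (Q 0) (Q γ) hπ
  have hsmall : Tendsto (fun γ => (Q 0).real {z | marginalDensity π (Q 0) (Q γ) (π z) < 1 / 2})
      (𝓝[≠] 0) (𝓝 0) := by
    refine squeeze_zero (fun _ => measureReal_nonneg) (fun γ => (hle γ).trans ?_)
      (by simpa using hs.tendsto_integral_sq_sub_one.const_mul 16)
    exact mul_le_mul_of_nonneg_left (setIntegral_le_integral (hs.memLp_sub_one γ).integrable_sq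
      (ae_of_all _ fun _ => sq_nonneg _)) (by norm_num)
  have hlim := (hs.tendsto_setIntegral_sq_sub_one_div hsmall).const_mul 16
  rw [mul_zero] at hlim
  refine squeeze_zero (fun _ => div_nonneg measureReal_nonneg (sq_nonneg _)) (fun γ => ?_) hlim
  rw [← mul_div_assoc]
  exact div_le_div_of_nonneg_right (hle γ) (sq_nonneg _)

lemma tendsto_setIntegral_sq_rootDensity_div [∀ γ, IsFiniteMeasure (Q γ)]
    (hs : IsRootDifferentiable (Q 0) (fun γ => rootDensity (Q 0) (Q γ)) g) (hπ : Measurable π) :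
    Tendsto (fun γ => (∫ z in {z | marginalDensity π (Q 0) (Q γ) (π z) < 1 / 2},
      rootDensity (Q 0) (Q γ) z ^ 2 ∂(Q 0)) / γ ^ 2) (𝓝[≠] 0) (𝓝 0) := by
  refine squeeze_zero (fun _ => div_nonneg (integral_nonneg fun _ => sq_nonneg _) (sq_nonneg _))
    (fun γ => div_le_div_of_nonneg_right ?_ (sq_nonneg _))
    (tendsto_measureReal_marginalDensity_lt_half_div hs hπ)
  have hA : MeasurableSet {v | marginalDensity π (Q 0) (Q γ) v < 1 / 2} :=
    measurableSet_lt (measurable_marginalDensity π _ _) measurable_const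
  calc ∫ z in {z | marginalDensity π (Q 0) (Q γ) (π z) < 1 / 2},
        rootDensity (Q 0) (Q γ) z ^ 2 ∂(Q 0)
      ≤ ∫ v in {v | marginalDensity π (Q 0) (Q γ) v < 1 / 2},
          marginalDensity π (Q 0) (Q γ) v ∂((Q 0).map π) :=
        setIntegral_sq_rootDensity_le _ _ hπ hA
    _ ≤ ∫ _ in {v | marginalDensity π (Q 0) (Q γ) v < 1 / 2}, 1 ∂((Q 0).map π) :=
        setIntegral_mono_on (integrable_marginalDensity π _ _).integrableOn
          (integrable_const 1).integrableOn hA fun v hv => by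
            have hv' : marginalDensity π (Q 0) (Q γ) v < 1 / 2 := hv
            linarith
    _ = _ := by
        rw [setIntegral_const, smul_eq_mul, mul_one, map_measureReal_apply hπ hA]
        rfl

lemma tendsto_setIntegral_mul_sq_rootDensity_div [∀ γ, IsFiniteMeasure (Q γ)]
    (hs : IsRootDifferentiable (Q 0) (fun γ => rootDensity (Q 0) (Q γ)) g) (hπ : Measurable π)
    (hf_meas : ∀ γ, Measurable (f γ))
    (hf : ∀ᶠ γ in 𝓝[≠] 0, MemLp (f γ) 2 (Q γ) ∧ ∫ z, f γ z ^ 2 ∂(Q γ) ≤ K) :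
    Tendsto (fun γ => (∫ z in {z | marginalDensity π (Q 0) (Q γ) (π z) < 1 / 2},
      f γ z * rootDensity (Q 0) (Q γ) z ^ 2 ∂(Q 0)) / γ) (𝓝[≠] 0) (𝓝 0) := by
  have hroot : ∀ᶠ γ in 𝓝[≠] 0, MemLp (fun z => f γ z * rootDensity (Q 0) (Q γ) z) 2
      ((Q 0).restrict {z | marginalDensity π (Q 0) (Q γ) (π z) < 1 / 2}) ∧
      ∫ z in {z | marginalDensity π (Q 0) (Q γ) (π z) < 1 / 2},
        (f γ z * rootDensity (Q 0) (Q γ) z) ^ 2 ∂(Q 0) ≤ K := by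
    filter_upwards [hf] with γ ⟨hmem, hle⟩
    have hmem_root := memLp_mul_rootDensity (Q 0) (Q γ) (hf_meas γ).aestronglyMeasurable hmem
    exact ⟨hmem_root.restrict _, (setIntegral_le_integral hmem_root.integrable_sq
      (ae_of_all _ fun _ => sq_nonneg _)).trans ((integral_sq_mul_rootDensity_le _ _ hmem).trans
      hle)⟩
  refine squeeze_zero_norm (fun γ => ?_) (tendsto_integral_abs_mul hroot
    (Eventually.of_forall fun γ => ((hs.memLp γ).restrict _).mul_const γ⁻¹)
    (by simpa only [mul_pow, inv_pow, integral_mul_const, div_eq_mul_inv] using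
      tendsto_setIntegral_sq_rootDensity_div hs hπ))
  rw [div_eq_mul_inv, ← integral_mul_const]
  refine (norm_integral_le_integral_norm _).trans_eq (integral_congr_ae (ae_of_all _ fun z => ?_))
  simp only [Real.norm_eq_abs]
  ring_nf

lemma memLp_clippedInv_mul {P : Measure W} {θ : W → ℝ} (hθ : Measurable θ)
    (hf₀ : MemLp f₀ 2 P) :
    MemLp (fun z => clippedInv (θ z) * f₀ z) 2 P ∧
      ∫ z, (clippedInv (θ z) * f₀ z) ^ 2 ∂P ≤ 4 * ∫ z, f₀ z ^ 2 ∂P := by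
  have hle : ∀ z, |clippedInv (θ z) * f₀ z| ≤ |2 * f₀ z| := fun z => by
    rw [abs_mul, abs_mul, abs_of_nonneg (clippedInv_nonneg _), abs_two]
    exact mul_le_mul_of_nonneg_right (clippedInv_le_two _) (abs_nonneg _)
  refine ⟨(hf₀.const_mul 2).of_le
    ((measurable_clippedInv.comp hθ).aestronglyMeasurable.mul hf₀.1) (ae_of_all _ hle), ?_⟩
  refine (integral_sq_le_of_abs_le (hf₀.const_mul 2) (ae_of_all _ hle)).trans_eq ?_
  simp only [mul_pow, integral_const_mul]
  norm_num

lemma memLp_clippedInv_mul_rootDensity {P Q : Measure W} [IsFiniteMeasure P] [IsFiniteMeasure Q]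
    (hπ : Measurable π) {f f₀ : W → ℝ} (hf_meas : Measurable f) (hf : MemLp f 2 Q)
    (hratio : ∀ᵐ z ∂P, f z * marginalDensity π P Q (π z) = f₀ z) :
    MemLp (fun z => clippedInv (marginalDensity π P Q (π z)) * f₀ z * rootDensity P Q z) 2 P ∧
      ∫ z, (clippedInv (marginalDensity π P Q (π z)) * f₀ z * rootDensity P Q z) ^ 2 ∂P
        ≤ ∫ z, f z ^ 2 ∂Q := by
  have hA : MeasurableSet {z | marginalDensity π P Q (π z) < 1 / 2}ᶜ :=
    (measurableSet_lt ((measurable_marginalDensity π P Q).comp hπ) measurable_const).compl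
  have hroot := memLp_mul_rootDensity P Q hf_meas.aestronglyMeasurable hf
  have hcongr : {z | marginalDensity π P Q (π z) < 1 / 2}ᶜ.indicator
        (fun z => f z * rootDensity P Q z) =ᵐ[P]
      fun z => clippedInv (marginalDensity π P Q (π z)) * f₀ z * rootDensity P Q z := by
    filter_upwards [ae_eq_indicator_add_clippedInv_mul P Q hratio] with z hz
    rw [Set.indicator_mul_left, Set.indicator_compl, Pi.sub_apply]
    linear_combination rootDensity P Q z * hz
  have hmem := (hroot.indicator hA).ae_eq hcongr
  refine ⟨hmem, le_trans ?_ (integral_sq_mul_rootDensity_le P Q hf)⟩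
  refine integral_sq_le_of_abs_le hroot ?_
  filter_upwards [hcongr] with z hz
  rw [← hz]
  exact norm_indicator_le_norm_self (fun z => f z * rootDensity P Q z) z

variable [∀ γ, IsProbabilityMeasure (Q γ)]

lemma tendsto_integral_abs_clippedInv_sub_one
    (hs : IsRootDifferentiable (Q 0) (fun γ => rootDensity (Q 0) (Q γ)) g) (hπ : Measurable π) :
    Tendsto (fun γ => ∫ z, |clippedInv (marginalDensity π (Q 0) (Q γ) (π z)) - 1| ∂(Q 0))
      (𝓝[≠] 0) (𝓝 0) := by
  have hlim := hs.tendsto_integral_abs_sq_sub_one.const_mul (2 * 2)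
  rw [mul_zero] at hlim
  refine squeeze_zero (fun _ => integral_nonneg fun _ => abs_nonneg _) (fun γ => ?_) hlim
  have hθ : Integrable (fun z => |marginalDensity π (Q 0) (Q γ) (π z) - 1|) (Q 0) :=
    (((integrable_marginalDensity π _ _).comp_measurable hπ).sub (integrable_const 1)).abs
  calc ∫ z, |clippedInv (marginalDensity π (Q 0) (Q γ) (π z)) - 1| ∂(Q 0)
      ≤ ∫ z, 2 * |marginalDensity π (Q 0) (Q γ) (π z) - 1| ∂(Q 0) :=
        integral_mono_of_nonneg (ae_of_all _ fun _ => abs_nonneg _) (hθ.const_mul 2)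
          (ae_of_all _ fun _ => abs_clippedInv_sub_one_le _)
    _ ≤ _ := by
        rw [integral_const_mul, mul_assoc]
        gcongr
        exact integral_abs_marginalDensity_sub_one_le _ _ hπ

lemma tendsto_integral_clippedInv_mul_mul
    (hs : IsRootDifferentiable (Q 0) (fun γ => rootDensity (Q 0) (Q γ)) g) (hπ : Measurable π)
    (hf₀ : MemLp f₀ 2 (Q 0)) :
    Tendsto (fun γ => ∫ z, clippedInv (marginalDensity π (Q 0) (Q γ) (π z)) * f₀ z * g z ∂(Q 0))
      (𝓝[≠] 0) (𝓝 (∫ z, f₀ z * g z ∂(Q 0))) := by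
  have hmeas : ∀ γ, Measurable fun z => clippedInv (marginalDensity π (Q 0) (Q γ) (π z)) - 1 :=
    fun γ => (measurable_clippedInv.comp ((measurable_marginalDensity π _ _).comp hπ)).sub_const 1
  have hone : ∀ γ z, |clippedInv (marginalDensity π (Q 0) (Q γ) (π z)) - 1| ≤ 1 :=
    fun γ z => abs_clippedInv_sub_one_le_one _
  have hmem : ∀ γ,
      MemLp (fun z => clippedInv (marginalDensity π (Q 0) (Q γ) (π z)) - 1) 2 (Q 0) :=
    fun γ => MemLp.of_bound (hmeas γ).aestronglyMeasurable 1 (ae_of_all _ (hone γ))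
  have hL1 := tendsto_integral_abs_mul_of_tendsto_integral_abs (K := 1)
    (Eventually.of_forall fun γ => ⟨hmem γ, (integral_sq_le_of_abs_le (memLp_const 1)
      (ae_of_all _ fun z => (hone γ z).trans_eq abs_one.symm)).trans_eq (by simp)⟩)
      (tendsto_integral_abs_clippedInv_sub_one hs hπ) hf₀
  have hle : ∀ γ z,
      |(clippedInv (marginalDensity π (Q 0) (Q γ) (π z)) - 1) * f₀ z| ≤ |f₀ z| := fun γ z => by
    rw [abs_mul]
    exact mul_le_of_le_one_left (abs_nonneg _) (hone γ z)
  have hL2 := tendsto_integral_abs_mul_of_tendsto_integral_abs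
    (h := fun γ z => (clippedInv (marginalDensity π (Q 0) (Q γ) (π z)) - 1) * f₀ z)
    (Eventually.of_forall fun γ => ⟨hf₀.of_le ((hmeas γ).aestronglyMeasurable.mul hf₀.1)
      (ae_of_all _ (hle γ)), integral_sq_le_of_abs_le hf₀ (ae_of_all _ (hle γ))⟩)
    hL1 hs.memLp_score
  refine tendsto_iff_norm_sub_tendsto_zero.2 (squeeze_zero (fun _ => norm_nonneg _)
    (fun γ => ?_) hL2)
  have hΦ := (memLp_clippedInv_mul ((measurable_marginalDensity π (Q 0) (Q γ)).comp hπ) hf₀).1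
  rw [← integral_sub (by exact hΦ.integrable_mul hs.memLp_score)
    (by exact hf₀.integrable_mul hs.memLp_score)]
  refine (norm_integral_le_integral_norm _).trans_eq (integral_congr_ae (ae_of_all _ fun z => ?_))
  simp only [Real.norm_eq_abs]
  ring_nf

theorem HasScore.tendsto_integral_div (hQ : HasScore Q g) (hπ : Measurable π)
    (hf_meas : ∀ γ, Measurable (f γ))
    (hf : ∀ᶠ γ in 𝓝[≠] 0, MemLp (f γ) 2 (Q γ) ∧ ∫ z, f γ z ^ 2 ∂(Q γ) ≤ K)
    (hf₀ : MemLp f₀ 2 (Q 0))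
    (hratio : ∀ᶠ γ in 𝓝[≠] 0,
      ∀ᵐ z ∂(Q 0), f γ z * marginalDensity π (Q 0) (Q γ) (π z) = f₀ z)
    (hcent : ∀ φ : V → ℝ, Measurable φ → (∃ c, ∀ v, |φ v| ≤ c) →
      ∫ z, φ (π z) * f₀ z ∂(Q 0) = 0) :
    Tendsto (fun γ => (∫ z, f γ z ∂(Q γ)) / γ) (𝓝[≠] 0) (𝓝 (∫ z, f₀ z * g z ∂(Q 0))) := by
  obtain ⟨hs, hS⟩ := hasScore_iff.1 hQ
  have hθ := fun γ => (measurable_marginalDensity π (Q 0) (Q γ)).comp hπ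
  have hΦ : ∀ᶠ γ in 𝓝[≠] 0, MemLp (fun z =>
      clippedInv (marginalDensity π (Q 0) (Q γ) (π z)) * f₀ z) 2 (Q 0) ∧
      ∫ z, (clippedInv (marginalDensity π (Q 0) (Q γ) (π z)) * f₀ z) ^ 2 ∂(Q 0)
        ≤ max K (4 * ∫ z, f₀ z ^ 2 ∂(Q 0)) := Eventually.of_forall fun γ =>
    (memLp_clippedInv_mul (hθ γ) hf₀).imp_right fun h => h.trans (le_max_right _ _)
  have hΦs : ∀ᶠ γ in 𝓝[≠] 0, MemLp (fun z =>
      clippedInv (marginalDensity π (Q 0) (Q γ) (π z)) * f₀ z * rootDensity (Q 0) (Q γ) z) 2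
        (Q 0) ∧
      ∫ z, (clippedInv (marginalDensity π (Q 0) (Q γ) (π z)) * f₀ z
        * rootDensity (Q 0) (Q γ) z) ^ 2 ∂(Q 0) ≤ max K (4 * ∫ z, f₀ z ^ 2 ∂(Q 0)) := by
    filter_upwards [hf, hratio] with γ ⟨hmem, hle⟩ hr
    exact (memLp_clippedInv_mul_rootDensity hπ (hf_meas γ) hmem hr).imp_right fun h =>
      (h.trans hle).trans (le_max_left _ _)
  have hcent_clip : ∀ᶠ γ in 𝓝[≠] 0,
      ∫ z, clippedInv (marginalDensity π (Q 0) (Q γ) (π z)) * f₀ z ∂(Q 0) = 0 :=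
    Eventually.of_forall fun γ => hcent (fun v => clippedInv (marginalDensity π (Q 0) (Q γ) v))
      (measurable_clippedInv.comp (measurable_marginalDensity π _ _))
      ⟨2, fun v => (abs_of_nonneg (clippedInv_nonneg _)).trans_le (clippedInv_le_two _)⟩
  have hlim := ((tendsto_integral_singularPart_div hS hf).add
    (tendsto_setIntegral_mul_sq_rootDensity_div hs hπ hf_meas hf)).add
    ((hs.tendsto_integral_centred_div hΦ hΦs hcent_clip).add
      (tendsto_integral_clippedInv_mul_mul hs hπ hf₀))
  rw [zero_add, zero_add, zero_add] at hlim
  refine hlim.congr' ?_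
  filter_upwards [hf, hratio] with γ hmem hr
  rw [integral_eq_integral_singularPart_add (Q 0) (Q γ) hπ (hmem.1.integrable one_le_two) hr]
  ring

theorem HasScore.tendsto_integral_weighted_div (hQ : HasScore Q g) (hπ : Measurable π)
    {w : ℝ → V → ℝ} (hw : ∀ γ, Measurable (w γ)) (hw_nonneg : ∀ γ v, 0 ≤ w γ v) {ν : Measure V}
    (hν : ∀ᶠ γ in 𝓝 0, ((Q γ).map π).withDensity (fun v => ENNReal.ofReal (w γ v)) = ν)
    {r : W → ℝ} (hr : Measurable r) (h₀ : MemLp (fun z => w 0 (π z) * r z) 2 (Q 0)) {B : ℝ≥0}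
    (hB : ∀ᶠ γ in 𝓝 0, ∫⁻ z, ENNReal.ofReal ((w γ (π z) * r z) ^ 2) ∂(Q γ) ≤ B)
    (hcent : ∀ φ : V → ℝ, Measurable φ → (∃ c, ∀ v, |φ v| ≤ c) →
      ∫ z, φ (π z) * (w 0 (π z) * r z) ∂(Q 0) = 0) :
    Tendsto (fun γ => (∫ z, w γ (π z) * r z ∂(Q γ)) / γ) (𝓝[≠] 0)
      (𝓝 (∫ z, w 0 (π z) * r z * g z ∂(Q 0))) := by
  have hf_meas : ∀ γ, Measurable fun z => w γ (π z) * r z := fun γ => ((hw γ).comp hπ).mul hr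
  refine hQ.tendsto_integral_div (K := B) hπ hf_meas ?_ h₀ ?_ hcent
  · filter_upwards [hB.filter_mono nhdsWithin_le_nhds] with γ hγ
    have hint : Integrable (fun z => (w γ (π z) * r z) ^ 2) (Q γ) :=
      ⟨((hf_meas γ).pow_const 2).aestronglyMeasurable,
        (hasFiniteIntegral_iff_ofReal (ae_of_all _ fun _ => sq_nonneg _)).2
          (hγ.trans_lt ENNReal.coe_lt_top)⟩
    refine ⟨(memLp_two_iff_integrable_sq (hf_meas γ).aestronglyMeasurable).2 hint, ?_⟩
    rw [integral_eq_lintegral_of_nonneg_ae (ae_of_all _ fun _ => sq_nonneg _) hint.1]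
    exact ENNReal.toReal_mono ENNReal.coe_ne_top hγ
  · filter_upwards [hν.filter_mono nhdsWithin_le_nhds] with γ hγ
    filter_upwards [ae_weight_mul_marginalDensity_eq (Q 0) (Q γ) hπ (hw γ) (hw_nonneg γ) (hw 0)
      (hw_nonneg 0) (hγ.trans hν.self_of_nhds.symm)] with z hz
    rw [← hz]
    ring

end Path

section Tilt

variable {W : Type*} [MeasurableSpace W]

lemma abs_sqrt_one_add_mul_sub_one_div_sub_le {γ h : ℝ} (hγ : γ ≠ 0) (hle : -1 ≤ γ * h) :
    |(√(1 + γ * h) - 1) / γ - h / 2| ≤ |γ| * h ^ 2 / 2 := by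
  have hsq : √(1 + γ * h) ^ 2 = 1 + γ * h := Real.sq_sqrt (by linarith)
  have hrem : (√(1 + γ * h) - 1) / γ - h / 2 = -((√(1 + γ * h) - 1) ^ 2 / (2 * γ)) := by
    field_simp
    linear_combination hsq
  have hle_sq : (√(1 + γ * h) - 1) ^ 2 ≤ (γ * h) ^ 2 := by
    have hprod : γ * h = (√(1 + γ * h) - 1) * (√(1 + γ * h) + 1) := by linear_combination -hsq
    conv_rhs => rw [hprod, mul_pow]
    exact le_mul_of_one_le_right (sq_nonneg _)
      (one_le_pow₀ (le_add_of_nonneg_left (Real.sqrt_nonneg _)))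
  rw [hrem, abs_neg, abs_div, abs_sq, abs_mul, abs_two, div_le_iff₀ (by positivity)]
  calc (√(1 + γ * h) - 1) ^ 2 ≤ (γ * h) ^ 2 := hle_sq
    _ = |γ| * h ^ 2 / 2 * (2 * |γ|) := by rw [mul_pow, ← sq_abs γ]; ring

lemma hasScore_of_eventually_withDensity {Q : ℝ → Measure W} [∀ γ, IsFiniteMeasure (Q γ)]
    {h : W → ℝ} (hh : Measurable h) {c : ℝ} (hc : ∀ w, |h w| ≤ c)
    (hQ : ∀ᶠ γ in 𝓝 0, Q γ = (Q 0).withDensity fun w => ENNReal.ofReal (1 + γ * h w)) :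
    HasScore Q h := by
  replace hQ := hQ.filter_mono (nhdsWithin_le_nhds (s := {0}ᶜ))
  refine hasScore_iff.2 ⟨⟨MemLp.of_bound hh.aestronglyMeasurable c (ae_of_all _ hc),
    fun γ => memLp_rootDensity _ _, ?_⟩, ?_⟩
  · have hlim : Tendsto (fun γ : ℝ => ∫ _, (|γ| * c ^ 2 / 2) ^ 2 ∂(Q 0)) (𝓝[≠] 0) (𝓝 0) := by
      refine tendsto_nhdsWithin_of_tendsto_nhds ?_
      simp only [integral_const]
      exact Continuous.tendsto' (by fun_prop) 0 0 (by simp)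
    have hsmall : ∀ᶠ γ : ℝ in 𝓝[≠] 0, |γ| * c < 1 := nhdsWithin_le_nhds <|
      (Continuous.tendsto' (by fun_prop : Continuous fun γ : ℝ => |γ| * c) 0 0
        (by simp)).eventually (gt_mem_nhds one_pos)
    refine squeeze_zero' (Eventually.of_forall fun _ => integral_nonneg fun _ => sq_nonneg _) ?_
      hlim
    filter_upwards [hQ, hsmall, self_mem_nhdsWithin] with γ hγ hγc hne
    refine integral_sq_le_of_abs_le (memLp_const _) ?_
    have hderiv := Measure.rnDeriv_withDensity (Q 0) (f := fun w => ENNReal.ofReal (1 + γ * h w))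
      (by fun_prop)
    rw [← hγ] at hderiv
    filter_upwards [hderiv] with w hw
    have habs : |γ * h w| ≤ |γ| * c := by
      rw [abs_mul]
      exact mul_le_mul_of_nonneg_left (hc w) (abs_nonneg _)
    have hge : -1 ≤ γ * h w := (abs_le.1 (habs.trans hγc.le)).1
    rw [rootDensity, hw, ENNReal.toReal_ofReal (by linarith),
      abs_of_nonneg (a := |γ| * c ^ 2 / 2) (by positivity)]
    refine (abs_sqrt_one_add_mul_sub_one_div_sub_le hne hge).trans ?_
    rw [← sq_abs (h w)]
    gcongr
    exact hc w
  · refine tendsto_const_nhds.congr' ?_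
    filter_upwards [hQ] with γ hγ
    rw [hγ, Measure.singularPart_withDensity, measureReal_zero, Pi.zero_apply, zero_div]

end Tilt

section EfficientInfluence

variable {Θ W : Type*} [MeasurableSpace W] {obs : Θ → Measure W} {χ : Θ → ℝ} {θ₀ : Θ}
  {Γ : Set (ℝ → Θ)} {ψ g : W → ℝ}

lemma eLpNorm_two_eq_ofReal_sqrt {P : Measure W} {f : W → ℝ} (hf : MemLp f 2 P) :
    eLpNorm f 2 P = ENNReal.ofReal √(∫ w, f w ^ 2 ∂P) := by
  rw [hf.eLpNorm_eq_integral_rpow_norm two_ne_zero ENNReal.ofNat_ne_top, Real.sqrt_eq_rpow]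
  simp

lemma sq_integral_mul_le {P : Measure W} (hψ : MemLp ψ 2 P) (hg : MemLp g 2 P) :
    (∫ w, ψ w * g w ∂P) ^ 2 ≤ (∫ w, ψ w ^ 2 ∂P) * ∫ w, g w ^ 2 ∂P := by
  rw [← Real.sqrt_le_sqrt_iff (mul_nonneg (integral_nonneg fun _ => sq_nonneg _)
    (integral_nonneg fun _ => sq_nonneg _)), Real.sqrt_sq_eq_abs,
    Real.sqrt_mul (integral_nonneg fun _ => sq_nonneg _)]
  exact abs_integral_le_integral_abs.trans (integral_abs_mul_le_sqrt_mul_sqrt hψ hg)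

lemma integral_sq_sub {P : Measure W} (hψ : MemLp ψ 2 P) (hg : MemLp g 2 P) :
    ∫ w, (ψ w - g w) ^ 2 ∂P
      = ∫ w, ψ w ^ 2 ∂P - 2 * ∫ w, ψ w * g w ∂P + ∫ w, g w ^ 2 ∂P := by
  have hcross : Integrable (fun w => 2 * (ψ w * g w)) P := (hψ.integrable_mul hg).const_mul 2
  rw [← integral_const_mul, ← integral_sub hψ.integrable_sq hcross,
    ← integral_add (by exact hψ.integrable_sq.sub hcross) hg.integrable_sq]
  congr with w
  ring

lemma ofReal_integral_sq_le_sq_integral_mul_div {P : Measure W} (hψ : MemLp ψ 2 P)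
    (hg : MemLp g 2 P) :
    ENNReal.ofReal (∫ w, ψ w ^ 2 ∂P)
      ≤ ENNReal.ofReal ((∫ w, ψ w * g w ∂P) ^ 2) / ENNReal.ofReal (∫ w, g w ^ 2 ∂P)
        + ENNReal.ofReal (∫ w, (ψ w - g w) ^ 2 ∂P) := by
  have hdist := integral_sq_sub hψ hg
  have hcs := sq_integral_mul_le hψ hg
  set V := ∫ w, ψ w ^ 2 ∂P
  set G := ∫ w, g w ^ 2 ∂P
  set D := ∫ w, ψ w * g w ∂P
  have hG : 0 ≤ G := integral_nonneg fun _ => sq_nonneg _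
  have hproj : ENNReal.ofReal (2 * D - G) ≤ ENNReal.ofReal (D ^ 2) / ENNReal.ofReal G := by
    rcases hG.eq_or_lt with hG0 | hGpos
    · rw [← hG0, mul_zero] at hcs
      have hD : D = 0 := pow_eq_zero_iff two_ne_zero |>.1 (le_antisymm hcs (sq_nonneg _))
      simp [hD, ← hG0]
    · rw [← ENNReal.ofReal_div_of_pos hGpos]
      refine ENNReal.ofReal_le_ofReal ((le_div_iff₀ hGpos).2 ?_)
      linarith [sq_nonneg (D - G)]
  calc ENNReal.ofReal V = ENNReal.ofReal (2 * D - G + ∫ w, (ψ w - g w) ^ 2 ∂P) := by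
        rw [hdist]
        ring_nf
    _ ≤ _ := ENNReal.ofReal_add_le.trans (by gcongr)

lemma memLp_of_hasScore (hΓ : ∀ path ∈ Γ, path 0 = θ₀) {path : ℝ → Θ} (hpath : path ∈ Γ)
    (hg : HasScore (fun γ => obs (path γ)) g) : MemLp g 2 (obs θ₀) := by
  simpa only [hΓ path hpath] using hg.1

lemma IsInfluenceFunction.efficiencyLowerBound_le (hψ : IsInfluenceFunction obs χ θ₀ Γ ψ)
    (hΓ : ∀ path ∈ Γ, path 0 = θ₀) :
    efficiencyLowerBound obs χ θ₀ Γ ≤ ENNReal.ofReal (∫ w, ψ w ^ 2 ∂(obs θ₀)) := by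
  refine iSup₂_le fun path hpath => iSup₂_le fun g hg => iSup₂_le fun d hd =>
    ENNReal.div_le_of_le_mul ?_
  rw [hd.unique (hψ.2 path hpath g hg),
    ← ENNReal.ofReal_mul (integral_nonneg fun _ => sq_nonneg _)]
  exact ENNReal.ofReal_le_ofReal (sq_integral_mul_le hψ.1 (memLp_of_hasScore hΓ hpath hg))

lemma IsInfluenceFunction.sq_integral_mul_div_le_efficiencyLowerBound
    (hψ : IsInfluenceFunction obs χ θ₀ Γ ψ) (hg : g ∈ tangentSet obs Γ) :
    ENNReal.ofReal ((∫ w, ψ w * g w ∂(obs θ₀)) ^ 2) / ENNReal.ofReal (∫ w, g w ^ 2 ∂(obs θ₀))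
      ≤ efficiencyLowerBound obs χ θ₀ Γ := by
  obtain ⟨path, hpath, hscore⟩ := hg
  exact le_iSup₂_of_le path hpath (le_iSup₂_of_le g hscore
    (le_iSup₂_of_le _ (hψ.2 path hpath g hscore) le_rfl))

lemma IsInfluenceFunction.isEfficientInfluenceFunction_of_approx
    (hψ : IsInfluenceFunction obs χ θ₀ Γ ψ) (hΓ : ∀ path ∈ Γ, path 0 = θ₀)
    (happrox : ∀ η : ℝ, 0 < η → ∃ g ∈ tangentSet obs Γ, ∫ w, (ψ w - g w) ^ 2 ∂(obs θ₀) < η) :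
    IsEfficientInfluenceFunction obs χ θ₀ Γ ψ := by
  refine ⟨hψ, fun η hη => ?_⟩
  obtain ⟨ζ, hζ, hζη⟩ := ENNReal.lt_iff_exists_nnreal_btwn.1 hη
  rw [ENNReal.coe_pos] at hζ
  obtain ⟨g, ⟨path, hpath, hscore⟩, hlt⟩ := happrox (ζ ^ 2) (by positivity)
  refine ⟨g, Submodule.subset_span ⟨path, hpath, hscore⟩, lt_of_le_of_lt ?_ hζη⟩
  rw [eLpNorm_two_eq_ofReal_sqrt (by exact hψ.1.sub (memLp_of_hasScore hΓ hpath hscore)),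
    ← ENNReal.ofReal_coe_nnreal]
  exact ENNReal.ofReal_le_ofReal (Real.sqrt_le_iff.2 ⟨ζ.coe_nonneg, hlt.le⟩)

lemma IsInfluenceFunction.efficiencyLowerBound_eq_of_approx
    (hψ : IsInfluenceFunction obs χ θ₀ Γ ψ) (hΓ : ∀ path ∈ Γ, path 0 = θ₀)
    (happrox : ∀ η : ℝ, 0 < η → ∃ g ∈ tangentSet obs Γ, ∫ w, (ψ w - g w) ^ 2 ∂(obs θ₀) < η) :
    efficiencyLowerBound obs χ θ₀ Γ = ENNReal.ofReal (∫ w, ψ w ^ 2 ∂(obs θ₀)) := by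
  refine (hψ.efficiencyLowerBound_le hΓ).antisymm (ENNReal.le_of_forall_pos_le_add
    fun η hη _ => ?_)
  obtain ⟨g, hg, hlt⟩ := happrox η (by exact_mod_cast hη)
  obtain ⟨path, hpath, hscore⟩ := id hg
  refine (ofReal_integral_sq_le_sq_integral_mul_div hψ.1
    (memLp_of_hasScore hΓ hpath hscore)).trans ?_
  rw [← ENNReal.ofReal_coe_nnreal]
  gcongr
  exact hψ.sq_integral_mul_div_le_efficiencyLowerBound hg

end EfficientInfluence

end Efficiency

namespace Surrogate

section Measure

variable {α β γ : Type*} [MeasurableSpace α] [MeasurableSpace β] [MeasurableSpace γ]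

lemma withDensity_fst_compProd (μ : Measure α) [SFinite μ] (κ : Kernel α β) [IsSFiniteKernel κ]
    {f : α → ℝ≥0∞} (hf : Measurable f) :
    (μ ⊗ₘ κ).withDensity (fun z => f z.1) = μ.withDensity f ⊗ₘ κ := by
  have hf' : Measurable fun z : α × β => f z.1 := hf.comp measurable_fst
  refine Measure.ext_of_lintegral _ fun g hg => ?_
  rw [lintegral_withDensity_eq_lintegral_mul _ hf' hg, Measure.lintegral_compProd (hf'.mul hg),
    Measure.lintegral_compProd hg,
    lintegral_withDensity_eq_lintegral_mul _ hf hg.lintegral_kernel_prod_right']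
  refine lintegral_congr fun a => ?_
  simp only [Pi.mul_apply]
  rw [lintegral_const_mul _ (by fun_prop)]

lemma map_withDensity_comp {μ : Measure α} {f : α → β} (hf : Measurable f) {g : β → ℝ≥0∞}
    (hg : Measurable g) :
    (μ.withDensity fun a => g (f a)).map f = (μ.map f).withDensity g := by
  ext s hs
  rw [Measure.map_apply hf hs, withDensity_apply _ (hf hs), withDensity_apply _ hs,
    setLIntegral_map hs hg hf]

lemma eq_of_withDensity_comp_eq {μ ν : Measure α} {f : α → β} (hf : Measurable f) {g : β → ℝ≥0∞}
    (hg : Measurable g) (hpos : ∀ᵐ b ∂(μ.map f), g b ≠ 0) (hfin : ∀ᵐ b ∂(μ.map f), g b ≠ ∞)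
    (hmap : μ.map f = ν.map f)
    (h : (μ.withDensity fun a => g (f a)) = ν.withDensity fun a => g (f a)) : μ = ν := by
  have hgf : Measurable fun a => g (f a) := hg.comp hf
  rw [← withDensity_inv_same hgf (ae_of_ae_map hf.aemeasurable hpos)
    (ae_of_ae_map hf.aemeasurable hfin), h]
  rw [hmap] at hpos hfin
  exact withDensity_inv_same hgf (ae_of_ae_map hf.aemeasurable hpos)
    (ae_of_ae_map hf.aemeasurable hfin)

lemma restrict_eq_smul_cond (μ : Measure α) [IsFiniteMeasure μ] (s : Set α) :
    μ.restrict s = μ s • ProbabilityTheory.cond μ s := by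
  rcases eq_or_ne (μ s) 0 with h | h
  · rw [h, zero_smul, Measure.restrict_eq_zero.2 h]
  · rw [ProbabilityTheory.cond, smul_smul, ENNReal.mul_inv_cancel h (measure_ne_top _ _), one_smul]

lemma map_restrict_eq_compProd_of_cond {μ : Measure α} [IsFiniteMeasure μ] {s : Set α} {X : α → β}
    {Y : α → γ} {κ : Kernel β γ} [IsSFiniteKernel κ]
    (h : (ProbabilityTheory.cond μ s).map (fun a => (X a, Y a))
      = (ProbabilityTheory.cond μ s).map X ⊗ₘ κ) :
    (μ.restrict s).map (fun a => (X a, Y a)) = (μ.restrict s).map X ⊗ₘ κ := by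
  rw [restrict_eq_smul_cond, Measure.map_smul, Measure.map_smul, h, Measure.compProd_smul_left]

lemma condDistrib_congr_of_map_eq [StandardBorelSpace γ] [Nonempty γ] {X : α → β} {Y : α → γ}
    {μ μ' : Measure α} [IsFiniteMeasure μ] [IsFiniteMeasure μ']
    (h : μ.map (fun a => (X a, Y a)) = μ'.map fun a => (X a, Y a)) :
    condDistrib Y X μ = condDistrib Y X μ' := by
  simp only [condDistrib, h]

lemma map_restrict_preimage_eq_withDensity [StandardBorelSpace γ] [Nonempty γ] {μ : Measure α}
    [IsFiniteMeasure μ] {X : α → β} (hX : Measurable X) {Y : α → γ} (hY : Measurable Y)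
    {s : Set γ} (hs : MeasurableSet s) :
    (μ.restrict (Y ⁻¹' s)).map X = (μ.map X).withDensity fun b => condDistrib Y X μ b s := by
  ext A hA
  rw [Measure.map_apply hX hA, Measure.restrict_apply (hX hA), withDensity_apply _ hA,
    setLIntegral_map hA (Kernel.measurable_coe _ hs) hX,
    setLIntegral_preimage_condDistrib hX hY.aemeasurable hs hA]

lemma map_restrict_preimage_of_condIndepFun [StandardBorelSpace α] [StandardBorelSpace γ]
    [Nonempty γ] {δ : Type*} [MeasurableSpace δ] [StandardBorelSpace δ] [Nonempty δ]
    {μ : Measure α} [IsFiniteMeasure μ] {X : α → β} (hX : Measurable X) {Z : α → δ}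
    (hZ : Measurable Z) {Y : α → γ} (hY : Measurable Y)
    (h : CondIndepFun (MeasurableSpace.comap X inferInstance) hX.comap_le Z Y μ)
    {s : Set γ} (hs : MeasurableSet s) :
    (μ.restrict (Y ⁻¹' s)).map (fun a => (X a, Z a))
      = (μ.map fun a => (X a, Z a)).withDensity fun b => condDistrib Y X μ b.1 s := by
  rw [map_restrict_preimage_eq_withDensity (hX.prodMk hZ) hY hs]
  refine withDensity_congr_ae ?_
  filter_upwards [(condIndepFun_iff_condDistrib_prod_ae_eq_prodMkRight hY hZ hX).1 h] with b hb
  rw [hb, Kernel.prodMkRight_apply]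

end Measure

section Arms

variable {𝒳 𝒮 : Type*} [MeasurableSpace 𝒳] [MeasurableSpace 𝒮]

attribute [fun_prop] measurable_cov

@[fun_prop]
lemma measurable_trt : Measurable (trt : FullData 𝒳 𝒮 → Bool) := measurable_fst.comp measurable_snd

@[fun_prop]
lemma measurable_surr (t : Bool) : Measurable (surr t : FullData 𝒳 𝒮 → 𝒮) :=
  (measurable_pi_apply t).comp (measurable_fst.comp (measurable_snd.comp measurable_snd))

@[fun_prop]
lemma measurable_out (t : Bool) : Measurable (out t : FullData 𝒳 𝒮 → ℝ) :=
  (measurable_pi_apply t).comp (measurable_snd.comp (measurable_snd.comp measurable_snd))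

lemma measurable_apply_trt {β : Type*} [MeasurableSpace β] {f : Bool → FullData 𝒳 𝒮 → β}
    (hf : ∀ t, Measurable (f t)) : Measurable fun v => f (trt v) v :=
  (measurable_from_prod_countable_right (f := fun q : Bool × FullData 𝒳 𝒮 => f q.1 q.2) hf).comp
    (measurable_trt.prodMk measurable_id)

@[fun_prop]
lemma measurable_surrObs : Measurable (surrObs : FullData 𝒳 𝒮 → 𝒮) :=
  measurable_apply_trt measurable_surr

@[fun_prop]
lemma measurable_outObs : Measurable (outObs : FullData 𝒳 𝒮 → ℝ) :=
  measurable_apply_trt measurable_out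

@[fun_prop]
lemma measurable_covTrtSurr : Measurable (covTrtSurr : FullData 𝒳 𝒮 → 𝒳 × Bool × 𝒮) :=
  measurable_cov.prodMk (measurable_trt.prodMk measurable_surrObs)

@[fun_prop]
lemma measurable_observe : Measurable (observe : FullData 𝒳 𝒮 → Obs 𝒳 𝒮) :=
  measurable_cov.prodMk (measurable_trt.prodMk (measurable_surrObs.prodMk measurable_outObs))

lemma measurableSet_arm (t : Bool) : MeasurableSet (arm t : Set (FullData 𝒳 𝒮)) :=
  measurable_trt (measurableSet_singleton t)

/-- The triple `(X, T, S)` of a unit with `(X, S) = z` that is assigned to the treatment `t`. -/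
def inArm (t : Bool) (z : 𝒳 × 𝒮) : 𝒳 × Bool × 𝒮 := (z.1, t, z.2)

@[fun_prop]
lemma measurable_inArm (t : Bool) : Measurable (inArm t : 𝒳 × 𝒮 → 𝒳 × Bool × 𝒮) := by
  unfold inArm; fun_prop

lemma measurable_of_comp_inArm {β : Type*} [MeasurableSpace β] {f : 𝒳 × Bool × 𝒮 → β}
    (h : ∀ t, Measurable fun z => f (inArm t z)) : Measurable f :=
  (measurable_from_prod_countable_right
    (f := fun q : Bool × 𝒳 × 𝒮 => f (inArm q.1 q.2)) h).comp
    (by fun_prop : Measurable fun z : 𝒳 × Bool × 𝒮 => (z.2.1, z.1, z.2.2))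

variable {m : Measure (FullData 𝒳 𝒮)}

lemma ae_restrict_arm (m : Measure (FullData 𝒳 𝒮)) (t : Bool) :
    ∀ᵐ v ∂(m.restrict (arm t)), trt v = t ∧ surrObs v = surr t v ∧ outObs v = out t v := by
  filter_upwards [ae_restrict_mem (measurableSet_arm t)] with v hv
  have htrt : trt v = t := hv
  simp [surrObs, outObs, htrt]

lemma map_cov_surrObs_restrict_arm (t : Bool) :
    (m.restrict (arm t)).map (fun v => (cov v, surrObs v))
      = (m.restrict (arm t)).map fun v => (cov v, surr t v) :=
  Measure.map_congr <| (ae_restrict_arm m t).mono fun v hv => by simp only [hv.2.1]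

lemma map_cov_surrObs_outObs_restrict_arm (t : Bool) :
    (m.restrict (arm t)).map (fun v => ((cov v, surrObs v), outObs v))
      = (m.restrict (arm t)).map fun v => ((cov v, surr t v), out t v) :=
  Measure.map_congr <| (ae_restrict_arm m t).mono fun v hv => by simp only [hv.2.1, hv.2.2]

lemma map_cov_surrObs_restrict_arm_eq_compProd [StandardBorelSpace 𝒮] [Nonempty 𝒮]
    [IsFiniteMeasure m] (t : Bool) :
    (m.restrict (arm t)).map (fun v => (cov v, surrObs v))
      = ((m.map cov).withDensity fun x => condDistrib trt cov m x {t}) ⊗ₘ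
        condDistrib surrObs cov (ProbabilityTheory.cond m (arm t)) := by
  rw [← map_restrict_preimage_eq_withDensity measurable_cov measurable_trt
    (measurableSet_singleton t)]
  exact map_restrict_eq_compProd_of_cond
    (compProd_map_condDistrib measurable_surrObs.aemeasurable).symm

lemma map_restrict_arm_eq_compProd_comap [IsFiniteMeasure m] (t : Bool)
    {K : Kernel (𝒳 × Bool × 𝒮) ℝ} [IsSFiniteKernel K]
    (h : m.map (fun v => (covTrtSurr v, outObs v)) = m.map covTrtSurr ⊗ₘ K) :
    (m.restrict (arm t)).map (fun v => ((cov v, surrObs v), outObs v))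
      = (m.restrict (arm t)).map (fun v => (cov v, surrObs v)) ⊗ₘ
        K.comap (inArm t) (measurable_inArm t) := by
  refine Measure.ext_prod fun {A B} hA hB => ?_
  have hA' : MeasurableSet {z : 𝒳 × Bool × 𝒮 | (z.1, z.2.2) ∈ A ∧ z.2.1 = t} :=
    ((by fun_prop : Measurable fun z : 𝒳 × Bool × 𝒮 => (z.1, z.2.2)) hA).inter
      ((by fun_prop : Measurable fun z : 𝒳 × Bool × 𝒮 => z.2.1) (measurableSet_singleton t))
  have hset : (fun v : FullData 𝒳 𝒮 => ((cov v, surrObs v), outObs v)) ⁻¹' A ×ˢ B ∩ arm t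
      = (fun v => (covTrtSurr v, outObs v)) ⁻¹' {z | (z.1, z.2.2) ∈ A ∧ z.2.1 = t} ×ˢ B := by
    ext v
    simp only [arm, covTrtSurr, Set.mem_inter_iff, Set.mem_preimage, Set.mem_prod,
      Set.mem_ofPred_eq]
    tauto
  have hKA : Measurable fun z => K (inArm t z) B :=
    (Kernel.measurable_coe K hB).comp (measurable_inArm t)
  rw [Measure.map_apply (by fun_prop) (hA.prod hB), Measure.restrict_apply
      ((by fun_prop : Measurable fun v : FullData 𝒳 𝒮 => ((cov v, surrObs v), outObs v))
        (hA.prod hB)), hset,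
    ← Measure.map_apply (by fun_prop) (hA'.prod hB), h, Measure.compProd_apply_prod hA' hB,
    setLIntegral_map hA' (Kernel.measurable_coe K hB) measurable_covTrtSurr,
    Measure.compProd_apply_prod hA hB]
  simp only [Kernel.comap_apply]
  rw [setLIntegral_map hA hKA (by fun_prop), Measure.restrict_restrict
    ((by fun_prop : Measurable fun v : FullData 𝒳 𝒮 => (cov v, surrObs v)) hA)]
  refine setLIntegral_congr_fun (measurable_covTrtSurr hA') fun v hv => ?_
  simp only [inArm, covTrtSurr, ← hv.2]

end Arms

section Weights

lemma real_singleton_false (μ : Measure Bool) [IsProbabilityMeasure μ] :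
    μ.real {false} = 1 - μ.real {true} := by
  rw [← probReal_compl_eq_one_sub (measurableSet_singleton true)]
  congr 1
  ext b
  simp

lemma real_singleton_pos {μ : Measure Bool} [IsProbabilityMeasure μ]
    (hpos : 0 < μ.real {true}) (hlt : μ.real {true} < 1) (t : Bool) : 0 < μ.real {t} := by
  cases t
  · rw [real_singleton_false]; linarith
  · exact hpos

/-- The sign with which the mean outcome in an arm enters the average treatment effect. -/
def armSign (t : Bool) : ℝ := if t then 1 else -1

lemma measurable_armSign : Measurable armSign := measurable_of_finite _

namespace Population

variable {𝒳 𝒮 : Type*} [MeasurableSpace 𝒳] [MeasurableSpace 𝒮]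

/-- The part `(X, T, S)` of an observation. -/
def dropOut (w : Obs 𝒳 𝒮) : 𝒳 × Bool × 𝒮 := (w.1, w.2.1, w.2.2.1)

@[fun_prop]
lemma measurable_dropOut : Measurable (dropOut : Obs 𝒳 𝒮 → 𝒳 × Bool × 𝒮) := by
  unfold dropOut; fun_prop

lemma measurable_ratioCov (p : Population 𝒳 𝒮) : Measurable p.ratioCov :=
  (Measure.measurable_rnDeriv _ _).ennreal_toReal

lemma ratioCov_nonneg (p : Population 𝒳 𝒮) (x : 𝒳) : 0 ≤ p.ratioCov x := ENNReal.toReal_nonneg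

lemma withDensity_ratioCov {p : Population 𝒳 𝒮} (hac : p.law.map cov ≪ p.labelled.map cov) :
    ((p.labelled.map cov).withDensity fun x => ENNReal.ofReal (p.ratioCov x)) = p.law.map cov := by
  refine (withDensity_congr_ae ?_).trans (Measure.withDensity_rnDeriv_eq _ _ hac)
  filter_upwards [Measure.rnDeriv_lt_top (p.law.map cov) (p.labelled.map cov)] with x hfin
  rw [ratioCov, ENNReal.ofReal_toReal hfin.ne]

lemma measurable_outcomeReg (p : Population 𝒳 𝒮) :
    Measurable fun z : 𝒳 × Bool × 𝒮 => p.outcomeReg z.2.1 z.1 z.2.2 :=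
  (StronglyMeasurable.integral_condDistrib (μ := p.labelled) (X := covTrtSurr) (Y := outObs)
    (f := fun q : (𝒳 × Bool × 𝒮) × ℝ => q.2) measurable_snd.stronglyMeasurable).measurable

/-- The conditional law of `Y` given `(X, T, S)` and `R = 1`. -/
abbrev outKernel (p : Population 𝒳 𝒮) : Kernel (𝒳 × Bool × 𝒮) ℝ :=
  condDistrib outObs covTrtSurr p.labelled

/-- The residual `Y - μ̃(T, X, S)`, with the sign of the arm. -/
def signedResidual (p : Population 𝒳 𝒮) (w : Obs 𝒳 𝒮) : ℝ :=
  armSign w.2.1 * (w.2.2.2 - p.outcomeReg w.2.1 w.1 w.2.2.1)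

lemma measurable_signedResidual (p : Population 𝒳 𝒮) : Measurable p.signedResidual :=
  (measurable_armSign.comp (by fun_prop)).mul
    ((by fun_prop : Measurable fun w : Obs 𝒳 𝒮 => w.2.2.2).sub
      (p.measurable_outcomeReg.comp measurable_dropOut))

variable [StandardBorelSpace 𝒮] [Nonempty 𝒮]

instance (p : Population 𝒳 𝒮) (t : Bool) : IsMarkovKernel (p.surrKernel t) := by
  unfold surrKernel; infer_instance

instance (p : Population 𝒳 𝒮) (t : Bool) : IsMarkovKernel (p.surrKernelLabelled t) := by
  unfold surrKernelLabelled; infer_instance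

/-- The factor `λ(X) λ_T(S, X) / P(T | R = 1, X)` by which `psi` multiplies the residual: the
density, with respect to the labelled law of `(X, S)` in an arm, of the law under which `X` is
distributed as in the population and `S` given `X` as in that arm of the population. -/
def weight (p : Population 𝒳 𝒮) (z : 𝒳 × Bool × 𝒮) : ℝ :=
  p.ratioCov z.1 * p.ratioSurr z.2.1 z.2.2 z.1 / (condDistrib trt cov p.labelled z.1).real {z.2.1}

lemma measurable_ratioSurr (p : Population 𝒳 𝒮) (t : Bool) :
    Measurable fun z : 𝒳 × 𝒮 => p.ratioSurr t z.2 z.1 :=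
  (Kernel.measurable_rnDeriv (p.surrKernel t) (p.surrKernelLabelled t)).ennreal_toReal

lemma weight_nonneg (p : Population 𝒳 𝒮) (z : 𝒳 × Bool × 𝒮) : 0 ≤ p.weight z :=
  div_nonneg (mul_nonneg (p.ratioCov_nonneg _) ENNReal.toReal_nonneg) measureReal_nonneg

lemma measurable_weight (p : Population 𝒳 𝒮) : Measurable p.weight := by
  refine measurable_of_comp_inArm fun t => ?_
  have hprob : Measurable fun z : 𝒳 × 𝒮 => (condDistrib trt cov p.labelled z.1).real {t} :=
    ((Kernel.measurable_coe _ (measurableSet_singleton t)).comp measurable_fst).ennreal_toReal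
  exact ((p.measurable_ratioCov.comp measurable_fst).mul (p.measurable_ratioSurr t)).div hprob

lemma measurable_ofReal_weight_inArm (p : Population 𝒳 𝒮) (t : Bool) :
    Measurable fun z : 𝒳 × 𝒮 => ENNReal.ofReal (p.weight (inArm t z)) :=
  (p.measurable_weight.comp (measurable_inArm t)).ennreal_ofReal

lemma weightedResidual_eq (p p₀ : Population 𝒳 𝒮) (w : Obs 𝒳 𝒮) :
    p.weightedResidual p₀ w = p.weight (dropOut w) * p₀.signedResidual w := by
  obtain ⟨x, t, s, y⟩ := w
  cases t
  · simp only [weightedResidual, weight, signedResidual, dropOut, armSign, propensityLabelled,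
      real_singleton_false, Bool.false_eq_true, if_false]
    ring
  · simp only [weightedResidual, weight, signedResidual, dropOut, armSign, propensityLabelled,
      if_true]
    ring

lemma measurable_weightedResidual (p p₀ : Population 𝒳 𝒮) :
    Measurable (p.weightedResidual p₀) := by
  rw [funext (p.weightedResidual_eq p₀)]
  exact (p.measurable_weight.comp measurable_dropOut).mul p₀.measurable_signedResidual

lemma prob_mul_ofReal_weight {p : Population 𝒳 𝒮} {t : Bool} {x : 𝒳}
    (hpos : 0 < (condDistrib trt cov p.labelled x).real {t}) (s : 𝒮) :
    condDistrib trt cov p.labelled x {t} * ENNReal.ofReal (p.weight (inArm t (x, s)))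
      = ENNReal.ofReal (p.ratioCov x) * ENNReal.ofReal (p.ratioSurr t s x) := by
  rw [← ofReal_measureReal, ← ENNReal.ofReal_mul hpos.le,
    ← ENNReal.ofReal_mul (p.ratioCov_nonneg x)]
  simp only [weight, inArm, mul_div_cancel₀ _ hpos.ne']

lemma lintegral_ofReal_ratioSurr_mul {p : Population 𝒳 𝒮} {t : Bool} {x : 𝒳}
    (hac : p.surrKernel t x ≪ p.surrKernelLabelled t x) {f : 𝒮 → ℝ≥0∞} (hf : Measurable f) :
    ∫⁻ s, ENNReal.ofReal (p.ratioSurr t s x) * f s ∂(p.surrKernelLabelled t x)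
      = ∫⁻ s, f s ∂(p.surrKernel t x) := by
  rw [← lintegral_rnDeriv_mul hac hf.aemeasurable]
  refine lintegral_congr_ae ?_
  filter_upwards [Kernel.rnDeriv_eq_rnDeriv_measure (κ := p.surrKernel t)
    (η := p.surrKernelLabelled t) (a := x),
    Measure.rnDeriv_lt_top (p.surrKernel t x) (p.surrKernelLabelled t x)] with s hs hfin
  simp only [ratioSurr, hs, ENNReal.ofReal_toReal hfin.ne]

namespace Admissible

variable [StandardBorelSpace 𝒳] {ε C : ℝ} {p : Population 𝒳 𝒮}

lemma condDistrib_trt_singleton_ne_zero (hε : 0 < ε) (hp : p.Admissible ε C) (t : Bool) :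
    ∀ᵐ x ∂(p.law.map cov), condDistrib trt cov p.law x {t} ≠ 0 := by
  filter_upwards [hp.overlap] with x ⟨hle, hge⟩
  have hpos : 0 < (condDistrib trt cov p.law x).real {t} :=
    real_singleton_pos (hε.trans_le hle) (hge.trans_lt (by linarith)) t
  rwa [measureReal_def, ENNReal.toReal_pos_iff, and_iff_left (measure_lt_top _ _),
    pos_iff_ne_zero] at hpos

lemma withDensity_weight_map_restrict_arm (hp : p.Admissible ε C) (t : Bool) :
    ((p.labelled.restrict (arm t)).map fun v => (cov v, surrObs v)).withDensity
        (fun z => ENNReal.ofReal (p.weight (inArm t z)))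
      = p.law.map cov ⊗ₘ p.surrKernel t := by
  set E : 𝒳 → ℝ≥0∞ := fun x => condDistrib trt cov p.labelled x {t}
  have hEm : Measurable E := Kernel.measurable_coe _ (measurableSet_singleton t)
  have hratiom : Measurable fun x => ENNReal.ofReal (p.ratioCov x) :=
    p.measurable_ratioCov.ennreal_ofReal
  have hwm := p.measurable_ofReal_weight_inArm t
  have hae := (hp.ratioSurr_ac t).and hp.overlap_labelled
  rw [← withDensity_ratioCov hp.ratioCov_ac, ae_withDensity_iff hratiom] at hae
  rw [map_cov_surrObs_restrict_arm_eq_compProd, ← withDensity_ratioCov hp.ratioCov_ac]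
  refine Measure.ext_of_lintegral _ fun f hf => ?_
  rw [lintegral_withDensity_eq_lintegral_mul _ hwm hf, Measure.lintegral_compProd (hwm.mul hf),
    lintegral_withDensity_eq_lintegral_mul _ hEm (hwm.mul hf).lintegral_kernel_prod_right',
    Measure.lintegral_compProd hf,
    lintegral_withDensity_eq_lintegral_mul _ hratiom hf.lintegral_kernel_prod_right']
  refine lintegral_congr_ae ?_
  filter_upwards [hae] with x hx
  have hfx : Measurable fun s => f (x, s) := hf.comp measurable_prodMk_left
  have hwfx : Measurable fun s => ENNReal.ofReal (p.weight (inArm t (x, s))) * f (x, s) :=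
    (hwm.mul hf).comp measurable_prodMk_left
  have hrfx : Measurable fun s => ENNReal.ofReal (p.ratioSurr t s x) * f (x, s) :=
    ((p.measurable_ratioSurr t).ennreal_ofReal.mul hf).comp measurable_prodMk_left
  change E x * ∫⁻ s, ENNReal.ofReal (p.weight (inArm t (x, s))) * f (x, s)
      ∂(p.surrKernelLabelled t x)
    = ENNReal.ofReal (p.ratioCov x) * ∫⁻ s, f (x, s) ∂(p.surrKernel t x)
  by_cases hzero : ENNReal.ofReal (p.ratioCov x) = 0
  · have hratio : p.ratioCov x = 0 :=
      le_antisymm (ENNReal.ofReal_eq_zero.1 hzero) (p.ratioCov_nonneg x)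
    simp [weight, inArm, hratio]
  · obtain ⟨hac, hlo, hhi⟩ := hx hzero
    rw [← lintegral_ofReal_ratioSurr_mul hac hfx, ← lintegral_const_mul _ hwfx,
      ← lintegral_const_mul _ hrfx]
    refine lintegral_congr fun s => ?_
    rw [← mul_assoc, ← mul_assoc, prob_mul_ofReal_weight (real_singleton_pos hlo hhi t)]

lemma map_restrict_arm_of_fst_eq (hp : p.Admissible ε C) (t : Bool) {β : Type*}
    [MeasurableSpace β] {φ : 𝒳 × ℝ × 𝒮 → β} (hφ : Measurable φ) {π : β → 𝒳} (hπ : Measurable π)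
    (hπφ : ∀ z, π (φ z) = z.1) :
    (p.law.restrict (arm t)).map (fun v => φ (cov v, out t v, surr t v))
      = (p.law.map fun v => φ (cov v, out t v, surr t v)).withDensity
        fun b => condDistrib trt cov p.law (π b) {t} := by
  have hprob : Measurable fun x => condDistrib trt cov p.law x {t} :=
    Kernel.measurable_coe _ (measurableSet_singleton t)
  have hpot : Measurable fun v : FullData 𝒳 𝒮 => (cov v, out t v, surr t v) := by fun_prop
  have harm := map_restrict_preimage_of_condIndepFun measurable_cov
    ((measurable_out t).prodMk (measurable_surr t)) measurable_trt (hp.unconfounded_trt t)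
    (measurableSet_singleton t)
  have hmap := congrArg (fun μ => μ.map φ) harm
  beta_reduce at hmap
  rw [Measure.map_map hφ hpot] at hmap
  refine hmap.trans ?_
  simp only [← hπφ]
  refine (map_withDensity_comp hφ (hprob.comp hπ)).trans ?_
  rw [Measure.map_map hφ hpot]
  rfl

lemma map_cov_surr_eq_compProd (hε : 0 < ε) (hp : p.Admissible ε C) (t : Bool) :
    p.law.map (fun v => (cov v, surr t v)) = p.law.map cov ⊗ₘ p.surrKernel t := by
  have hprob : Measurable fun x => condDistrib trt cov p.law x {t} :=
    Kernel.measurable_coe _ (measurableSet_singleton t)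
  have hmap : (p.law.map fun v => (cov v, surr t v)).map Prod.fst = p.law.map cov :=
    Measure.map_map measurable_fst (by fun_prop)
  refine eq_of_withDensity_comp_eq measurable_fst hprob ?_
    (ae_of_all _ fun _ => measure_ne_top _ _) (hmap.trans (Measure.fst_compProd _ _).symm) ?_
  · rw [hmap]
    exact hp.condDistrib_trt_singleton_ne_zero hε t
  · rw [withDensity_fst_compProd _ _ hprob, surrKernel, ← map_cov_surrObs_restrict_arm_eq_compProd,
      map_cov_surrObs_restrict_arm]
    exact (hp.map_restrict_arm_of_fst_eq t
      (by fun_prop : Measurable fun z : 𝒳 × ℝ × 𝒮 => (z.1, z.2.2)) measurable_fst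
      fun _ => rfl).symm

lemma map_out_eq_compProd_of_restrict_arm (hε : 0 < ε) (hp : p.Admissible ε C) {t : Bool}
    {κ : Kernel (𝒳 × 𝒮) ℝ} [IsMarkovKernel κ]
    (h : (p.law.restrict (arm t)).map (fun v => ((cov v, surr t v), out t v))
      = (p.law.restrict (arm t)).map (fun v => (cov v, surr t v)) ⊗ₘ κ) :
    p.law.map (fun v => ((cov v, surr t v), out t v))
      = p.law.map (fun v => (cov v, surr t v)) ⊗ₘ κ := by
  have hprob : Measurable fun x => condDistrib trt cov p.law x {t} :=
    Kernel.measurable_coe _ (measurableSet_singleton t)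
  have hfst : Measurable fun z : (𝒳 × 𝒮) × ℝ => z.1.1 := by fun_prop
  have hmap : (p.law.map fun v => ((cov v, surr t v), out t v)).map (fun z => z.1.1)
      = p.law.map cov := Measure.map_map hfst (by fun_prop)
  have hmap' : (p.law.map (fun v => (cov v, surr t v)) ⊗ₘ κ).map (fun z => z.1.1)
      = p.law.map cov := by
    refine (Measure.map_map measurable_fst measurable_fst).symm.trans ?_
    rw [← Measure.fst, ← Measure.fst, Measure.fst_compProd]
    exact Measure.map_map measurable_fst (by fun_prop)
  refine eq_of_withDensity_comp_eq hfst hprob ?_ (ae_of_all _ fun _ => measure_ne_top _ _)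
    (hmap.trans hmap'.symm) ?_
  · rw [hmap]
    exact hp.condDistrib_trt_singleton_ne_zero hε t
  · refine Eq.trans ?_ (withDensity_fst_compProd _ κ (hprob.comp measurable_fst)).symm
    refine (hp.map_restrict_arm_of_fst_eq t
      (by fun_prop : Measurable fun z : 𝒳 × ℝ × 𝒮 => ((z.1, z.2.2), z.2.1)) hfst
      fun _ => rfl).symm.trans (h.trans ?_)
    rw [hp.map_restrict_arm_of_fst_eq t
      (by fun_prop : Measurable fun z : 𝒳 × ℝ × 𝒮 => (z.1, z.2.2)) measurable_fst fun _ => rfl]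
    rfl

lemma exists_common_outcome_kernel (hε : 0 < ε) (hp : p.Admissible ε C) (t : Bool) :
    ∃ κ : Kernel (𝒳 × 𝒮) ℝ, IsMarkovKernel κ ∧
      p.law.map (fun v => ((cov v, surr t v), out t v))
        = p.law.map (fun v => (cov v, surr t v)) ⊗ₘ κ ∧
      (p.labelled.restrict (arm t)).map (fun v => ((cov v, surrObs v), outObs v))
        = (p.labelled.restrict (arm t)).map (fun v => (cov v, surrObs v)) ⊗ₘ κ := by
  obtain ⟨κ, hκ, hlaw, hlabelled⟩ := hp.missing_at_random t
  refine ⟨κ, hκ, hp.map_out_eq_compProd_of_restrict_arm hε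
    (map_restrict_eq_compProd_of_cond hlaw.map_eq), ?_⟩
  rw [map_cov_surrObs_restrict_arm, map_cov_surrObs_outObs_restrict_arm]
  exact map_restrict_eq_compProd_of_cond hlabelled.map_eq

lemma withDensity_weight_compProd (hε : 0 < ε) (hp : p.Admissible ε C) (t : Bool)
    (κ : Kernel (𝒳 × 𝒮) ℝ) [IsSFiniteKernel κ] :
    ((p.labelled.restrict (arm t)).map (fun v => (cov v, surrObs v)) ⊗ₘ κ).withDensity
        (fun z => ENNReal.ofReal (p.weight (inArm t z.1)))
      = p.law.map (fun v => (cov v, surr t v)) ⊗ₘ κ := by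
  rw [withDensity_fst_compProd _ κ (p.measurable_ofReal_weight_inArm t),
    hp.withDensity_weight_map_restrict_arm, hp.map_cov_surr_eq_compProd hε]

lemma withDensity_weight_map_out (hε : 0 < ε) (hp : p.Admissible ε C) (t : Bool) :
    ((p.labelled.restrict (arm t)).map fun v => ((cov v, surrObs v), outObs v)).withDensity
        (fun z => ENNReal.ofReal (p.weight (inArm t z.1)))
      = p.law.map fun v => ((cov v, surr t v), out t v) := by
  obtain ⟨κ, hκ, hlaw, hlabelled⟩ := hp.exists_common_outcome_kernel hε t
  rw [hlabelled, hp.withDensity_weight_compProd hε, hlaw]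

lemma map_out_eq_compProd (hε : 0 < ε) (hp : p.Admissible ε C) (t : Bool) :
    p.law.map (fun v => ((cov v, surr t v), out t v))
      = p.law.map (fun v => (cov v, surr t v)) ⊗ₘ
        p.outKernel.comap (inArm t) (measurable_inArm t) := by
  rw [← hp.withDensity_weight_map_out hε, map_restrict_arm_eq_compProd_comap t
    (compProd_map_condDistrib measurable_outObs.aemeasurable).symm,
    hp.withDensity_weight_compProd hε]

lemma setIntegral_weight_mul_sub (hε : 0 < ε) (hp : p.Admissible ε C) (t : Bool)
    {μ : 𝒳 × 𝒮 → ℝ} (hμ : Measurable μ) :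
    ∫ v in arm t, p.weight (covTrtSurr v) * (outObs v - μ (cov v, surrObs v)) ∂p.labelled
      = ∫ v, (out t v - μ (cov v, surr t v)) ∂p.law := by
  have hF : Measurable fun z : (𝒳 × 𝒮) × ℝ => z.2 - μ z.1 :=
    measurable_snd.sub (hμ.comp measurable_fst)
  have hw : Measurable fun z : (𝒳 × 𝒮) × ℝ => ENNReal.ofReal (p.weight (inArm t z.1)) :=
    (p.measurable_ofReal_weight_inArm t).comp measurable_fst
  have hpot : Measurable fun v : FullData 𝒳 𝒮 => ((cov v, surr t v), out t v) := by fun_prop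
  rw [← integral_map (φ := fun v : FullData 𝒳 𝒮 => ((cov v, surr t v), out t v))
      (f := fun z => z.2 - μ z.1) hpot.aemeasurable hF.aestronglyMeasurable,
    ← hp.withDensity_weight_map_out hε t,
    integral_withDensity_eq_integral_toReal_smul hw (ae_of_all _ fun _ => ENNReal.ofReal_lt_top),
    integral_map (by fun_prop) (by exact (hw.ennreal_toReal.smul hF).aestronglyMeasurable)]
  refine integral_congr_ae ?_
  filter_upwards [ae_restrict_arm p.labelled t] with v hv
  simp only [ENNReal.toReal_ofReal (p.weight_nonneg _), smul_eq_mul, covTrtSurr, hv.1, inArm]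

lemma integrable_snd_map_out (hp : p.Admissible ε C) (t : Bool) :
    Integrable (fun z => z.2) (p.law.map fun v => ((cov v, surr t v), out t v)) := by
  rw [integrable_map_measure measurable_snd.aestronglyMeasurable (by fun_prop)]
  exact hp.integrable_out t

lemma integrable_outcomeReg (hε : 0 < ε) (hp : p.Admissible ε C) (t : Bool) :
    Integrable (fun z => p.outcomeReg t z.1 z.2) (p.law.map fun v => (cov v, surr t v)) := by
  have hi := hp.integrable_snd_map_out t
  rw [hp.map_out_eq_compProd hε] at hi
  exact hi.integral_compProd

lemma integral_outcomeReg (hε : 0 < ε) (hp : p.Admissible ε C) (t : Bool) :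
    ∫ z, p.outcomeReg t z.1 z.2 ∂(p.law.map fun v => (cov v, surr t v))
      = ∫ v, out t v ∂p.law := by
  have hi := hp.integrable_snd_map_out t
  have hmap : ∫ z, z.2 ∂(p.law.map fun v => ((cov v, surr t v), out t v)) = ∫ v, out t v ∂p.law :=
    integral_map (by fun_prop) measurable_snd.aestronglyMeasurable
  rw [hp.map_out_eq_compProd hε] at hi hmap
  rw [← hmap, Measure.integral_compProd hi]
  rfl

end Admissible

end Population

end Weights

section InfluenceFunction

lemma map_comp_congr {α β γ : Type*} [MeasurableSpace α] [MeasurableSpace β] [MeasurableSpace γ]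
    {μ ν : Measure α} {f : α → β} {g : β → γ} (hg : Measurable g) (hf : Measurable f)
    (h : μ.map f = ν.map f) : μ.map (g ∘ f) = ν.map (g ∘ f) := by
  rw [← Measure.map_map hg hf, h, Measure.map_map hg hf]

lemma integral_mul_sub_mean {μ : Measure ℝ} [IsProbabilityMeasure μ] {c : ℝ}
    (h : Integrable (fun y => c * (y - ∫ x, x ∂μ)) μ) : ∫ y, c * (y - ∫ x, x ∂μ) ∂μ = 0 := by
  rw [integral_const_mul]
  rcases eq_or_ne c 0 with rfl | hc
  · rw [zero_mul]
  · have hsub : Integrable (fun y => y - ∫ x, x ∂μ) μ := by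
      simpa [hc] using h.const_mul c⁻¹
    have hid : Integrable (fun y : ℝ => y) μ :=
      (hsub.add (integrable_const (∫ x, x ∂μ))).congr (ae_of_all _ fun y => by simp)
    rw [integral_sub hid (integrable_const _)]
    simp

lemma compl_arm_true {𝒳 𝒮 : Type*} : (arm true : Set (FullData 𝒳 𝒮))ᶜ = arm false := by
  ext v
  simp [arm]

variable {𝒳 𝒮 : Type*} [MeasurableSpace 𝒳] [MeasurableSpace 𝒮]

lemma measurableSet_snd_fst_eq (t : Bool) : MeasurableSet {z : 𝒳 × Bool × 𝒮 | z.2.1 = t} :=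
  (measurable_fst.comp measurable_snd) (measurableSet_singleton t)

lemma map_covTrtSurr_eq_add (μ : Measure (FullData 𝒳 𝒮)) :
    μ.map covTrtSurr
      = ((μ.restrict (arm true)).map fun v => (cov v, surrObs v)).map (inArm true)
        + ((μ.restrict (arm false)).map fun v => (cov v, surrObs v)).map (inArm false) := by
  have harm : ∀ t, ((μ.restrict (arm t)).map fun v => (cov v, surrObs v)).map (inArm t)
      = (μ.restrict (arm t)).map covTrtSurr := fun t => by
    rw [Measure.map_map (measurable_inArm t) (by fun_prop)]
    refine Measure.map_congr ?_
    filter_upwards [ae_restrict_arm μ t] with v hv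
    simp [covTrtSurr, inArm, hv.1]
  rw [harm, harm, ← Measure.map_add _ _ measurable_covTrtSurr, ← compl_arm_true,
    Measure.restrict_add_restrict_compl (measurableSet_arm true)]

lemma map_cov_surrObs_restrict_arm_eq_map_covTrtSurr (μ : Measure (FullData 𝒳 𝒮)) (t : Bool) :
    (μ.restrict (arm t)).map (fun v => (cov v, surrObs v))
      = ((μ.map covTrtSurr).restrict {z | z.2.1 = t}).map fun z => (z.1, z.2.2) := by
  rw [Measure.restrict_map measurable_covTrtSurr (measurableSet_snd_fst_eq t),
    Measure.map_map (by fun_prop) measurable_covTrtSurr]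
  rfl

section SameLaw

variable {μ ν : Measure (FullData 𝒳 𝒮)}

lemma map_cov_congr (h : μ.map covTrtSurr = ν.map covTrtSurr) : μ.map cov = ν.map cov :=
  map_comp_congr (f := covTrtSurr) (g := Prod.fst) measurable_fst measurable_covTrtSurr h

lemma map_cov_trt_congr (h : μ.map covTrtSurr = ν.map covTrtSurr) :
    μ.map (fun v => (cov v, trt v)) = ν.map fun v => (cov v, trt v) :=
  map_comp_congr (f := covTrtSurr) (g := fun z => (z.1, z.2.1)) (by fun_prop)
    measurable_covTrtSurr h

lemma measure_arm_congr (h : μ.map covTrtSurr = ν.map covTrtSurr) (t : Bool) :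
    μ (arm t) = ν (arm t) := by
  have harm : (arm t : Set (FullData 𝒳 𝒮)) = covTrtSurr ⁻¹' {z | z.2.1 = t} := rfl
  rw [harm, ← Measure.map_apply measurable_covTrtSurr (measurableSet_snd_fst_eq t), h,
    Measure.map_apply measurable_covTrtSurr (measurableSet_snd_fst_eq t)]

lemma condDistrib_surrObs_congr [StandardBorelSpace 𝒮] [Nonempty 𝒮]
    (h : μ.map covTrtSurr = ν.map covTrtSurr) (t : Bool) :
    condDistrib surrObs cov (ProbabilityTheory.cond μ (arm t))
      = condDistrib surrObs cov (ProbabilityTheory.cond ν (arm t)) := by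
  refine condDistrib_congr_of_map_eq ?_
  simp only [ProbabilityTheory.cond, Measure.map_smul,
    map_cov_surrObs_restrict_arm_eq_map_covTrtSurr, h, measure_arm_congr h t]

end SameLaw

/-- The observation with `(X, T, S) = q.1` and `Y = q.2`. -/
def addOut (q : (𝒳 × Bool × 𝒮) × ℝ) : Obs 𝒳 𝒮 := (q.1.1, q.1.2.1, q.1.2.2, q.2)

@[fun_prop]
lemma measurable_addOut : Measurable (addOut : (𝒳 × Bool × 𝒮) × ℝ → Obs 𝒳 𝒮) := by
  unfold addOut; fun_prop

namespace Population

instance (p : Population 𝒳 𝒮) : IsProbabilityMeasure p.obsLaw :=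
  Measure.isProbabilityMeasure_map measurable_observe.aemeasurable

lemma map_dropOut_obsLaw (p : Population 𝒳 𝒮) :
    p.obsLaw.map dropOut = p.labelled.map covTrtSurr := by
  rw [obsLaw, Measure.map_map measurable_dropOut measurable_observe]
  rfl

lemma obsLaw_eq_map_compProd (p : Population 𝒳 𝒮) :
    p.obsLaw = (p.labelled.map covTrtSurr ⊗ₘ p.outKernel).map addOut := by
  rw [compProd_map_condDistrib measurable_outObs.aemeasurable,
    Measure.map_map measurable_addOut (by fun_prop)]
  rfl

variable [StandardBorelSpace 𝒮] [Nonempty 𝒮]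

lemma ae_integral_psi (p : Population 𝒳 𝒮) (hψ : MemLp p.psi 2 p.obsLaw) :
    ∀ᵐ z ∂(p.labelled.map covTrtSurr),
      ∫ y, p.psi (addOut (z, y)) ∂(p.outKernel z) = 0 := by
  have hint := hψ.integrable one_le_two
  rw [obsLaw_eq_map_compProd] at hint
  replace hint := (integrable_map_measure hint.1 measurable_addOut.aemeasurable).1 hint
  filter_upwards [((Measure.integrable_compProd_iff hint.1).1 hint).1] with z hz
  have hpsi : (fun y => p.psi (addOut (z, y))) = fun y => (p.weight z * armSign z.2.1)
      * (y - ∫ x, x ∂(p.outKernel z)) := by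
    funext y
    rw [psi, weightedResidual_eq, mul_assoc]
    rfl
  simp only [Function.comp_def, hpsi] at hz
  rw [hpsi]
  exact integral_mul_sub_mean hz

lemma integral_mul_psi (p : Population 𝒳 𝒮) (hψ : MemLp p.psi 2 p.obsLaw)
    {φ : 𝒳 × Bool × 𝒮 → ℝ} (hφ : Measurable φ) (hφb : ∃ c, ∀ v, |φ v| ≤ c) :
    ∫ w, φ (dropOut w) * p.psi w ∂p.obsLaw = 0 := by
  obtain ⟨c, hc⟩ := hφb
  have hint : Integrable (fun w => φ (dropOut w) * p.psi w) p.obsLaw :=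
    (hψ.integrable one_le_two).bdd_mul (hφ.comp measurable_dropOut).aestronglyMeasurable
      (ae_of_all _ fun w => hc (dropOut w))
  have hcentred := p.ae_integral_psi hψ
  rw [obsLaw_eq_map_compProd] at hint ⊢
  have hint' : Integrable (fun q => φ (dropOut (addOut q)) * p.psi (addOut q))
      (p.labelled.map covTrtSurr ⊗ₘ p.outKernel) :=
    (integrable_map_measure hint.1 measurable_addOut.aemeasurable).1 hint
  rw [integral_map measurable_addOut.aemeasurable hint.1, Measure.integral_compProd hint']
  refine integral_eq_zero_of_ae ?_
  filter_upwards [hcentred] with z hz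
  have hdrop : ∀ y : ℝ, dropOut (addOut (z, y)) = z := fun _ => rfl
  simp only [hdrop, Pi.zero_apply]
  rw [integral_const_mul, hz, mul_zero]

/-- The law of `(X, T, S)` towards which the weights change the labelled one. It is not
a probability measure: each arm has mass `1`. -/
def targetLaw (p : Population 𝒳 𝒮) : Measure (𝒳 × Bool × 𝒮) :=
  (p.law.map cov ⊗ₘ p.surrKernel true).map (inArm true)
    + (p.law.map cov ⊗ₘ p.surrKernel false).map (inArm false)

lemma targetLaw_congr {p p' : Population 𝒳 𝒮} (h : p.covTrtSurrLaw = p'.covTrtSurrLaw) :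
    p.targetLaw = p'.targetLaw := by
  simp only [targetLaw, surrKernel, map_cov_congr h, condDistrib_surrObs_congr h]

namespace Admissible

variable [StandardBorelSpace 𝒳] {ε C : ℝ} {p p' : Population 𝒳 𝒮}

lemma withDensity_weight (hp : p.Admissible ε C) :
    (p.obsLaw.map dropOut).withDensity (fun z => ENNReal.ofReal (p.weight z)) = p.targetLaw := by
  have hwm := p.measurable_weight.ennreal_ofReal
  rw [map_dropOut_obsLaw, map_covTrtSurr_eq_add, withDensity_add_measure,
    ← map_withDensity_comp (measurable_inArm true) hwm,
    ← map_withDensity_comp (measurable_inArm false) hwm,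
    hp.withDensity_weight_map_restrict_arm true, hp.withDensity_weight_map_restrict_arm false,
    targetLaw]

lemma map_cov_surr_congr (hε : 0 < ε) (hp : p.Admissible ε C) (hp' : p'.Admissible ε C)
    (h : p'.covTrtSurrLaw = p.covTrtSurrLaw) (t : Bool) :
    p'.law.map (fun v => (cov v, surr t v)) = p.law.map fun v => (cov v, surr t v) := by
  rw [hp'.map_cov_surr_eq_compProd hε, hp.map_cov_surr_eq_compProd hε, surrKernel, surrKernel,
    map_cov_congr h, condDistrib_surrObs_congr h]

lemma setIntegral_weightedResidual (hε : 0 < ε) (hp : p.Admissible ε C)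
    (hp' : p'.Admissible ε C) (h : p'.covTrtSurrLaw = p.covTrtSurrLaw) (t : Bool) :
    ∫ v in arm t, p'.weightedResidual p (observe v) ∂p'.labelled
      = armSign t * ((∫ v, out t v ∂p'.law) - ∫ v, out t v ∂p.law) := by
  have hreg : Measurable fun z : 𝒳 × 𝒮 => p.outcomeReg t z.1 z.2 :=
    p.measurable_outcomeReg.comp (measurable_inArm t)
  have hpair : AEMeasurable (fun v : FullData 𝒳 𝒮 => (cov v, surr t v)) p'.law := by fun_prop
  have hlaw := map_cov_surr_congr hε hp hp' h t
  have hint : Integrable (fun v => p.outcomeReg t (cov v) (surr t v)) p'.law :=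
    (integrable_map_measure hreg.aestronglyMeasurable hpair).1
      (hlaw ▸ hp.integrable_outcomeReg hε t)
  have hmean : ∫ v, p.outcomeReg t (cov v) (surr t v) ∂p'.law = ∫ v, out t v ∂p.law := by
    rw [← hp.integral_outcomeReg hε, ← hlaw, integral_map hpair hreg.aestronglyMeasurable]
  rw [← hmean, ← integral_sub (hp'.integrable_out t) hint,
    ← hp'.setIntegral_weight_mul_sub hε t hreg, ← integral_const_mul]
  refine integral_congr_ae ?_
  filter_upwards [ae_restrict_arm p'.labelled t] with v hv
  rw [weightedResidual_eq]
  simp only [signedResidual, dropOut, observe, covTrtSurr, hv.1]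
  ring

lemma ate_sub_ate (hε : 0 < ε) (hp : p.Admissible ε C) (hp' : p'.Admissible ε C)
    (h : p'.covTrtSurrLaw = p.covTrtSurrLaw) (hi : Integrable (p'.weightedResidual p) p'.obsLaw) :
    p'.ate - p.ate = ∫ w, p'.weightedResidual p w ∂p'.obsLaw := by
  have hint : Integrable (fun v => p'.weightedResidual p (observe v)) p'.labelled :=
    (integrable_map_measure hi.1 measurable_observe.aemeasurable).1 hi
  rw [obsLaw, integral_map measurable_observe.aemeasurable
    (p'.measurable_weightedResidual p).aestronglyMeasurable,
    ← integral_add_compl (measurableSet_arm true) hint, compl_arm_true,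
    setIntegral_weightedResidual hε hp hp' h, setIntegral_weightedResidual hε hp hp' h, ate, ate]
  simp only [armSign, if_true, Bool.false_eq_true, if_false]
  ring

lemma eventually_ate_sub_eq_integral (hε : 0 < ε) (hp : p.Admissible ε C)
    {path : ℝ → Population 𝒳 𝒮} (hpath : path ∈ regularSubmodels (model ε C p.covTrtSurrLaw) p) :
    ∀ᶠ γ in 𝓝 (0 : ℝ), (path γ).ate - p.ate
      = ∫ w, (path γ).weightedResidual p w ∂(path γ).obsLaw := by
  obtain ⟨-, hM, B, hB⟩ := hpath
  filter_upwards [hM, hB] with γ hγ hBγ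
  have hm := (path γ).measurable_weightedResidual p
  have hL2 : MemLp ((path γ).weightedResidual p) 2 (path γ).obsLaw := by
    rw [memLp_two_iff_integrable_sq hm.aestronglyMeasurable]
    refine ⟨(hm.pow_const 2).aestronglyMeasurable, ?_⟩
    rw [hasFiniteIntegral_iff_ofReal (ae_of_all _ fun _ => sq_nonneg _)]
    exact hBγ.trans_lt ENNReal.coe_lt_top
  exact ate_sub_ate hε hp hγ.1 hγ.2 (hL2.integrable one_le_two)

theorem isInfluenceFunction_psi (hε : 0 < ε) (hp : p.Admissible ε C)
    (hψ : MemLp p.psi 2 p.obsLaw) :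
    Efficiency.IsInfluenceFunction obsLaw ate p
      (regularSubmodels (model ε C p.covTrtSurrLaw) p) p.psi := by
  refine ⟨hψ, fun path hpath g hg => ?_⟩
  have hate := hp.eventually_ate_sub_eq_integral hε hpath
  obtain ⟨rfl, hM, B, hB⟩ := hpath
  have hpsi : ∀ w, (path 0).weight (dropOut w) * (path 0).signedResidual w = (path 0).psi w :=
    fun w => ((path 0).weightedResidual_eq (path 0) w).symm
  have hlimit := hg.tendsto_integral_weighted_div (π := dropOut) measurable_dropOut
    (w := fun γ => (path γ).weight) (fun γ => (path γ).measurable_weight)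
    (fun γ => (path γ).weight_nonneg) (ν := (path 0).targetLaw)
    (by
      filter_upwards [hM] with γ hγ
      rw [hγ.1.withDensity_weight, targetLaw_congr hγ.2])
    (path 0).measurable_signedResidual (B := B)
    (by simpa only [hpsi] using hψ)
    (by simpa only [weightedResidual_eq] using hB)
    (by
      simp only [hpsi]
      exact fun φ hφ hφb => (path 0).integral_mul_psi hψ hφ hφb)
  simp only [hpsi] at hlimit
  rw [hasDerivAt_iff_tendsto_slope]
  refine hlimit.congr' ?_
  filter_upwards [hate.filter_mono nhdsWithin_le_nhds] with γ hγ
  rw [slope_def_field, sub_zero, hγ]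
  simp only [weightedResidual_eq]

end Admissible

end Population

end InfluenceFunction

section Completion

variable {𝒳 𝒮 : Type*} [MeasurableSpace 𝒳] [MeasurableSpace 𝒮]

/-- The conditional law of `(S(t), Y(t))` given `X` when `S(t)` is drawn from `c t` and then `Y(t)`
from the outcome kernel `K`. -/
def pairKernel (c : Bool → Kernel 𝒳 𝒮) (K : Kernel (𝒳 × Bool × 𝒮) ℝ) (t : Bool) :
    Kernel 𝒳 (𝒮 × ℝ) :=
  c t ⊗ₖ K.comap (inArm t) (measurable_inArm t)

instance (c : Bool → Kernel 𝒳 𝒮) [∀ t, IsMarkovKernel (c t)] (K : Kernel (𝒳 × Bool × 𝒮) ℝ)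
    [IsMarkovKernel K] (t : Bool) : IsMarkovKernel (pairKernel c K t) := by
  unfold pairKernel; infer_instance

lemma lintegral_pairKernel (c : Bool → Kernel 𝒳 𝒮) [∀ t, IsMarkovKernel (c t)]
    (K : Kernel (𝒳 × Bool × 𝒮) ℝ) [IsMarkovKernel K] (t : Bool) (x : 𝒳) {f : 𝒮 × ℝ → ℝ≥0∞}
    (hf : Measurable f) :
    ∫⁻ u, f u ∂(pairKernel c K t x) = ∫⁻ s, ∫⁻ y, f (s, y) ∂(K (x, t, s)) ∂(c t x) := by
  rw [pairKernel, Kernel.lintegral_compProd _ _ _ hf]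
  rfl

open Classical in
/-- The conditional law of the counterfactual pair `(S(1 - T), Y(1 - T))` given `(X, T, S)`; it
ignores `S`. -/
def counterfactualKernel (c : Bool → Kernel 𝒳 𝒮) (K : Kernel (𝒳 × Bool × 𝒮) ℝ) :
    Kernel (𝒳 × Bool × 𝒮) (𝒮 × ℝ) :=
  Kernel.piecewise (measurableSet_snd_fst_eq true)
    ((pairKernel c K false).comap Prod.fst measurable_fst)
    ((pairKernel c K true).comap Prod.fst measurable_fst)

instance (c : Bool → Kernel 𝒳 𝒮) [∀ t, IsMarkovKernel (c t)] (K : Kernel (𝒳 × Bool × 𝒮) ℝ)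
    [IsMarkovKernel K] : IsMarkovKernel (counterfactualKernel c K) := by
  unfold counterfactualKernel; infer_instance

lemma counterfactualKernel_apply (c : Bool → Kernel 𝒳 𝒮) (K : Kernel (𝒳 × Bool × 𝒮) ℝ)
    (x : 𝒳) (t : Bool) (s : 𝒮) :
    counterfactualKernel c K (x, t, s) = pairKernel c K (!t) x := by
  cases t <;> simp [counterfactualKernel, Kernel.piecewise_apply, Kernel.comap_apply]

/-- The complete data with `(X, T, S) = q.1`, actual outcome `q.2.1` and counterfactual pair
`q.2.2`. -/
def assemble (q : (𝒳 × Bool × 𝒮) × ℝ × 𝒮 × ℝ) : FullData 𝒳 𝒮 :=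
  (q.1.1, q.1.2.1, fun b => if b = q.1.2.1 then q.1.2.2 else q.2.2.1,
    fun b => if b = q.1.2.1 then q.2.1 else q.2.2.2)

@[fun_prop]
lemma measurable_assemble : Measurable (assemble : _ → FullData 𝒳 𝒮) := by
  have hactual : ∀ b : Bool, MeasurableSet {q : (𝒳 × Bool × 𝒮) × ℝ × 𝒮 × ℝ | b = q.1.2.1} :=
    fun b => measurableSet_eq_fun measurable_const (by fun_prop)
  exact Measurable.prodMk (by fun_prop) <| Measurable.prodMk (by fun_prop) <| Measurable.prodMk
    (measurable_pi_lambda _ fun b => Measurable.ite (hactual b) (by fun_prop) (by fun_prop))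
    (measurable_pi_lambda _ fun b => Measurable.ite (hactual b) (by fun_prop) (by fun_prop))

/-- The law of complete data with prescribed law `m` of `(X, T, S)`: given `(X, T, S)`, the actual
outcome is drawn from `K` and, independently, the counterfactual pair. -/
def completion (c : Bool → Kernel 𝒳 𝒮) (K : Kernel (𝒳 × Bool × 𝒮) ℝ)
    (m : Measure (𝒳 × Bool × 𝒮)) : Measure (FullData 𝒳 𝒮) :=
  (m ⊗ₘ (K ×ₖ counterfactualKernel c K)).map assemble

lemma completion_add_smul (c : Bool → Kernel 𝒳 𝒮) (K : Kernel (𝒳 × Bool × 𝒮) ℝ)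
    (m₁ m₂ : Measure (𝒳 × Bool × 𝒮)) [SFinite m₁] [SFinite m₂] (a b : ℝ≥0) :
    completion c K (a • m₁ + b • m₂) = a • completion c K m₁ + b • completion c K m₂ := by
  simp only [completion, ENNReal.smul_def, Measure.compProd_add_left,
    Measure.compProd_smul_left, Measure.map_add _ _ measurable_assemble, Measure.map_smul]

variable (c : Bool → Kernel 𝒳 𝒮) [∀ t, IsMarkovKernel (c t)] (K : Kernel (𝒳 × Bool × 𝒮) ℝ)
  [IsMarkovKernel K] (m : Measure (𝒳 × Bool × 𝒮))

instance [IsProbabilityMeasure m] : IsProbabilityMeasure (completion c K m) :=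
  Measure.isProbabilityMeasure_map measurable_assemble.aemeasurable

lemma lintegral_completion [SFinite m] {F : FullData 𝒳 𝒮 → ℝ≥0∞} (hF : Measurable F) :
    ∫⁻ v, F v ∂(completion c K m)
      = ∫⁻ z, ∫⁻ y, ∫⁻ u, F (assemble (z, y, u)) ∂(counterfactualKernel c K z) ∂(K z) ∂m := by
  have hFa : Measurable fun q => F (assemble q) := hF.comp measurable_assemble
  rw [completion, lintegral_map hF measurable_assemble, Measure.lintegral_compProd hFa]
  exact lintegral_congr fun z => Kernel.lintegral_prod _ _ _ (hFa.comp measurable_prodMk_left)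

lemma map_covTrtSurr_outObs_completion [SFinite m] :
    (completion c K m).map (fun v => (covTrtSurr v, outObs v)) = m ⊗ₘ K := by
  refine Measure.ext_of_lintegral _ fun f hf => ?_
  rw [lintegral_map hf (by fun_prop), lintegral_completion c K m (by fun_prop),
    Measure.lintegral_compProd hf]
  simp [assemble, covTrtSurr, cov, trt, surrObs, surr, outObs, out]

lemma map_covTrtSurr_completion [SFinite m] : (completion c K m).map covTrtSurr = m := by
  have hfst := Measure.fst_map_prodMk (X := covTrtSurr) (μ := completion c K m) measurable_outObs
  rw [map_covTrtSurr_outObs_completion, Measure.fst_compProd] at hfst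
  exact hfst.symm

lemma setLIntegral_outcome_eq_setLIntegral_pairKernel [SFinite m] {t : Bool}
    (hm : (m.restrict {z | z.2.1 = t}).map (fun z => (z.1, z.2.2))
      = (m.restrict {z | z.2.1 = t}).map Prod.fst ⊗ₘ c t)
    {f : 𝒳 × 𝒮 × ℝ → ℝ≥0∞} (hf : Measurable f) :
    ∫⁻ z in {z | z.2.1 = t}, ∫⁻ y, f (z.1, z.2.2, y) ∂(K z) ∂m
      = ∫⁻ z in {z | z.2.1 = t}, ∫⁻ u, f (z.1, u) ∂(pairKernel c K t z.1) ∂m := by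
  set A : Set (𝒳 × Bool × 𝒮) := {z | z.2.1 = t}
  have hA : MeasurableSet A := measurableSet_snd_fst_eq t
  have hG : Measurable fun w : 𝒳 × 𝒮 => ∫⁻ y, f (w.1, w.2, y) ∂(K (inArm t w)) :=
    (hf.comp (by fun_prop) : Measurable fun q : (𝒳 × 𝒮) × ℝ => f (q.1.1, q.1.2, q.2))
      |>.lintegral_kernel_prod_right' (κ := K.comap (inArm t) (measurable_inArm t))
  calc ∫⁻ z in A, ∫⁻ y, f (z.1, z.2.2, y) ∂(K z) ∂m
      = ∫⁻ z in A, ∫⁻ y, f (z.1, z.2.2, y) ∂(K (inArm t (z.1, z.2.2))) ∂m := by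
        refine setLIntegral_congr_fun hA ?_
        rintro ⟨x, t', s⟩ (rfl : t' = t)
        rfl
    _ = ∫⁻ w, ∫⁻ y, f (w.1, w.2, y) ∂(K (inArm t w))
          ∂((m.restrict A).map fun z => (z.1, z.2.2)) := (lintegral_map hG (by fun_prop)).symm
    _ = ∫⁻ z in A, ∫⁻ s, ∫⁻ y, f (z.1, s, y) ∂(K (z.1, t, s)) ∂(c t z.1) ∂m := by
        rw [hm, Measure.lintegral_compProd hG,
          lintegral_map hG.lintegral_kernel_prod_right' measurable_fst]
        rfl
    _ = ∫⁻ z in A, ∫⁻ u, f (z.1, u) ∂(pairKernel c K t z.1) ∂m :=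
        lintegral_congr fun z =>
          (lintegral_pairKernel c K t z.1 (hf.comp measurable_prodMk_left)).symm

/-- The potential pair of arm `t` is conditionally independent of the treatment: units of the other
arm draw it afresh from `pairKernel c K t`, and in arm `t` itself it has that conditional law by
`hm`. -/
lemma map_potential_completion [SFinite m] (t : Bool)
    (hm : (m.restrict {z | z.2.1 = t}).map (fun z => (z.1, z.2.2))
      = (m.restrict {z | z.2.1 = t}).map Prod.fst ⊗ₘ c t) :
    (completion c K m).map (fun v => ((cov v, trt v), (surr t v, out t v)))
      = m.map (fun z => (z.1, z.2.1)) ⊗ₘ (pairKernel c K t).prodMkRight Bool := by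
  have hA : MeasurableSet {z : 𝒳 × Bool × 𝒮 | z.2.1 = t} := measurableSet_snd_fst_eq t
  refine Measure.ext_of_lintegral _ fun f hf => ?_
  rw [lintegral_map hf (by fun_prop), lintegral_completion c K m (by fun_prop),
    Measure.lintegral_compProd hf, lintegral_map hf.lintegral_kernel_prod_right' (by fun_prop)]
  simp only [Kernel.prodMkRight_apply]
  rw [← lintegral_add_compl _ hA, ← lintegral_add_compl (μ := m) _ hA]
  congr 1
  · have hf' : Measurable fun q : 𝒳 × 𝒮 × ℝ => f ((q.1, t), q.2) := hf.comp (by fun_prop)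
    refine Eq.trans ?_ ((setLIntegral_outcome_eq_setLIntegral_pairKernel c K m hm hf').trans ?_)
    · refine setLIntegral_congr_fun hA ?_
      rintro ⟨x, t', s⟩ (rfl : t' = t)
      simp [assemble, cov, trt, surr, out]
    · refine setLIntegral_congr_fun hA ?_
      rintro ⟨x, t', s⟩ (rfl : t' = t)
      rfl
  · refine setLIntegral_congr_fun hA.compl ?_
    rintro ⟨x, t', s⟩ (ht : ¬t' = t)
    obtain rfl : t = !t' := by
      cases t <;> cases t' <;> simp_all
    simp [assemble, cov, trt, surr, out, counterfactualKernel_apply]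

end Completion

section Recombination

section CondIndep

variable {Ω α β γ : Type*} [MeasurableSpace Ω] [MeasurableSpace α] [MeasurableSpace β]
  [MeasurableSpace γ] {μ : Measure Ω} [IsFiniteMeasure μ] {f : Ω → β} {g : Ω → γ} {k : Ω → α}
  {D : Kernel α β} [IsMarkovKernel D]

lemma map_eq_compProd_of_map_eq_compProd_prodMkRight (hf : Measurable f) (hg : Measurable g)
    (hk : Measurable k)
    (h : μ.map (fun ω => ((k ω, g ω), f ω)) = μ.map (fun ω => (k ω, g ω)) ⊗ₘ D.prodMkRight γ) :
    μ.map (fun ω => (k ω, f ω)) = μ.map k ⊗ₘ D := by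
  refine Measure.ext_of_lintegral _ fun F hF => ?_
  have hF' : Measurable fun q : (α × γ) × β => F (q.1.1, q.2) := hF.comp (by fun_prop)
  have hlint := congrArg (fun ν => ∫⁻ q, F (q.1.1, q.2) ∂ν) h
  beta_reduce at hlint
  rw [lintegral_map hF' (by fun_prop), Measure.lintegral_compProd hF',
    lintegral_map hF'.lintegral_kernel_prod_right' (by fun_prop)] at hlint
  rw [lintegral_map hF (by fun_prop), Measure.lintegral_compProd hF,
    lintegral_map hF.lintegral_kernel_prod_right' hk]
  exact hlint

lemma condIndepFun_of_map_eq_compProd_prodMkRight [StandardBorelSpace Ω] [StandardBorelSpace β]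
    [Nonempty β] [StandardBorelSpace γ] [Nonempty γ] (hf : Measurable f) (hg : Measurable g)
    (hk : Measurable k)
    (h : μ.map (fun ω => ((k ω, g ω), f ω)) = μ.map (fun ω => (k ω, g ω)) ⊗ₘ D.prodMkRight γ) :
    CondIndepFun (MeasurableSpace.comap k inferInstance) hk.comap_le f g μ := by
  refine CondIndepFun.symm ((condIndepFun_iff_condDistrib_prod_ae_eq_prodMkRight hf hg hk).2 ?_)
  have hjoint : condDistrib f (fun ω => (k ω, g ω)) μ
      =ᵐ[μ.map fun ω => (k ω, g ω)] D.prodMkRight γ :=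
    condDistrib_ae_eq_of_measure_eq_compProd _ hf.aemeasurable h
  have hmarginal : condDistrib f k μ =ᵐ[μ.map k] D :=
    condDistrib_ae_eq_of_measure_eq_compProd k hf.aemeasurable
      (map_eq_compProd_of_map_eq_compProd_prodMkRight hf hg hk h)
  have hfst : (μ.map fun ω => (k ω, g ω)).map Prod.fst = μ.map k :=
    Measure.map_map measurable_fst (by fun_prop)
  rw [← hfst] at hmarginal
  filter_upwards [hjoint, ae_of_ae_map measurable_fst.aemeasurable hmarginal] with q hq hq'
  rw [hq, Kernel.prodMkRight_apply, Kernel.prodMkRight_apply, hq']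

end CondIndep

variable {𝒳 𝒮 : Type*} [MeasurableSpace 𝒳] [MeasurableSpace 𝒮]

lemma hasCondDistrib_cond_arm {m : Measure (FullData 𝒳 𝒮)} [IsFiniteMeasure m]
    {K : Kernel (𝒳 × Bool × 𝒮) ℝ} [IsSFiniteKernel K]
    (h : m.map (fun v => (covTrtSurr v, outObs v)) = m.map covTrtSurr ⊗ₘ K) (t : Bool) :
    HasCondDistrib (out t) (fun v => (cov v, surr t v))
      (K.comap (inArm t) (measurable_inArm t)) (ProbabilityTheory.cond m (arm t)) := by
  have hrestrict := map_restrict_arm_eq_compProd_comap t h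
  rw [map_cov_surrObs_restrict_arm, map_cov_surrObs_outObs_restrict_arm] at hrestrict
  refine ⟨by fun_prop, ?_⟩
  rw [ProbabilityTheory.cond, Measure.map_smul, Measure.map_smul, hrestrict,
    Measure.compProd_smul_left]

namespace Population

lemma covTrtSurrLaw_eq (p : Population 𝒳 𝒮) :
    p.covTrtSurrLaw = p.rate • p.labelled.map covTrtSurr
      + (1 - p.rate) • p.unlabelled.map covTrtSurr := by
  rw [covTrtSurrLaw, law, Measure.map_add _ _ measurable_covTrtSurr, Measure.map_smul,
    Measure.map_smul]

instance (p : Population 𝒳 𝒮) : IsProbabilityMeasure p.covTrtSurrLaw :=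
  Measure.isProbabilityMeasure_map measurable_covTrtSurr.aemeasurable

variable [StandardBorelSpace 𝒮] [Nonempty 𝒮]

/-- The population with the law of `(X, T, S, R)` of `p` in which outcomes are drawn from `K`.
Potential variables of the other arm are drawn independently from the conditional laws under `p`
and `K`, which makes the treatment unconfounded. -/
def recombine (p : Population 𝒳 𝒮) (K : Kernel (𝒳 × Bool × 𝒮) ℝ) [IsMarkovKernel K] :
    Population 𝒳 𝒮 where
  rate := p.rate
  rate_le_one := p.rate_le_one
  labelled := completion p.surrKernel K (p.labelled.map covTrtSurr)
  unlabelled := completion p.surrKernel K (p.unlabelled.map covTrtSurr)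
  isProb_labelled := by
    have : IsProbabilityMeasure (p.labelled.map covTrtSurr) :=
      Measure.isProbabilityMeasure_map measurable_covTrtSurr.aemeasurable
    infer_instance
  isProb_unlabelled := by
    have : IsProbabilityMeasure (p.unlabelled.map covTrtSurr) :=
      Measure.isProbabilityMeasure_map measurable_covTrtSurr.aemeasurable
    infer_instance

section Recombine

variable (p : Population 𝒳 𝒮) (K : Kernel (𝒳 × Bool × 𝒮) ℝ) [IsMarkovKernel K]

lemma law_recombine : (p.recombine K).law = completion p.surrKernel K p.covTrtSurrLaw := by
  rw [covTrtSurrLaw_eq, completion_add_smul]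
  rfl

lemma map_covTrtSurr_law_recombine : (p.recombine K).law.map covTrtSurr = p.law.map covTrtSurr := by
  rw [law_recombine, map_covTrtSurr_completion]
  rfl

lemma map_covTrtSurr_labelled_recombine :
    (p.recombine K).labelled.map covTrtSurr = p.labelled.map covTrtSurr :=
  map_covTrtSurr_completion _ _ _

lemma map_cov_law_recombine : (p.recombine K).law.map cov = p.law.map cov :=
  map_cov_congr (p.map_covTrtSurr_law_recombine K)

lemma map_cov_labelled_recombine : (p.recombine K).labelled.map cov = p.labelled.map cov :=
  map_cov_congr (p.map_covTrtSurr_labelled_recombine K)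

lemma propensity_recombine : (p.recombine K).propensity = p.propensity := by
  funext x
  rw [propensity, propensity, condDistrib_congr_of_map_eq
    (map_cov_trt_congr (p.map_covTrtSurr_law_recombine K))]

lemma propensityLabelled_recombine :
    (p.recombine K).propensityLabelled = p.propensityLabelled := by
  funext x
  rw [propensityLabelled, propensityLabelled, condDistrib_congr_of_map_eq
    (map_cov_trt_congr (p.map_covTrtSurr_labelled_recombine K))]

lemma ratioCov_recombine : (p.recombine K).ratioCov = p.ratioCov := by
  funext x
  rw [ratioCov, ratioCov, map_cov_law_recombine, map_cov_labelled_recombine]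

lemma surrKernel_recombine (t : Bool) : (p.recombine K).surrKernel t = p.surrKernel t :=
  condDistrib_surrObs_congr (p.map_covTrtSurr_law_recombine K) t

lemma surrKernelLabelled_recombine (t : Bool) :
    (p.recombine K).surrKernelLabelled t = p.surrKernelLabelled t :=
  condDistrib_surrObs_congr (p.map_covTrtSurr_labelled_recombine K) t

lemma ratioSurr_recombine (t : Bool) : (p.recombine K).ratioSurr t = p.ratioSurr t := by
  funext s x
  rw [ratioSurr, ratioSurr, surrKernel_recombine, surrKernelLabelled_recombine]

lemma weightedResidual_recombine : (p.recombine K).weightedResidual p = p.psi := by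
  funext ⟨x, t, s, y⟩
  simp only [psi, weightedResidual, ratioCov_recombine, ratioSurr_recombine,
    propensityLabelled_recombine]

lemma obsLaw_recombine :
    (p.recombine K).obsLaw = (p.labelled.map covTrtSurr ⊗ₘ K).map addOut := by
  rw [← map_covTrtSurr_outObs_completion p.surrKernel K (p.labelled.map covTrtSurr),
    Measure.map_map measurable_addOut (by fun_prop)]
  rfl

lemma map_potential_law_recombine (t : Bool) :
    (p.recombine K).law.map (fun v => ((cov v, trt v), (surr t v, out t v)))
      = (p.recombine K).law.map (fun v => (cov v, trt v))
        ⊗ₘ (pairKernel p.surrKernel K t).prodMkRight Bool := by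
  rw [map_cov_trt_congr (p.map_covTrtSurr_law_recombine K), law_recombine,
    map_potential_completion p.surrKernel K p.covTrtSurrLaw t, covTrtSurrLaw,
    Measure.map_map (by fun_prop) measurable_covTrtSurr]
  · rfl
  · have harm := map_restrict_eq_compProd_of_cond (μ := p.law) (s := arm t) (X := cov)
      (Y := surrObs) (κ := p.surrKernel t)
      (compProd_map_condDistrib measurable_surrObs.aemeasurable).symm
    rw [map_cov_surrObs_restrict_arm_eq_map_covTrtSurr] at harm
    rw [covTrtSurrLaw, harm, Measure.restrict_map measurable_covTrtSurr
      (measurableSet_snd_fst_eq t), Measure.map_map measurable_fst measurable_covTrtSurr]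
    rfl

lemma map_cov_potential_law_recombine (t : Bool) :
    (p.recombine K).law.map (fun v => (cov v, (surr t v, out t v)))
      = p.law.map cov ⊗ₘ pairKernel p.surrKernel K t := by
  rw [← p.map_cov_law_recombine K]
  exact map_eq_compProd_of_map_eq_compProd_prodMkRight (by fun_prop) measurable_trt measurable_cov
    (p.map_potential_law_recombine K t)

lemma lintegral_enorm_out_law_recombine (t : Bool) :
    ∫⁻ v, ‖out t v‖ₑ ∂(p.recombine K).law
      = ∫⁻ z, ∫⁻ y, ‖y‖ₑ ∂(K (inArm t z)) ∂(p.law.map cov ⊗ₘ p.surrKernel t) := by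
  have hf : Measurable fun q : 𝒳 × 𝒮 × ℝ => ‖q.2.2‖ₑ := by fun_prop
  have hK : Measurable fun z : 𝒳 × 𝒮 => ∫⁻ y, ‖y‖ₑ ∂(K (inArm t z)) :=
    (measurable_enorm.lintegral_kernel (κ := K)).comp (measurable_inArm t)
  calc ∫⁻ v, ‖out t v‖ₑ ∂(p.recombine K).law
      = ∫⁻ q, ‖q.2.2‖ₑ ∂(p.law.map cov ⊗ₘ pairKernel p.surrKernel K t) := by
        rw [← map_cov_potential_law_recombine, lintegral_map hf (by fun_prop)]
    _ = ∫⁻ z, ∫⁻ y, ‖y‖ₑ ∂(K (inArm t z)) ∂(p.law.map cov ⊗ₘ p.surrKernel t) := by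
        rw [Measure.lintegral_compProd hf, Measure.lintegral_compProd hK]
        exact lintegral_congr fun x => lintegral_pairKernel p.surrKernel K t x (by fun_prop)

lemma condIndepFun_potential_trt_recombine [StandardBorelSpace 𝒳] (t : Bool) :
    CondIndepFun (MeasurableSpace.comap cov inferInstance) measurable_cov.comap_le
      (fun v => (out t v, surr t v)) trt (p.recombine K).law :=
  (condIndepFun_of_map_eq_compProd_prodMkRight (by fun_prop) measurable_trt measurable_cov
    (p.map_potential_law_recombine K t)).comp measurable_swap measurable_id

end Recombine

lemma Admissible.recombine [StandardBorelSpace 𝒳] {ε C : ℝ} {p : Population 𝒳 𝒮} (hε : 0 < ε)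
    (hp : p.Admissible ε C) (K : Kernel (𝒳 × Bool × 𝒮) ℝ) [IsMarkovKernel K]
    (hK : ∀ t, ∫⁻ z, ∫⁻ y, ‖y‖ₑ ∂(K (inArm t z)) ∂(p.law.map fun v => (cov v, surr t v)) < ∞) :
    (p.recombine K).Admissible ε C where
  integrable_out t := by
    refine ⟨(measurable_out t).aestronglyMeasurable, ?_⟩
    rw [HasFiniteIntegral, lintegral_enorm_out_law_recombine, ← hp.map_cov_surr_eq_compProd hε]
    exact hK t
  unconfounded_trt := p.condIndepFun_potential_trt_recombine K
  missing_at_random t := by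
    refine ⟨K.comap (inArm t) (measurable_inArm t), inferInstance,
      hasCondDistrib_cond_arm ?_ t, hasCondDistrib_cond_arm ?_ t⟩
    · rw [map_covTrtSurr_law_recombine, law_recombine, map_covTrtSurr_outObs_completion]
      rfl
    · rw [map_covTrtSurr_labelled_recombine]
      exact map_covTrtSurr_outObs_completion _ _ _
  overlap := by
    rw [map_cov_law_recombine, propensity_recombine]
    exact hp.overlap
  ratioCov_ac := by
    rw [map_cov_law_recombine, map_cov_labelled_recombine]
    exact hp.ratioCov_ac
  ratioCov_le := by
    rw [map_cov_law_recombine, ratioCov_recombine]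
    exact hp.ratioCov_le
  overlap_labelled := by
    rw [map_cov_law_recombine, propensityLabelled_recombine]
    exact hp.overlap_labelled
  ratioSurr_ac t := by
    rw [map_cov_law_recombine, surrKernel_recombine, surrKernelLabelled_recombine]
    exact hp.ratioSurr_ac t
  ratioSurr_le t := by
    rw [map_cov_law_recombine, surrKernel_recombine, ratioSurr_recombine]
    exact hp.ratioSurr_le t

end Population

end Recombination

section OutcomeTilt

section Tilt

variable {α β : Type*} [MeasurableSpace α] [MeasurableSpace β]

/-- The linear tilt of a kernel by a function `h`. It is a Markov kernel if `h` has conditional mean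
`0` and `|γ * h| ≤ 1`. -/
def tilt (κ : Kernel α β) [IsSFiniteKernel κ] (h : α × β → ℝ) (γ : ℝ) : Kernel α β :=
  κ.withDensity fun a b => ENNReal.ofReal (1 + γ * h (a, b))

/-- The functions by which a kernel is tilted: they are bounded by `c` and have conditional mean
`0`. -/
structure IsTiltDirection (κ : Kernel α β) (c : ℝ) (h : α × β → ℝ) : Prop where
  measurable : Measurable h
  abs_le : ∀ q, |h q| ≤ c
  integral_eq_zero : ∀ a, ∫ b, h (a, b) ∂(κ a) = 0

lemma one_add_mul_mem_Icc {γ c x : ℝ} (hγ : |γ| * c ≤ 1) (hx : |x| ≤ c) :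
    1 + γ * x ∈ Set.Icc 0 2 := by
  have habs : |γ * x| ≤ 1 := by
    rw [abs_mul]
    exact (mul_le_mul_of_nonneg_left hx (abs_nonneg _)).trans hγ
  obtain ⟨hlo, hhi⟩ := abs_le.1 habs
  constructor <;> linarith

lemma eventually_abs_mul_le_one (c : ℝ) : ∀ᶠ γ : ℝ in 𝓝 0, |γ| * c ≤ 1 := by
  have hcont : Continuous fun γ : ℝ => |γ| * c := by fun_prop
  exact (hcont.tendsto' 0 0 (by simp)).eventually_le_const one_pos

lemma withDensity_one_add_mul_le {μ : Measure α} {h : α → ℝ} {c γ : ℝ} (hc : ∀ a, |h a| ≤ c)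
    (hγ : |γ| * c ≤ 1) :
    μ.withDensity (fun a => ENNReal.ofReal (1 + γ * h a)) ≤ (2 : ℝ≥0∞) • μ := by
  rw [← withDensity_const]
  refine withDensity_mono (ae_of_all _ fun a => ?_)
  rw [← ENNReal.ofReal_ofNat]
  exact ENNReal.ofReal_le_ofReal (one_add_mul_mem_Icc hγ (hc a)).2

section Kernel

variable {κ : Kernel α β} {h : α × β → ℝ} {γ : ℝ}

lemma measurable_ofReal_one_add_mul (hh : Measurable h) (γ : ℝ) :
    Measurable (Function.uncurry fun a b => ENNReal.ofReal (1 + γ * h (a, b))) :=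
  ((hh.const_mul γ).const_add 1).ennreal_ofReal

lemma tilt_apply [IsSFiniteKernel κ] (hh : Measurable h) (γ : ℝ) (a : α) :
    tilt κ h γ a = (κ a).withDensity fun b => ENNReal.ofReal (1 + γ * h (a, b)) :=
  Kernel.withDensity_apply κ (measurable_ofReal_one_add_mul hh γ) a

lemma compProd_tilt [IsSFiniteKernel κ] (μ : Measure α) [SFinite μ] (hh : Measurable h)
    [hs : IsSFiniteKernel (tilt κ h γ)] :
    μ ⊗ₘ tilt κ h γ = (μ ⊗ₘ κ).withDensity fun q => ENNReal.ofReal (1 + γ * h q) := by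
  have : IsSFiniteKernel (κ.withDensity fun a b => ENNReal.ofReal (1 + γ * h (a, b))) := hs
  exact Measure.compProd_withDensity (measurable_ofReal_one_add_mul hh γ)

namespace IsTiltDirection

variable [IsMarkovKernel κ] {c : ℝ}

lemma integrable (hh : IsTiltDirection κ c h) (a : α) : Integrable (fun b => h (a, b)) (κ a) :=
  .of_bound (hh.measurable.comp measurable_prodMk_left).aestronglyMeasurable c
    (ae_of_all _ fun b => hh.abs_le (a, b))

lemma isMarkovKernel_tilt (hh : IsTiltDirection κ c h) (hγ : |γ| * c ≤ 1) :
    IsMarkovKernel (tilt κ h γ) := by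
  refine ⟨fun a => ⟨?_⟩⟩
  have hint : Integrable (fun b => γ * h (a, b)) (κ a) := (hh.integrable a).const_mul γ
  have hint' : Integrable (fun b => 1 + γ * h (a, b)) (κ a) := (integrable_const 1).add hint
  rw [tilt_apply hh.measurable, withDensity_apply _ MeasurableSet.univ, Measure.restrict_univ,
    ← ofReal_integral_eq_lintegral_ofReal hint'
      (ae_of_all _ fun b => (one_add_mul_mem_Icc hγ (hh.abs_le _)).1),
    integral_add (integrable_const 1) hint, integral_const_mul, hh.integral_eq_zero]
  simp

lemma tilt_apply_le (hh : IsTiltDirection κ c h) (hγ : |γ| * c ≤ 1) (a : α) :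
    tilt κ h γ a ≤ (2 : ℝ≥0∞) • κ a := by
  rw [tilt_apply hh.measurable]
  exact withDensity_one_add_mul_le (fun b => hh.abs_le (a, b)) hγ

end IsTiltDirection

end Kernel

lemma integral_sq_sub_centred_le {μ : Measure β} [IsProbabilityMeasure μ] {f u : β → ℝ}
    (hf : Integrable f μ) (hu : Integrable u μ) (hf₀ : ∫ y, f y ∂μ = 0) :
    ∫ y, (f y - (u y - ∫ x, u x ∂μ)) ^ 2 ∂μ ≤ ∫ y, (f y - u y) ^ 2 ∂μ := by
  have hsub : Integrable (fun y => f y - u y) μ := hf.sub hu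
  have hmean : ∫ y, (f y - u y) ∂μ = -∫ x, u x ∂μ := by
    rw [integral_sub hf hu, hf₀, zero_sub]
  calc ∫ y, (f y - (u y - ∫ x, u x ∂μ)) ^ 2 ∂μ
      = variance (fun y => f y - u y) μ := by
        rw [variance_eq_integral hsub.aemeasurable, hmean]
        simp only [sub_neg_eq_add, sub_add]
    _ ≤ ∫ y, (f y - u y) ^ 2 ∂μ := variance_le_expectation_sq hsub.aestronglyMeasurable

lemma isTiltDirection_sub_integral {κ : Kernel α β} [IsMarkovKernel κ] {u : α × β → ℝ}
    (hu : Measurable u) {M : ℝ} (hM : ∀ q, |u q| ≤ M) :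
    IsTiltDirection κ (M + M) fun q => u q - ∫ y, u (q.1, y) ∂(κ q.1) where
  measurable := hu.sub
    ((hu.stronglyMeasurable.integral_kernel_prod_right' (κ := κ)).measurable.comp measurable_fst)
  abs_le q := by
    have hmean : |∫ y, u (q.1, y) ∂(κ q.1)| ≤ M := by
      simpa using norm_integral_le_of_norm_le_const (μ := κ q.1) (f := fun y => u (q.1, y))
        (ae_of_all _ fun y => hM (q.1, y))
    exact (abs_sub _ _).trans (add_le_add (hM q) hmean)
  integral_eq_zero a := by
    have hint : Integrable (fun y => u (a, y)) (κ a) :=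
      .of_bound (hu.comp measurable_prodMk_left).aestronglyMeasurable M
        (ae_of_all _ fun y => hM (a, y))
    change ∫ b, (u (a, b) - ∫ y, u (a, y) ∂(κ a)) ∂(κ a) = 0
    rw [integral_sub hint (integrable_const _)]
    simp

lemma integral_sq_sub_centred_compProd_le {m : Measure α} [IsFiniteMeasure m] {κ : Kernel α β}
    [IsMarkovKernel κ] {ψ u : α × β → ℝ} (hψ : MemLp ψ 2 (m ⊗ₘ κ))
    (hψ₀ : ∀ᵐ a ∂m, ∫ b, ψ (a, b) ∂(κ a) = 0) (hu : Measurable u) {M : ℝ}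
    (hM : ∀ q, |u q| ≤ M) :
    ∫ q, (ψ q - (u q - ∫ y, u (q.1, y) ∂(κ q.1))) ^ 2 ∂(m ⊗ₘ κ)
      ≤ ∫ q, (ψ q - u q) ^ 2 ∂(m ⊗ₘ κ) := by
  have hdir := isTiltDirection_sub_integral (κ := κ) hu hM
  have hleft : Integrable (fun q => (ψ q - (u q - ∫ y, u (q.1, y) ∂(κ q.1))) ^ 2) (m ⊗ₘ κ) :=
    (hψ.sub (.of_bound hdir.measurable.aestronglyMeasurable _
      (ae_of_all _ hdir.abs_le))).integrable_sq
  have hright : Integrable (fun q => (ψ q - u q) ^ 2) (m ⊗ₘ κ) :=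
    (hψ.sub (.of_bound hu.aestronglyMeasurable M (ae_of_all _ hM))).integrable_sq
  have hψint := hψ.integrable one_le_two
  rw [Measure.integral_compProd hleft, Measure.integral_compProd hright]
  refine integral_mono_ae hleft.integral_compProd hright.integral_compProd ?_
  filter_upwards [hψ₀, ((Measure.integrable_compProd_iff hψint.1).1 hψint).1] with a ha hint
  exact integral_sq_sub_centred_le hint
    (.of_bound (hu.comp measurable_prodMk_left).aestronglyMeasurable M
      (ae_of_all _ fun b => hM (a, b))) ha

/-- The approximation truncates `ψ` and recentres the truncation, which by the variance bound does
not increase the distance to the centred function `ψ`. -/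
lemma exists_isTiltDirection_integral_sq_sub_lt {m : Measure α} [IsFiniteMeasure m]
    {κ : Kernel α β} [IsMarkovKernel κ] {ψ : α × β → ℝ} (hψm : Measurable ψ)
    (hψ : MemLp ψ 2 (m ⊗ₘ κ)) (hψ₀ : ∀ᵐ a ∂m, ∫ b, ψ (a, b) ∂(κ a) = 0) {η : ℝ} (hη : 0 < η) :
    ∃ c h, IsTiltDirection κ c h ∧ ∫ q, (ψ q - h q) ^ 2 ∂(m ⊗ₘ κ) < η := by
  obtain ⟨M, hM⟩ := ((Efficiency.tendsto_integral_sq_indicator_lt_abs hψ).eventually_lt_const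
    hη).exists
  set large : Set (α × β) := {q | (M : ℝ) < |ψ q|}
  have hum : Measurable fun q => ψ q - large.indicator ψ q :=
    hψm.sub (hψm.indicator (measurableSet_lt measurable_const hψm.abs))
  have hub : ∀ q, |ψ q - large.indicator ψ q| ≤ M := fun q => by
    by_cases hq : q ∈ large
    · simp [Set.indicator_of_mem hq]
    · rw [Set.indicator_of_notMem hq, sub_zero]
      exact not_lt.1 hq
  refine ⟨_, _, isTiltDirection_sub_integral hum hub, ?_⟩
  refine (integral_sq_sub_centred_compProd_le hψ hψ₀ hum hub).trans_lt ?_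
  simpa only [sub_sub_cancel] using hM

end Tilt

variable {𝒳 𝒮 : Type*} [MeasurableSpace 𝒳] [MeasurableSpace 𝒮]

namespace Population

/-- The inverse of `addOut`. -/
def splitOut (w : Obs 𝒳 𝒮) : (𝒳 × Bool × 𝒮) × ℝ := (dropOut w, w.2.2.2)

@[fun_prop]
lemma measurable_splitOut : Measurable (splitOut : Obs 𝒳 𝒮 → (𝒳 × Bool × 𝒮) × ℝ) := by
  unfold splitOut; fun_prop

variable [StandardBorelSpace 𝒮] [Nonempty 𝒮]

lemma obsLaw_recombine_tilt (p : Population 𝒳 𝒮) {h : (𝒳 × Bool × 𝒮) × ℝ → ℝ}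
    (hh : Measurable h) (γ : ℝ) [IsMarkovKernel (tilt p.outKernel h γ)] :
    (p.recombine (tilt p.outKernel h γ)).obsLaw
      = p.obsLaw.withDensity fun w => ENNReal.ofReal (1 + γ * h (splitOut w)) := by
  have hdensity : Measurable fun w : Obs 𝒳 𝒮 => ENNReal.ofReal (1 + γ * h (splitOut w)) :=
    (((hh.comp measurable_splitOut).const_mul γ).const_add 1).ennreal_ofReal
  rw [obsLaw_recombine, obsLaw_eq_map_compProd, ← map_withDensity_comp measurable_addOut hdensity,
    compProd_tilt _ hh]
  rfl

open Classical in
/-- The submodel that tilts the conditional law of the outcome linearly by `h`. It is set to `p` at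
`γ = 0` because `p` need not be recombined from its own outcome kernel. -/
def tiltPath (p : Population 𝒳 𝒮) (h : (𝒳 × Bool × 𝒮) × ℝ → ℝ) (γ : ℝ) : Population 𝒳 𝒮 :=
  if hγ : γ ≠ 0 ∧ IsMarkovKernel (tilt p.outKernel h γ) then
    haveI := hγ.2
    p.recombine (tilt p.outKernel h γ)
  else p

lemma tiltPath_zero (p : Population 𝒳 𝒮) (h : (𝒳 × Bool × 𝒮) × ℝ → ℝ) : p.tiltPath h 0 = p := by
  simp [tiltPath]

lemma weightedResidual_tiltPath (p : Population 𝒳 𝒮) (h : (𝒳 × Bool × 𝒮) × ℝ → ℝ) (γ : ℝ) :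
    (p.tiltPath h γ).weightedResidual p = p.psi := by
  rw [tiltPath]
  split_ifs with hγ
  · have := hγ.2
    exact weightedResidual_recombine p _
  · rfl

variable {p : Population 𝒳 𝒮} {h : (𝒳 × Bool × 𝒮) × ℝ → ℝ} {c γ : ℝ}

lemma tiltPath_cases (hh : IsTiltDirection p.outKernel c h) (hγ : |γ| * c ≤ 1) :
    (γ = 0 ∧ p.tiltPath h γ = p) ∨ ∃ _ : IsMarkovKernel (tilt p.outKernel h γ),
      p.tiltPath h γ = p.recombine (tilt p.outKernel h γ) := by
  rcases eq_or_ne γ 0 with rfl | hne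
  · exact Or.inl ⟨rfl, p.tiltPath_zero h⟩
  · have hmarkov := hh.isMarkovKernel_tilt hγ
    exact Or.inr ⟨hmarkov, by rw [tiltPath, dif_pos ⟨hne, hmarkov⟩]⟩

lemma obsLaw_tiltPath (hh : IsTiltDirection p.outKernel c h) (hγ : |γ| * c ≤ 1) :
    (p.tiltPath h γ).obsLaw
      = p.obsLaw.withDensity fun w => ENNReal.ofReal (1 + γ * h (splitOut w)) := by
  rcases tiltPath_cases hh hγ with ⟨rfl, hpath⟩ | ⟨_, hpath⟩
  · rw [hpath]
    simp [withDensity_const]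
  · rw [hpath, obsLaw_recombine_tilt p hh.measurable]

lemma hasScore_tiltPath (hh : IsTiltDirection p.outKernel c h) :
    Efficiency.HasScore (fun γ => (p.tiltPath h γ).obsLaw) fun w => h (splitOut w) := by
  refine Efficiency.hasScore_of_eventually_withDensity (hh.measurable.comp measurable_splitOut)
    (fun w => hh.abs_le (splitOut w)) ?_
  filter_upwards [eventually_abs_mul_le_one c] with γ hγ
  rw [obsLaw_tiltPath hh hγ, tiltPath_zero]

lemma exists_isTiltDirection_integral_sq_psi_sub_lt (hψ : MemLp p.psi 2 p.obsLaw) {η : ℝ}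
    (hη : 0 < η) :
    ∃ c h, IsTiltDirection p.outKernel c h ∧
      ∫ w, (p.psi w - h (splitOut w)) ^ 2 ∂p.obsLaw < η := by
  have hψm : Measurable p.psi := p.measurable_weightedResidual p
  have hψ' : MemLp (p.psi ∘ addOut) 2 (p.labelled.map covTrtSurr ⊗ₘ p.outKernel) := by
    rw [obsLaw_eq_map_compProd] at hψ
    exact hψ.comp_of_map measurable_addOut.aemeasurable
  obtain ⟨c, h, hh, hlt⟩ := exists_isTiltDirection_integral_sq_sub_lt
    (hψm.comp measurable_addOut) hψ' (p.ae_integral_psi hψ) hη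
  refine ⟨c, h, hh, ?_⟩
  have hdist : Measurable fun w => (p.psi w - h (splitOut w)) ^ 2 :=
    (hψm.sub (hh.measurable.comp measurable_splitOut)).pow_const 2
  rw [obsLaw_eq_map_compProd, integral_map measurable_addOut.aemeasurable
    hdist.aestronglyMeasurable]
  exact hlt

lemma lintegral_sq_weightedResidual_tiltPath_le (hh : IsTiltDirection p.outKernel c h)
    (hγ : |γ| * c ≤ 1) :
    ∫⁻ w, ENNReal.ofReal ((p.tiltPath h γ).weightedResidual p w ^ 2) ∂(p.tiltPath h γ).obsLaw
      ≤ 2 * ∫⁻ w, ENNReal.ofReal (p.psi w ^ 2) ∂p.obsLaw := by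
  rw [weightedResidual_tiltPath, obsLaw_tiltPath hh hγ, ← smul_eq_mul, ← lintegral_smul_measure]
  exact lintegral_mono' (withDensity_one_add_mul_le (fun w => hh.abs_le (splitOut w)) hγ) le_rfl

namespace Admissible

variable [StandardBorelSpace 𝒳] {ε C : ℝ}

lemma lintegral_enorm_outKernel_lt_top (hε : 0 < ε) (hp : p.Admissible ε C) (t : Bool) :
    ∫⁻ z, ∫⁻ y, ‖y‖ₑ ∂(p.outKernel (inArm t z)) ∂(p.law.map fun v => (cov v, surr t v)) < ∞ := by
  have hfin := (hp.integrable_snd_map_out t).2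
  rwa [hp.map_out_eq_compProd hε, HasFiniteIntegral,
    Measure.lintegral_compProd (by fun_prop)] at hfin

lemma recombine_tilt (hε : 0 < ε) (hp : p.Admissible ε C) (hh : IsTiltDirection p.outKernel c h)
    (hγ : |γ| * c ≤ 1) [IsMarkovKernel (tilt p.outKernel h γ)] :
    (p.recombine (tilt p.outKernel h γ)).Admissible ε C := by
  refine hp.recombine hε _ fun t => ?_
  have hmeas : Measurable fun z : 𝒳 × 𝒮 => ∫⁻ y, ‖y‖ₑ ∂(p.outKernel (inArm t z)) :=
    (measurable_enorm.lintegral_kernel (κ := p.outKernel)).comp (measurable_inArm t)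
  calc ∫⁻ z, ∫⁻ y, ‖y‖ₑ ∂(tilt p.outKernel h γ (inArm t z))
        ∂(p.law.map fun v => (cov v, surr t v))
      ≤ ∫⁻ z, 2 * ∫⁻ y, ‖y‖ₑ ∂(p.outKernel (inArm t z))
          ∂(p.law.map fun v => (cov v, surr t v)) := lintegral_mono fun z => by
        rw [← smul_eq_mul, ← lintegral_smul_measure]
        exact lintegral_mono' (hh.tilt_apply_le hγ _) le_rfl
    _ = 2 * ∫⁻ z, ∫⁻ y, ‖y‖ₑ ∂(p.outKernel (inArm t z))
          ∂(p.law.map fun v => (cov v, surr t v)) := lintegral_const_mul _ hmeas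
    _ < ∞ := ENNReal.mul_lt_top ENNReal.ofNat_lt_top (hp.lintegral_enorm_outKernel_lt_top hε t)

lemma tiltPath_mem_model (hε : 0 < ε) (hp : p.Admissible ε C)
    (hh : IsTiltDirection p.outKernel c h) (hγ : |γ| * c ≤ 1) :
    p.tiltPath h γ ∈ model ε C p.covTrtSurrLaw := by
  rcases tiltPath_cases hh hγ with ⟨-, hpath⟩ | ⟨_, hpath⟩
  · rw [hpath]
    exact ⟨hp, rfl⟩
  · rw [hpath]
    exact ⟨hp.recombine_tilt hε hh hγ, p.map_covTrtSurr_law_recombine _⟩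

lemma tiltPath_mem_regularSubmodels (hε : 0 < ε) (hp : p.Admissible ε C)
    (hψ : MemLp p.psi 2 p.obsLaw) (hh : IsTiltDirection p.outKernel c h) :
    p.tiltPath h ∈ regularSubmodels (model ε C p.covTrtSurrLaw) p := by
  have hfin : ∫⁻ w, ENNReal.ofReal (p.psi w ^ 2) ∂p.obsLaw < ∞ := by
    rw [← hasFiniteIntegral_iff_ofReal (ae_of_all _ fun _ => sq_nonneg _)]
    exact hψ.integrable_sq.2
  refine ⟨p.tiltPath_zero h, ?_, (2 * ∫⁻ w, ENNReal.ofReal (p.psi w ^ 2) ∂p.obsLaw).toNNReal, ?_⟩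
  · exact (eventually_abs_mul_le_one c).mono fun γ hγ => hp.tiltPath_mem_model hε hh hγ
  · rw [ENNReal.coe_toNNReal (ENNReal.mul_ne_top ENNReal.ofNat_ne_top hfin.ne)]
    exact (eventually_abs_mul_le_one c).mono fun γ hγ =>
      lintegral_sq_weightedResidual_tiltPath_le hh hγ

lemma exists_mem_tangentSet_integral_sq_sub_lt (hε : 0 < ε) (hp : p.Admissible ε C)
    (hψ : MemLp p.psi 2 p.obsLaw) {η : ℝ} (hη : 0 < η) :
    ∃ g ∈ Efficiency.tangentSet obsLaw (regularSubmodels (model ε C p.covTrtSurrLaw) p),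
      ∫ w, (p.psi w - g w) ^ 2 ∂p.obsLaw < η := by
  obtain ⟨c, h, hh, hlt⟩ := exists_isTiltDirection_integral_sq_psi_sub_lt hψ hη
  exact ⟨_, ⟨p.tiltPath h, hp.tiltPath_mem_regularSubmodels hε hψ hh, hasScore_tiltPath hh⟩, hlt⟩

end Admissible

end Population

end OutcomeTilt

end Surrogate

end

theorem theorem10 {𝒳 𝒮 : Type*} [MeasurableSpace 𝒳] [StandardBorelSpace 𝒳]
    [MeasurableSpace 𝒮] [StandardBorelSpace 𝒮] [Nonempty 𝒮]
    (ε C : ℝ) (hε : 0 < ε) (hε' : ε < 1 / 2) (hC : 0 < C)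
    (p : Surrogate.Population 𝒳 𝒮) (hp : p.Admissible ε C)
    (hψ : MemLp p.psi 2 p.obsLaw) :
    Efficiency.IsEfficientInfluenceFunction
      Surrogate.Population.obsLaw Surrogate.Population.ate p
      (Surrogate.Population.regularSubmodels
        (Surrogate.Population.model ε C p.covTrtSurrLaw) p) p.psi ∧
    Efficiency.efficiencyLowerBound
      Surrogate.Population.obsLaw Surrogate.Population.ate p
      (Surrogate.Population.regularSubmodels
        (Surrogate.Population.model ε C p.covTrtSurrLaw) p) =
      ENNReal.ofReal (∫ w, p.psi w ^ 2 ∂p.obsLaw) := by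
  have hψ' := hp.isInfluenceFunction_psi hε hψ
  have happrox := fun η hη => hp.exists_mem_tangentSet_integral_sq_sub_lt hε hψ (η := η) hη
  exact ⟨hψ'.isEfficientInfluenceFunction_of_approx (fun _ h => h.1) happrox,
    hψ'.efficiencyLowerBound_eq_of_approx (fun _ h => h.1) happrox⟩
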